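/- Identify $\mathbb{R}^2$ with $\mathbb{C}$. A Lipschitz-starlike plane domain is a set $\Omega=\{re^{i\theta}:0\le r<R(\theta)\}$ whose radius function $R:\mathbb{R}\to(0,\infty)$ is $2\pi$-periodic and Lipschitz continuous. Let $A=A(\Omega)$ be its area and $G=G(\Omega)=\max\{G_0,G_1\}$, where \[ G_0=1+\frac1{2\pi}\int_0^{2\pi}\big((\log R)'(\theta)\big)^2\,d\theta,\qquad G_1=\frac{\frac1{2\pi}\int_0^{2\pi}R(\theta)^4\,d\theta}{\big(\frac1{2\pi}\int_0^{2\pi}R(\theta)^2\,d\theta\big)^2}. \] Fix a real number $\beta\neq0$ (the same flux for all domains) and put $F(x)=\frac{\beta}{2A}(-x_2,x_1)$. The Neumann eigenvalues $\mu_1\le\mu_2\le\mu_3\le\cdots$ of the magnetic Laplacian $(i\nabla+F)^2$ on $\Omega$, repeated according to multiplicity, are the eigenvalues belonging to an orthonormal basis $(u_j)_{j\ge1}$ of $L^2(\Omega;\mathbb{C})$ that consists of weak solutions $u_j\in H^1(\Omega;\mathbb{C})$ of \[ (i\nabla+F)^2u_j=\mu_ju_j\ \text{ in }\Omega,\qquad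 \vec n\cdot(\nabla-iF)u_j=0\ \text{ on }\partial\Omega, \] that is, $\int_\Omega (i\nabla+F)u_j\cdot\overline{(i\nabla+F)v}\,dx=\mu_j\int_\Omega u_j\overline v\,dx$ for all $v\in H^1(\Omega;\mathbb{C})$. For every Lipschitz-starlike plane domain such eigenvalues exist, and they are all positive. Theorem (Neumann magnetic Laplacian). Let $\beta\ne0$ and $n\ge1$. Among all Lipschitz-starlike plane domains $\Omega$, each of the scale invariant functionals \[ \mu_1A/G,\qquad (\mu_1^s+\cdots+\mu_n^s)^{1/s}A/G\quad(0<s\le1),\qquad \sqrt[n]{\mu_1\mu_2\cdots\mu_n}\,A/G, \] achieves its maximum value when $\Omega$ is a disk centered at the origin (of any radius). Further, if $\Phi:(0,\infty)\to\mathbb{R}$ is concave and increasing (not necessarily strictly), then $\sum_{j=1}^n\Phi(\mu_jA/G)$ is maximal when $\Omega$ is a disk centered at the origin. Consequently, for each $s<0<t$, the functionals \[ \sum_{j=1}^n(\mu_jA/G)^s\qquad\text{and}\qquad\sum_{j=1}^n\exp(-\mu_jAt/G) \] attain their smallest value when $\Omega$ is a disk centered at the origin. -/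

import Mathlib

open MeasureTheory Set
open scoped ContDiff ComplexConjugate Real

noncomputable section

/-- `R` is the radius function of a Lipschitz-starlike plane domain. -/
structure IsRadiusFunction (R : ℝ → ℝ) : Prop where
  pos : ∀ θ, 0 < R θ
  periodic : Function.Periodic R (2 * π)
  lipschitz : ∃ K, LipschitzWith K R

/-- The domain `{r e^{iθ} : 0 ≤ r < R(θ)}`; the plane is identified with `ℂ`. -/
def starlikeDomain (R : ℝ → ℝ) : Set ℂ :=
  {z | ∃ r θ : ℝ, 0 ≤ r ∧ r < R θ ∧ z = r * Complex.exp (θ * Complex.I)}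

/-- Area of a plane set. -/
def area (Ω : Set ℂ) : ℝ := volume.real Ω

/-- The factor `G₀ = 1 + (1/2π) ∫ ((log R)')²`. -/
def geomG0 (R : ℝ → ℝ) : ℝ :=
  1 + 1 / (2 * π) * ∫ θ in (0 : ℝ)..(2 * π), (deriv (fun t => Real.log (R t)) θ) ^ 2

/-- The factor `G₁`: the mean of `R⁴` over the square of the mean of `R²`. -/
def geomG1 (R : ℝ → ℝ) : ℝ :=
  (1 / (2 * π) * ∫ θ in (0 : ℝ)..(2 * π), R θ ^ 4) /
    (1 / (2 * π) * ∫ θ in (0 : ℝ)..(2 * π), R θ ^ 2) ^ 2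

/-- The geometric factor `G = max {G₀, G₁}`. -/
def geomG (R : ℝ → ℝ) : ℝ := max (geomG0 R) (geomG1 R)

/-- The factor `A / G` by which the eigenvalues are normalized. -/
def areaOverG (R : ℝ → ℝ) : ℝ := area (starlikeDomain R) / geomG R

/-- `g` is the weak derivative of `u` on `Ω` in the direction `e` (for `e = 1` and `e = i`, the
partial derivatives with respect to `x₁` and `x₂`). -/
def HasWeakPartial (Ω : Set ℂ) (e : ℂ) (u g : ℂ → ℂ) : Prop :=
  ∀ φ : ℂ → ℝ, ContDiff ℝ ∞ φ → HasCompactSupport φ → tsupport φ ⊆ Ω →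
    ∫ z in Ω, ((fderiv ℝ φ z e : ℝ) : ℂ) * u z = - ∫ z in Ω, (φ z : ℂ) * g z

/-- `u` belongs to `H¹(Ω; ℂ)` and `(g₁, g₂)` is its weak gradient. -/
structure IsH1WithGrad (Ω : Set ℂ) (u g₁ g₂ : ℂ → ℂ) : Prop where
  memLp : MemLp u 2 (volume.restrict Ω)
  memLp_fst : MemLp g₁ 2 (volume.restrict Ω)
  memLp_snd : MemLp g₂ 2 (volume.restrict Ω)
  weak_fst : HasWeakPartial Ω 1 u g₁
  weak_snd : HasWeakPartial Ω Complex.I u g₂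

/-- First component of the vector potential `F(x) = (β / 2A) (-x₂, x₁)`. -/
def potential₁ (β : ℝ) (Ω : Set ℂ) (z : ℂ) : ℝ := β / (2 * area Ω) * (-z.im)

/-- Second component of the vector potential `F(x) = (β / 2A) (-x₂, x₁)`. -/
def potential₂ (β : ℝ) (Ω : Set ℂ) (z : ℂ) : ℝ := β / (2 * area Ω) * z.re

/-- The magnetic form `∫_Ω (i∇ + F)u · conj ((i∇ + F)v)`, where `(g₁, g₂)` and `(h₁, h₂)` are the
gradients of `u` and `v`. -/
def magneticForm (β : ℝ) (Ω : Set ℂ) (u g₁ g₂ v h₁ h₂ : ℂ → ℂ) : ℂ :=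
  ∫ z in Ω,
    ((Complex.I * g₁ z + potential₁ β Ω z * u z) *
        conj (Complex.I * h₁ z + potential₁ β Ω z * v z) +
      (Complex.I * g₂ z + potential₂ β Ω z * u z) *
        conj (Complex.I * h₂ z + potential₂ β Ω z * v z))

/-- `u ∈ H¹(Ω; ℂ)` solves `(i∇ + F)² u = μ u` in `Ω` with the natural (magnetic Neumann) boundary
condition `n · (∇ - iF) u = 0` on `∂Ω`, in the weak sense: the test functions range over all of
`H¹(Ω; ℂ)`. -/
def IsNeumannSolution (β : ℝ) (Ω : Set ℂ) (u : ℂ → ℂ) (μ : ℝ) : Prop :=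
  ∃ g₁ g₂ : ℂ → ℂ, IsH1WithGrad Ω u g₁ g₂ ∧
    ∀ v h₁ h₂ : ℂ → ℂ, IsH1WithGrad Ω v h₁ h₂ →
      magneticForm β Ω u g₁ g₂ v h₁ h₂ = μ * ∫ z in Ω, u z * conj (v z)

/-- `μ 0 ≤ μ 1 ≤ μ 2 ≤ ⋯` are the Neumann eigenvalues of the magnetic Laplacian on `Ω`, repeated
according to multiplicity: they belong to the members of a complete orthonormal system of
eigenfunctions in `L²(Ω; ℂ)`. -/
def IsNeumannSpectrum (β : ℝ) (Ω : Set ℂ) (μ : ℕ → ℝ) : Prop :=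
  Monotone μ ∧ ∃ u : HilbertBasis ℕ ℂ (Lp ℂ 2 (volume.restrict Ω)),
    ∀ j, IsNeumannSolution β Ω (u j : Lp ℂ 2 (volume.restrict Ω)) (μ j)

end

/-!
The upper bounds on eigenvalues come from transplanting all eigenfunctions of the disk to the
starlike domain at once, and averaging over rotations of the disk.

*Comparison.* There is a Lipschitz, positively homogeneous map `diskMap R ρ η` of the starlike
domain onto the disk of radius `ρ` that multiplies all areas by one constant: the ray of angle `θ`
is stretched by `ρ / R θ` and sent to an angle whose rate of change is proportional to `R θ ^ 2`;
the rotation by `η` is left free. Composition with it preserves orthogonality in `L²`, so the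
transplanted eigenfunctions are admissible in the variational principle for the sum of the first
`n` eigenvalues (`sum_eigenvalues_le`), for every `η`. In polar components the covariant derivative
of a transplanted function is a linear combination of the radial and the angular covariant
derivative of the original function, with coefficients that depend only on the angle; here it
matters that the potential is normalized by the area, so that both domains carry the same flux
(`components_comp_diskMap`). Averaging over `η` separates the angle in the starlike domain from
the point of the disk (`map_arg_diskMap`), and the mean energy is therefore a sum of products: the
radial energy is multiplied by `G₀`, the angular energy by `G₁`, and the mixed term by
`∫ R R' = 0` (`average_energy_le`). This gives `∑ μⱼ A / G ≤ ∑ νⱼ A / G` for all partial sums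
(`sum_neumannSpectrum_le`). By weak majorization such inequalities between partial sums pass to
concave increasing functions of the terms (`sum_concave_le_of_sum_le`), and every functional is an
increasing or a decreasing function of such a sum.

*Existence.* A starlike domain with a Lipschitz radius is star-shaped about a small ball
(`IsRadiusFunction.exists_isStarShapedAboutBall`). On such a domain a function may be averaged over
the balls `(1 - t) x + t B`, which lie inside the domain. Averages of this kind, with a smooth
weight, show that smooth functions are dense in `H¹` (`IsStarShapedAboutBall.exists_smooth_approx`);
this yields the chain rule for compositions with Lipschitz maps (`IsH1WithGrad.comp_lipschitz`).
Averages over finitely many such balls are operators of finite rank that approximate the embedding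
of `H¹` into `L²` in norm, so that the embedding is compact (`isCompactOperator_magneticEmbedding`).
The spectral theorem for compact operators then provides the orthonormal basis of eigenfunctions
(`exists_hilbertBasis_of_graph`).

*Positivity.* An eigenfunction with eigenvalue `0` satisfies `(i∇ + F) u = 0`. The commutator of the
two components of `i∇ + F` is multiplication by `i` times the curl of `F`, a nonzero constant, so
that `u = 0` (`eq_zero_of_covariantPartial_eq_zero`).
-/

/-! ### Compact operators and orthonormal bases of eigenvectors -/

/-- A real function with finite sublevel sets on an infinite type can be listed in increasing
order. -/
theorem exists_equiv_nat_monotone {ι : Type*} [Infinite ι] (f : ι → ℝ)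
    (hf : ∀ c, {i | f i ≤ c}.Finite) : ∃ e : ℕ ≃ ι, Monotone (f ∘ e) := by
  classical
  have hcount : Countable ι := by
    have : (⋃ n : ℕ, {i | f i ≤ n}) = Set.univ :=
      Set.eq_univ_of_forall fun i => Set.mem_iUnion.2 (exists_nat_ge (f i))
    rw [← Set.countable_univ_iff, ← this]
    exact Set.countable_iUnion fun n => (hf n).countable
  obtain ⟨enc, henc⟩ := exists_injective_nat ι
  -- Ties are broken by an enumeration of `ι`.
  let k : ι → ℝ ×ₗ ℕ := fun i => toLex (f i, enc i)
  have hk : Function.Injective k := fun i j hij => henc (congrArg (fun p => (ofLex p).2) hij)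
  have hkf : ∀ i j, k i ≤ k j → f i ≤ f j := fun i j hij => by
    rcases (Prod.Lex.toLex_le_toLex.1 hij) with h | h
    · exact h.le
    · exact h.1.le
  have hfin : ∀ i, {j | k j < k i}.Finite := fun i =>
    (hf (f i)).subset fun j hj => hkf j i (le_of_lt hj)
  let g : ι → ℕ := fun i => {j | k j < k i}.ncard
  have hg : ∀ i j, k i < k j → g i < g j := fun i j hij =>
    Set.ncard_lt_ncard ⟨fun l hl => lt_trans hl hij, fun h => lt_irrefl (k i) (h hij)⟩ (hfin j)
  have hginj : Function.Injective g := fun i j hij => by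
    rcases lt_trichotomy (k i) (k j) with h | h | h
    · exact absurd hij (hg _ _ h).ne
    · exact hk h
    · exact absurd hij (hg _ _ h).ne'
  have : Infinite (Set.range g) := (Set.infinite_range_of_injective hginj).to_subtype
  let e : ℕ ≃ ι :=
    (Nat.Subtype.orderIsoOfNat (Set.range g)).toEquiv.trans (Equiv.ofInjective g hginj).symm
  refine ⟨e, fun m n hmn => ?_⟩
  have hge : ∀ m, g (e m) = (Nat.Subtype.orderIsoOfNat (Set.range g) m : ℕ) := fun m =>
    congrArg Subtype.val
      ((Equiv.ofInjective g hginj).apply_symm_apply (Nat.Subtype.orderIsoOfNat (Set.range g) m))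
  have hle : g (e m) ≤ g (e n) := by
    rw [hge, hge]
    exact_mod_cast (Nat.Subtype.orderIsoOfNat (Set.range g)).monotone hmn
  refine hkf _ _ (le_of_not_gt fun h => ?_)
  exact absurd (hg _ _ h) (not_lt.2 hle)

section Spectral

variable {H : Type*} [NormedAddCommGroup H] [InnerProductSpace ℂ H]

/-- A compact operator has only finitely many eigenvalues of modulus at least `ε` along an
orthonormal family of eigenvectors. -/
theorem finite_setOf_eigenvalue_ge {T : H →L[ℂ] H} (hT : IsCompactOperator T) {ι : Type*}
    {v : ι → H} (hv : Orthonormal ℂ v) {κ : ι → ℝ} (hκ : ∀ i, T (v i) = (κ i : ℂ) • v i)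
    {ε : ℝ} (hε : 0 < ε) : {i | ε ≤ κ i}.Finite := by
  by_contra hinf
  have hinf : {i | ε ≤ κ i}.Infinite := hinf
  let f := hinf.natEmbedding
  obtain ⟨K, hK, hKT⟩ := hT.image_closedBall_subset_compact (f := (T : H →ₗ[ℂ] H)) 1
  have hmem : ∀ n : ℕ, T (v (f n)) ∈ K := fun n =>
    hKT ⟨v (f n), by simp [hv.1], rfl⟩
  obtain ⟨a, -, φ, hφ, hlim⟩ := hK.tendsto_subseq hmem
  have hc := hlim.cauchySeq
  rw [Metric.cauchySeq_iff'] at hc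
  obtain ⟨N, hN⟩ := hc ε hε
  have h1 := hN (N + 1) (Nat.le_succ N)
  set i := (f (φ (N + 1)) : ι)
  set j := (f (φ N) : ι)
  have hij : i ≠ j := fun h =>
    absurd (hφ.injective (f.injective (Subtype.ext h))) (Nat.succ_ne_self N)
  have hi : ε ≤ κ i := (f (φ (N + 1))).2
  simp only [Function.comp_apply, dist_eq_norm] at h1
  change ‖T (v i) - T (v j)‖ < ε at h1
  have h2 : inner ℂ (v i) (T (v i) - T (v j)) = (κ i : ℂ) := by
    rw [hκ, hκ, inner_sub_right, inner_smul_right, inner_smul_right, hv.2 hij,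
      inner_self_eq_norm_sq_to_K, hv.1]
    simp
  have h3 := norm_inner_le_norm (𝕜 := ℂ) (v i) (T (v i) - T (v j))
  rw [h2, hv.1, one_mul, Complex.norm_real, Real.norm_eq_abs] at h3
  linarith [le_abs_self (κ i)]

variable [CompleteSpace H]

/-- The spectral theorem for a positive definite compact operator, with the eigenvalues listed in
decreasing order. -/
theorem exists_hilbertBasis_eigenvectors (hH : ¬ FiniteDimensional ℂ H) {T : H →L[ℂ] H}
    (hT : IsCompactOperator T) (hs : (T : H →ₗ[ℂ] H).IsSymmetric)
    (hpos : ∀ x, x ≠ 0 → 0 < (inner ℂ (T x) x).re) :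
    ∃ (κ : ℕ → ℝ) (b : HilbertBasis ℕ ℂ H), Antitone κ ∧ (∀ j, 0 < κ j) ∧
      ∀ j, T (b j) = (κ j : ℂ) • b j := by
  classical
  let E : ℂ → Submodule ℂ H := fun μ => Module.End.eigenspace (T : H →ₗ[ℂ] H) μ
  have hfd : ∀ μ, FiniteDimensional ℂ (E μ) := fun μ => by
    by_cases hμ : μ = 0
    · have : E μ = ⊥ := by
        rw [eq_bot_iff]
        intro x hx
        by_contra hx0
        have h := hpos x hx0
        have hTx : T x = μ • x := Module.End.mem_eigenspace_iff.1 hx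
        rw [hTx, hμ] at h
        simp at h
      rw [this]; infer_instance
    · exact ContinuousLinearMap.finite_dimensional_eigenspace hT μ hμ
  let ι := Σ μ : ℂ, Fin (Module.finrank ℂ (E μ))
  let v : ι → H := fun i => (stdOrthonormalBasis ℂ (E i.1) i.2 : H)
  have hv : Orthonormal ℂ v :=
    hs.orthogonalFamily_eigenspaces.orthonormal_sigma_orthonormal
      (fun μ => (stdOrthonormalBasis ℂ (E μ)).orthonormal)
  have hTv : ∀ i, T (v i) = i.1 • v i := fun i =>
    Module.End.mem_eigenspace_iff.1 (stdOrthonormalBasis ℂ (E i.1) i.2).2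
  have hne : ∀ i, v i ≠ 0 := fun i => hv.ne_zero i
  have hreal : ∀ i : ι, ((i.1.re : ℝ) : ℂ) = i.1 := fun i =>
    Complex.conj_eq_iff_re.1 (hs.conj_eigenvalue_eq_self
      (Module.End.hasEigenvalue_of_hasEigenvector ⟨Module.End.mem_eigenspace_iff.2 (hTv i), hne i⟩))
  let κ : ι → ℝ := fun i => i.1.re
  have hTκ : ∀ i, T (v i) = (κ i : ℂ) • v i := fun i => by rw [hTv i, hreal i]
  have hκ : ∀ i, 0 < κ i := fun i => by
    have h := hpos (v i) (hne i)
    rw [hTκ, inner_smul_left, inner_self_eq_norm_sq_to_K, hv.1] at h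
    simpa using h
  have hspan : (Submodule.span ℂ (Set.range v))ᗮ = ⊥ := by
    rw [eq_bot_iff, ← ContinuousLinearMap.orthogonalComplement_iSup_eigenspaces_eq_bot hT hs]
    refine Submodule.orthogonal_le (iSup_le fun μ x hx => ?_)
    have h1 := (stdOrthonormalBasis ℂ (E μ)).sum_repr ⟨x, hx⟩
    have h2 := congrArg Subtype.val h1
    simp only [AddSubmonoidClass.coe_finsetSum, Submodule.coe_smul] at h2
    rw [← h2]
    exact Submodule.sum_mem _ fun i _ => Submodule.smul_mem _ _
      (Submodule.subset_span ⟨⟨μ, i⟩, rfl⟩)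
  have hinf : Infinite ι := by
    by_contra hfin
    rw [not_infinite_iff_finite] at hfin
    have : FiniteDimensional ℂ (Submodule.span ℂ (Set.range v)) :=
      FiniteDimensional.span_of_finite ℂ (Set.finite_range v)
    have htop := Submodule.orthogonal_eq_bot_iff.1 hspan
    exact hH (Module.finite_def.2 (htop ▸ Submodule.fg_span (Set.finite_range v)))
  obtain ⟨e, he⟩ := exists_equiv_nat_monotone (fun i => (κ i)⁻¹) fun c => by
    rcases le_or_gt c 0 with hc | hc
    · refine Set.finite_empty.subset fun i hi => ?_
      have h1 : (κ i)⁻¹ ≤ c := hi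
      have h2 := inv_pos.2 (hκ i)
      linarith
    · refine (finite_setOf_eigenvalue_ge hT hv hTκ (inv_pos.2 hc)).subset fun i hi => ?_
      exact (inv_le_comm₀ (hκ i) hc).1 hi
  refine ⟨κ ∘ e, HilbertBasis.mkOfOrthogonalEqBot (hv.comp e e.injective)
    (by rw [e.surjective.range_comp, hspan]), ?_,
    fun j => hκ _, fun j => ?_⟩
  · intro m n hmn
    exact (inv_le_inv₀ (hκ _) (hκ _)).1 (he hmn)
  · simp [hTκ]

/-- The eigenvalue problem `⟪w, v⟫ = κ⁻¹ ⟪J w, J v⟫` for a compact map `J` with dense range: the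
vectors `J w` of its solutions form an orthonormal basis. -/
theorem exists_hilbertBasis_of_compact_embedding (hH : ¬ FiniteDimensional ℂ H)
    {W : Type*} [NormedAddCommGroup W] [InnerProductSpace ℂ W] [CompleteSpace W] (J : W →L[ℂ] H)
    (hJ : IsCompactOperator J) (hd : DenseRange J) :
    ∃ (κ : ℕ → ℝ) (b : HilbertBasis ℕ ℂ H) (w : ℕ → W), Antitone κ ∧ (∀ j, 0 < κ j) ∧
      (∀ j, J (w j) = b j) ∧
      ∀ j v, inner ℂ v (w j) = ((κ j)⁻¹ : ℂ) * inner ℂ (J v) (b j) := by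
  -- The eigenvectors are those of `J J*`, which is injective because `J` has dense range.
  let A := ContinuousLinearMap.adjoint J
  have hA : ∀ x, x ≠ 0 → A x ≠ 0 := fun x hx h => hx <| by
    refine hd.eq_zero_of_inner_left ℂ fun w => ?_
    rw [← ContinuousLinearMap.adjoint_inner_left]
    change inner ℂ (A x) w = 0
    rw [h, inner_zero_left]
  obtain ⟨κ, b, hκ, hpos, hb⟩ := exists_hilbertBasis_eigenvectors hH (T := J ∘L A)
    (hJ.comp_clm A) (fun x y => by
      change inner ℂ (J (A x)) y = inner ℂ x (J (A y))
      rw [← ContinuousLinearMap.adjoint_inner_right J, ← ContinuousLinearMap.adjoint_inner_left J])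
    (fun x hx => by
      change 0 < (inner ℂ (J (A x)) x).re
      rw [← ContinuousLinearMap.adjoint_inner_right J]
      exact (re_inner_self_pos (𝕜 := ℂ)).2 (hA x hx))
  refine ⟨κ, b, fun j => ((κ j)⁻¹ : ℂ) • A (b j), hκ, hpos, fun j => ?_, fun j v => ?_⟩
  · have h1 : J (A (b j)) = (κ j : ℂ) • b j := hb j
    have h2 : (κ j : ℂ) ≠ 0 := by exact_mod_cast (hpos j).ne'
    rw [map_smul, h1, smul_smul, inv_mul_cancel₀ h2, one_smul]
  · rw [inner_smul_right, ContinuousLinearMap.adjoint_inner_right]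

end Spectral

/-! ### Weak majorization -/

/-- Summation by parts: nonnegative decreasing weights preserve the sign of the partial sums. -/
theorem sum_mul_nonpos_of_antitone {c d : ℕ → ℝ} (hc : Antitone c) (hc0 : ∀ j, 0 ≤ c j)
    (hd : ∀ n, ∑ j ∈ Finset.range n, d j ≤ 0) (n : ℕ) :
    ∑ j ∈ Finset.range n, c j * d j ≤ 0 := by
  have key : ∀ n, ∑ j ∈ Finset.range (n + 1), c j * d j
      ≤ c n * ∑ j ∈ Finset.range (n + 1), d j := by
    intro n
    induction n with
    | zero => simp
    | succ n ih =>
      rw [Finset.sum_range_succ, Finset.sum_range_succ (fun j => d j) (n + 1), mul_add]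
      have h1 := mul_le_mul_of_nonpos_right (hc (Nat.le_succ n)) (hd (n + 1))
      simp only [Nat.succ_eq_add_one] at h1
      linarith
  cases n with
  | zero => simp
  | succ n => exact (key n).trans (mul_nonpos_of_nonneg_of_nonpos (hc0 n) (hd _))

/-- A convex decreasing function on the half-line has a nonpositive increasing subgradient. -/
theorem exists_monotone_subgradient {ψ : ℝ → ℝ} (hc : ConvexOn ℝ (Ioi 0) ψ)
    (hm : AntitoneOn ψ (Ioi 0)) :
    ∃ p : ℝ → ℝ, MonotoneOn p (Ioi 0) ∧ (∀ y, 0 < y → p y ≤ 0) ∧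
      ∀ x y, 0 < x → 0 < y → ψ y + p y * (x - y) ≤ ψ x := by
  have hi : ∀ {y : ℝ}, 0 < y → y ∈ interior (Ioi (0 : ℝ)) := fun hy => by
    rwa [interior_Ioi]
  refine ⟨fun y => derivWithin ψ (Ioi y) y, ?_, fun y hy => ?_, fun x y hx hy => ?_⟩
  · have := hc.monotoneOn_rightDeriv
    rwa [interior_Ioi] at this
  · refine (hc.rightDeriv_le_slope_of_mem_interior (hi hy)
      (show y + 1 ∈ Ioi (0 : ℝ) by simp only [mem_Ioi]; linarith) (lt_add_one y)).trans ?_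
    rw [slope_def_field]
    have := hm (show y ∈ Ioi (0 : ℝ) from hy)
      (show y + 1 ∈ Ioi (0 : ℝ) by simp only [mem_Ioi]; linarith) (lt_add_one y).le
    simpa using this
  · rcases lt_trichotomy x y with h | rfl | h
    · have h1 := (hc.slope_le_leftDeriv_of_mem_interior hx (hi hy) h).trans
        (hc.leftDeriv_le_rightDeriv_of_mem_interior (hi hy))
      rw [slope_def_field, div_le_iff₀ (by linarith)] at h1
      linarith
    · simp
    · have h1 := hc.rightDeriv_le_slope_of_mem_interior (hi hy) hx h
      rw [slope_def_field, le_div_iff₀ (by linarith)] at h1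
      linarith

/-- Concave increasing functions respect weak majorization. -/
theorem sum_concave_le_of_sum_le {Φ : ℝ → ℝ} (hc : ConcaveOn ℝ (Ioi 0) Φ)
    (hm : MonotoneOn Φ (Ioi 0)) {a b : ℕ → ℝ} (ha : ∀ j, 0 < a j) (hb : ∀ j, 0 < b j)
    (hbm : Monotone b)
    (h : ∀ n, ∑ j ∈ Finset.range n, a j ≤ ∑ j ∈ Finset.range n, b j) (n : ℕ) :
    ∑ j ∈ Finset.range n, Φ (a j) ≤ ∑ j ∈ Finset.range n, Φ (b j) := by
  obtain ⟨p, hp, hp0, hpΦ⟩ := exists_monotone_subgradient hc.neg hm.neg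
  have h1 := sum_mul_nonpos_of_antitone (c := fun j => - p (b j)) (d := fun j => a j - b j)
    (fun i j hij => neg_le_neg (hp (hb i) (hb j) (hbm hij)))
    (fun j => neg_nonneg.2 (hp0 _ (hb j)))
    (fun n => by rw [Finset.sum_sub_distrib]; exact sub_nonpos.2 (h n)) n
  have h2 : ∑ j ∈ Finset.range n, (Φ (a j) - Φ (b j)) ≤
      ∑ j ∈ Finset.range n, -p (b j) * (a j - b j) := by
    refine Finset.sum_le_sum fun j _ => ?_
    have := hpΦ (a j) (b j) (ha j) (hb j)
    simp only [Pi.neg_apply] at this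
    linarith
  rw [Finset.sum_sub_distrib] at h2
  linarith

theorem concaveOn_neg_rpow {s : ℝ} (hs : s < 0) : ConcaveOn ℝ (Ioi 0) fun x : ℝ => -x ^ s := by
  have h1 : ConvexOn ℝ (Ioi 0) fun x : ℝ => s * Real.log x := by
    have := (strictConcaveOn_log_Ioi.concaveOn.neg).smul (neg_nonneg.2 hs.le)
    refine this.congr fun x _ => ?_
    simp
  have h2 : ConvexOn ℝ (Ioi 0) fun x : ℝ => Real.exp (s * Real.log x) :=
    ⟨convex_Ioi 0, fun x hx y hy a b ha hb hab => (Real.exp_le_exp.2 (h1.2 hx hy ha hb hab)).trans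
      (convexOn_exp.2 (mem_univ _) (mem_univ _) ha hb hab)⟩
  refine (h2.congr fun x hx => ?_).neg
  rw [Real.rpow_def_of_pos hx, mul_comm]

/-- The comparison of the eigenvalue functionals follows from that of the partial sums, through the
concave increasing functions `x ^ s` for `0 < s ≤ 1`, `log x`, `-x ^ s` for `s < 0` and
`-exp (-t x)`. -/
theorem functionals_le_of_sum_le {μ ν : ℕ → ℝ} {x y : ℝ} (hx : 0 < x) (hy : 0 < y)
    (hμ : ∀ j, 0 < μ j) (hν : ∀ j, 0 < ν j) (hνm : Monotone ν)
    (h : ∀ n, ∑ j ∈ Finset.range n, μ j * x ≤ ∑ j ∈ Finset.range n, ν j * y)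
    (n : ℕ) (hn : 1 ≤ n) :
    μ 0 * x ≤ ν 0 * y ∧
      (∀ s : ℝ, 0 < s → s ≤ 1 →
        (∑ j ∈ Finset.range n, μ j ^ s) ^ (1 / s) * x ≤
          (∑ j ∈ Finset.range n, ν j ^ s) ^ (1 / s) * y) ∧
      (∏ j ∈ Finset.range n, μ j) ^ (1 / (n : ℝ)) * x ≤
        (∏ j ∈ Finset.range n, ν j) ^ (1 / (n : ℝ)) * y ∧
      (∀ Φ : ℝ → ℝ, ConcaveOn ℝ (Set.Ioi 0) Φ → MonotoneOn Φ (Set.Ioi 0) →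
        ∑ j ∈ Finset.range n, Φ (μ j * x) ≤ ∑ j ∈ Finset.range n, Φ (ν j * y)) ∧
      (∀ s : ℝ, s < 0 →
        ∑ j ∈ Finset.range n, (ν j * y) ^ s ≤ ∑ j ∈ Finset.range n, (μ j * x) ^ s) ∧
      (∀ t : ℝ, 0 < t →
        ∑ j ∈ Finset.range n, Real.exp (-(ν j * y * t)) ≤
          ∑ j ∈ Finset.range n, Real.exp (-(μ j * x * t))) := by
  have hΦ : ∀ Φ : ℝ → ℝ, ConcaveOn ℝ (Set.Ioi 0) Φ → MonotoneOn Φ (Set.Ioi 0) →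
      ∑ j ∈ Finset.range n, Φ (μ j * x) ≤ ∑ j ∈ Finset.range n, Φ (ν j * y) :=
    fun Φ hc hm => sum_concave_le_of_sum_le hc hm (fun j => mul_pos (hμ j) hx)
      (fun j => mul_pos (hν j) hy) (fun i j hij => mul_le_mul_of_nonneg_right (hνm hij) hy.le) h n
  have hpow : ∀ {c : ℕ → ℝ} {z s : ℝ}, (∀ j, 0 < c j) → 0 < z → 0 < s →
      (∑ j ∈ Finset.range n, c j ^ s) ^ (1 / s) * z =
        (∑ j ∈ Finset.range n, (c j * z) ^ s) ^ (1 / s) := fun {c z s} hc hz hs => by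
    have h1 : ∀ j, (c j * z) ^ s = c j ^ s * z ^ s := fun j => Real.mul_rpow (hc j).le hz.le
    simp_rw [h1]
    rw [← Finset.sum_mul, Real.mul_rpow (Finset.sum_nonneg fun j _ => (Real.rpow_pos_of_pos
      (hc j) s).le) (Real.rpow_pos_of_pos hz s).le, ← Real.rpow_mul hz.le,
      mul_one_div_cancel hs.ne', Real.rpow_one]
  have hprod : ∀ {c : ℕ → ℝ} {z : ℝ}, (∀ j, 0 < c j) → 0 < z →
      (∏ j ∈ Finset.range n, c j) ^ (1 / (n : ℝ)) * z =
        Real.exp (1 / (n : ℝ) * ∑ j ∈ Finset.range n, Real.log (c j * z)) := fun {c z} hc hz => by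
    have hn0 : (n : ℝ) ≠ 0 := by exact_mod_cast (by omega : n ≠ 0)
    have h1 : ∀ j, Real.log (c j * z) = Real.log (c j) + Real.log z := fun j =>
      Real.log_mul (hc j).ne' hz.ne'
    have hP : 0 < ∏ j ∈ Finset.range n, c j := Finset.prod_pos fun j _ => hc j
    simp_rw [h1]
    rw [Finset.sum_add_distrib, Finset.sum_const, Finset.card_range, nsmul_eq_mul, mul_add,
      Real.exp_add, ← mul_assoc, one_div_mul_cancel hn0, one_mul, Real.exp_log hz,
      ← Real.log_prod (fun j _ => (hc j).ne'), Real.rpow_def_of_pos hP, mul_comm (Real.log _)]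
  refine ⟨by simpa using h 1, fun s hs hs1 => ?_, ?_, hΦ, fun s hs => ?_, fun t ht => ?_⟩
  · rw [hpow hμ hx hs, hpow hν hy hs]
    refine Real.rpow_le_rpow (Finset.sum_nonneg fun j _ =>
      (Real.rpow_pos_of_pos (mul_pos (hμ j) hx) s).le) ?_ (by positivity)
    exact hΦ (fun x => x ^ s)
      ((Real.concaveOn_rpow hs.le hs1).subset Ioi_subset_Ici_self (convex_Ioi 0))
      fun a ha b hb hab => Real.rpow_le_rpow (le_of_lt ha) hab hs.le
  · rw [hprod hμ hx, hprod hν hy]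
    refine Real.exp_le_exp.2 (mul_le_mul_of_nonneg_left ?_ (by positivity))
    exact hΦ Real.log strictConcaveOn_log_Ioi.concaveOn
      fun a ha b hb hab => Real.log_le_log ha hab
  · have := hΦ (fun x => -x ^ s) (concaveOn_neg_rpow hs) fun a ha b hb hab =>
      neg_le_neg (Real.rpow_le_rpow_of_nonpos ha hab hs.le)
    simpa using this
  · have hconv : ConvexOn ℝ (Ioi 0) fun x : ℝ => Real.exp (-(x * t)) := by
      have := (convexOn_exp.comp_linearMap (LinearMap.lsmul ℝ ℝ (-t)))
      refine (this.subset (subset_univ _) (convex_Ioi 0)).congr fun z _ => ?_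
      simp [mul_comm]
    have := hΦ (fun x => -Real.exp (-(x * t))) hconv.neg fun a ha b hb hab =>
      neg_le_neg (Real.exp_le_exp.2 (by nlinarith))
    simpa using this

/-! ### The variational principle for sums of eigenvalues -/

/-- If weights `p k ∈ [0, 1]` add up to `n`, then the weighted sum of an increasing sequence is at
least the sum of its first `n` terms. -/
theorem sum_range_le_of_weights {μ p : ℕ → ℝ} (hμ : Monotone μ) (hp0 : ∀ k, 0 ≤ p k)
    (hp1 : ∀ k, p k ≤ 1) {n : ℕ} (hp : HasSum p n) {S : ℝ}
    (hS : ∀ N, ∑ k ∈ Finset.range N, μ k * p k ≤ S) :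
    ∑ k ∈ Finset.range n, μ k ≤ S := by
  -- Weight beyond the first `n` indices only costs at least `μ n`, and the total weight is `n`.
  have key : ∀ N, ∑ k ∈ Finset.range n, μ k + μ n * (∑ k ∈ Finset.range (n + N), p k - n)
      ≤ S := by
    intro N
    refine le_trans ?_ (hS (n + N))
    have h1 : ∑ k ∈ Finset.range n, (μ k - μ n) ≤ ∑ k ∈ Finset.range n, (μ k - μ n) * p k :=
      Finset.sum_le_sum fun k hk => by
        have := hμ (Finset.mem_range.1 hk).le
        nlinarith [hp1 k]
    have h2 : ∑ k ∈ Finset.range n, (μ k - μ n) * p k ≤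
        ∑ k ∈ Finset.range (n + N), (μ k - μ n) * p k := by
      rw [Finset.sum_range_add]
      refine le_add_of_nonneg_right (Finset.sum_nonneg fun k _ => mul_nonneg ?_ (hp0 _))
      exact sub_nonneg.2 (hμ (Nat.le_add_right n k))
    have h3 : ∑ k ∈ Finset.range (n + N), (μ k - μ n) * p k =
        ∑ k ∈ Finset.range (n + N), μ k * p k - μ n * ∑ k ∈ Finset.range (n + N), p k := by
      rw [Finset.mul_sum, ← Finset.sum_sub_distrib]
      exact Finset.sum_congr rfl fun k _ => by ring
    rw [Finset.sum_sub_distrib, Finset.sum_const, Finset.card_range, nsmul_eq_mul] at h1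
    linarith
  have h1 : Filter.Tendsto (fun N => ∑ k ∈ Finset.range (n + N), p k) Filter.atTop
      (nhds (n : ℝ)) :=
    hp.tendsto_sum_nat.comp (Filter.tendsto_atTop_mono (fun N => Nat.le_add_left N n)
      Filter.tendsto_id)
  have h2 := ((h1.sub_const (n : ℝ)).const_mul (μ n)).const_add (∑ k ∈ Finset.range n, μ k)
  rw [sub_self, mul_zero, add_zero] at h2
  exact le_of_tendsto h2 (Filter.Eventually.of_forall key)

section Variational

variable {H K : Type*} [NormedAddCommGroup H] [InnerProductSpace ℂ H] [NormedAddCommGroup K]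
  [InnerProductSpace ℂ K]

/-- The variational principle for the sum of the first `n` eigenvalues. The vectors `p k` and `q j`
stand for the (magnetic) gradients of the eigenvectors `b k` and of the trial vectors `v j`. -/
theorem sum_eigenvalues_le (b : HilbertBasis ℕ ℂ H) {μ : ℕ → ℝ} (hμ : Monotone μ) {p : ℕ → K}
    (hp : ∀ k l, inner ℂ (p k) (p l) = (μ k : ℂ) * inner ℂ (b k) (b l)) {n : ℕ} {v : Fin n → H}
    (hv : Orthonormal ℂ v) {q : Fin n → K}
    (hq : ∀ k j, inner ℂ (p k) (q j) = (μ k : ℂ) * inner ℂ (b k) (v j)) :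
    ∑ k ∈ Finset.range n, μ k ≤ ∑ j, ‖q j‖ ^ 2 := by
  -- Bessel's inequality in `K`, for the orthogonal vectors `p k` of squared length `μ k`; it is
  -- stated without dividing by `μ k`, which may vanish.
  have hbessel : ∀ j N, ∑ k ∈ Finset.range N, μ k * ‖inner ℂ (b k) (v j)‖ ^ 2 ≤ ‖q j‖ ^ 2 := by
    intro j N
    set c : ℕ → ℂ := fun k => inner ℂ (b k) (v j)
    set x : K := ∑ k ∈ Finset.range N, c k • p k
    have hxq : inner ℂ x (q j) = ((∑ k ∈ Finset.range N, μ k * ‖c k‖ ^ 2 : ℝ) : ℂ) := by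
      rw [sum_inner, Complex.ofReal_sum]
      refine Finset.sum_congr rfl fun k _ => ?_
      rw [inner_smul_left, hq]
      push_cast
      rw [← Complex.conj_mul']
      ring
    have hxp : ∀ k ∈ Finset.range N, inner ℂ x (p k) = conj (c k) * (μ k : ℂ) := fun k hk => by
      rw [sum_inner, Finset.sum_eq_single k]
      · rw [inner_smul_left, hp, inner_self_eq_norm_sq_to_K, b.orthonormal.1]
        simp
      · intro l _ hl
        rw [inner_smul_left, hp, b.orthonormal.2 hl, mul_zero, mul_zero]
      · exact fun h => absurd hk h
    have hxx : inner ℂ x x = ((∑ k ∈ Finset.range N, μ k * ‖c k‖ ^ 2 : ℝ) : ℂ) := by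
      conv_lhs => rw [show x = ∑ k ∈ Finset.range N, c k • p k from rfl]
      rw [inner_sum, Complex.ofReal_sum]
      refine Finset.sum_congr rfl fun k hk => ?_
      rw [inner_smul_right, hxp k hk]
      push_cast
      rw [← Complex.conj_mul']
      ring
    have h1 := norm_sub_sq (𝕜 := ℂ) x (q j)
    have h2 : ‖x‖ ^ 2 = ∑ k ∈ Finset.range N, μ k * ‖c k‖ ^ 2 := by
      have := inner_self_eq_norm_sq (𝕜 := ℂ) x
      rw [hxx] at this
      exact this.symm
    rw [hxq] at h1
    simp only [RCLike.re_to_complex, Complex.ofReal_re] at h1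
    have := sq_nonneg ‖x - q j‖
    linarith
  have hsymm : ∀ k j, ‖inner ℂ (b k) (v j)‖ = ‖inner ℂ (v j) (b k)‖ := fun k j =>
    norm_inner_symm _ _
  refine sum_range_le_of_weights (p := fun k => ∑ j, ‖inner ℂ (b k) (v j)‖ ^ 2) hμ
    (fun k => Finset.sum_nonneg fun j _ => sq_nonneg _) (fun k => ?_) ?_ fun N => ?_
  · simp_rw [hsymm]
    refine (hv.sum_inner_products_le (x := b k)).trans ?_
    rw [b.orthonormal.1]
    norm_num
  · have h1 : ∀ j ∈ (Finset.univ : Finset (Fin n)),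
        HasSum (fun k => ‖inner ℂ (b k) (v j)‖ ^ 2) (1 : ℝ) := fun j _ => by
      have h2 := b.hasSum_inner_mul_inner (v j) (v j)
      rw [inner_self_eq_norm_sq_to_K, hv.1] at h2
      rw [← Complex.hasSum_ofReal]
      convert! h2 using 1
      · funext k
        rw [← inner_conj_symm (v j) (b k), Complex.conj_mul']
        push_cast
        rfl
      · simp
    simpa using hasSum_sum h1
  · simp_rw [Finset.mul_sum]
    rw [Finset.sum_comm]
    exact Finset.sum_le_sum fun j _ => hbessel j N

end Variational

/-! ### Square integrable functions -/

section L2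

variable {α : Type*} {m : MeasurableSpace α} {μ : Measure α}

theorem eLpNorm_two_sq {E : Type*} [NormedAddCommGroup E] (f : α → E) (μ : Measure α) :
    eLpNorm f 2 μ ^ 2 = ∫⁻ a, ‖f a‖ₑ ^ 2 ∂μ := by
  have h := eLpNorm_nnreal_pow_eq_lintegral (f := f) (μ := μ) (p := 2) two_ne_zero
  simpa using h

/-- The Cauchy–Schwarz inequality against the constant function. -/
theorem sq_lintegral_le {f : α → ENNReal} (hf : AEMeasurable f μ) :
    (∫⁻ a, f a ∂μ) ^ 2 ≤ μ univ * ∫⁻ a, f a ^ 2 ∂μ := by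
  have h := ENNReal.lintegral_mul_le_Lp_mul_Lq μ Real.HolderConjugate.two_two hf
    (aemeasurable_const (b := (1 : ENNReal)))
  have h2 := pow_le_pow_left₀ (zero_le (a := _)) h 2
  simp only [Pi.mul_apply, mul_one, one_div, ENNReal.one_rpow, lintegral_const, one_mul,
    mul_pow] at h2
  refine h2.trans (le_of_eq ?_)
  rw [← ENNReal.rpow_two, ← ENNReal.rpow_mul, ← ENNReal.rpow_two, ← ENNReal.rpow_mul]
  simp [mul_comm]

/-- The pairing with a fixed square integrable function is continuous in `L²`. -/
theorem tendsto_integral_mul_of_eLpNorm {k : α → ℂ} (hk : MemLp k 2 μ) {u : ℕ → α → ℂ}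
    {v : α → ℂ} (hu : ∀ n, MemLp (u n) 2 μ) (hv : MemLp v 2 μ)
    (h : Filter.Tendsto (fun n => eLpNorm (u n - v) 2 μ) Filter.atTop (nhds 0)) :
    Filter.Tendsto (fun n => ∫ a, k a * u n a ∂μ) Filter.atTop (nhds (∫ a, k a * v a ∂μ)) := by
  have hk' : MemLp (fun a => conj (k a)) 2 μ := hk.star
  have key : ∀ {f : α → ℂ} (hf : MemLp f 2 μ),
      inner ℂ (hk'.toLp _) (hf.toLp f) = ∫ a, k a * f a ∂μ := fun {f} hf => by
    rw [L2.inner_def]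
    refine integral_congr_ae ?_
    filter_upwards [hk'.coeFn_toLp, hf.coeFn_toLp] with a h1 h2
    rw [h1, h2, RCLike.inner_apply, RingHomCompTriple.comp_apply, RingHom.id_apply, mul_comm]
  have h1 := (Lp.tendsto_Lp_iff_tendsto_eLpNorm'' u hu v hv).2 h
  have h2 := Filter.Tendsto.inner (𝕜 := ℂ) (tendsto_const_nhds (x := hk'.toLp _)) h1
  rw [key hv] at h2
  exact h2.congr fun n => key (hu n)

/-- Composition with a map whose pushforward measure is controlled is bounded on `L²`. -/
theorem eLpNorm_comp_le {β E : Type*} {m' : MeasurableSpace β} [NormedAddCommGroup E]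
    {ν : Measure β} {T : α → β} (hT : Measurable T) {C : NNReal}
    (hC : μ.map T ≤ C • ν) {f : β → E} (hf : AEStronglyMeasurable f ν) :
    eLpNorm (f ∘ T) 2 μ ≤ (C : ENNReal) ^ (1 / 2 : ℝ) * eLpNorm f 2 ν := by
  have hac : μ.map T ≪ ν := (Measure.absolutelyContinuous_of_le hC).trans
    (Measure.smul_absolutelyContinuous (c := (C : ENNReal)))
  rw [← eLpNorm_map_measure (hf.mono_ac hac) hT.aemeasurable]
  refine (eLpNorm_mono_measure f hC).trans ((eLpNorm_smul_measure_le (C : ENNReal) f 2 ν).trans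
    (le_of_eq ?_))
  simp

theorem memLp_comp {β E : Type*} {m' : MeasurableSpace β} [NormedAddCommGroup E]
    {ν : Measure β} {T : α → β} (hT : Measurable T) {C : NNReal}
    (hC : μ.map T ≤ C • ν) {f : β → E} (hf : MemLp f 2 ν) : MemLp (f ∘ T) 2 μ := by
  have hac : μ.map T ≪ ν := (Measure.absolutelyContinuous_of_le hC).trans
    (Measure.smul_absolutelyContinuous (c := (C : ENNReal)))
  refine ⟨(hf.1.mono_ac hac).comp_measurable hT, (eLpNorm_comp_le hT hC hf.1).trans_lt ?_⟩
  exact ENNReal.mul_lt_top (ENNReal.rpow_lt_top_of_nonneg (by norm_num) ENNReal.coe_ne_top) hf.2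

end L2

/-! ### Weak derivatives -/

section Weak

variable {Ω : Set ℂ}

theorem memLp_ofReal_of_hasCompactSupport {φ : ℂ → ℝ} (h : Continuous φ)
    (hc : HasCompactSupport φ) (Ω : Set ℂ) :
    MemLp (fun z => (φ z : ℂ)) 2 (volume.restrict Ω) :=
  ((h.memLp_of_hasCompactSupport hc).ofReal).restrict Ω

theorem memLp_fderiv_of_hasCompactSupport {φ : ℂ → ℝ} (h : ContDiff ℝ ∞ φ)
    (hc : HasCompactSupport φ) (e : ℂ) (Ω : Set ℂ) :
    MemLp (fun z => ((fderiv ℝ φ z e : ℝ) : ℂ)) 2 (volume.restrict Ω) :=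
  memLp_ofReal_of_hasCompactSupport
    ((h.continuous_fderiv (by simp)).clm_apply continuous_const) (hc.fderiv_apply ℝ e) Ω

theorem HasWeakPartial.congr {e : ℂ} {u g u' g' : ℂ → ℂ} (h : HasWeakPartial Ω e u g)
    (hu : u =ᵐ[volume.restrict Ω] u') (hg : g =ᵐ[volume.restrict Ω] g') :
    HasWeakPartial Ω e u' g' := fun φ h1 h2 h3 => by
  have e1 : ∫ z in Ω, ((fderiv ℝ φ z e : ℝ) : ℂ) * u' z
      = ∫ z in Ω, ((fderiv ℝ φ z e : ℝ) : ℂ) * u z := integral_congr_ae <| by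
    filter_upwards [hu] with z hz; rw [hz]
  have e2 : ∫ z in Ω, (φ z : ℂ) * g' z = ∫ z in Ω, (φ z : ℂ) * g z := integral_congr_ae <| by
    filter_upwards [hg] with z hz; rw [hz]
  rw [e1, e2, h φ h1 h2 h3]

/-- Weak derivatives are closed under convergence in `L²`. -/
theorem HasWeakPartial.of_tendsto {e : ℂ} {u g : ℕ → ℂ → ℂ} {u' g' : ℂ → ℂ}
    (h : ∀ n, HasWeakPartial Ω e (u n) (g n))
    (hu : ∀ n, MemLp (u n) 2 (volume.restrict Ω)) (hu' : MemLp u' 2 (volume.restrict Ω))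
    (hg : ∀ n, MemLp (g n) 2 (volume.restrict Ω)) (hg' : MemLp g' 2 (volume.restrict Ω))
    (hlu : Filter.Tendsto (fun n => eLpNorm (u n - u') 2 (volume.restrict Ω)) Filter.atTop
      (nhds 0))
    (hlg : Filter.Tendsto (fun n => eLpNorm (g n - g') 2 (volume.restrict Ω)) Filter.atTop
      (nhds 0)) : HasWeakPartial Ω e u' g' := fun φ h1 h2 h3 => by
  have l1 := tendsto_integral_mul_of_eLpNorm (memLp_fderiv_of_hasCompactSupport h1 h2 e Ω)
    hu hu' hlu
  have l2 := (tendsto_integral_mul_of_eLpNorm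
    (memLp_ofReal_of_hasCompactSupport h1.continuous h2 Ω) hg hg' hlg).neg
  exact tendsto_nhds_unique (l1.congr fun n => h n φ h1 h2 h3) l2

/-- A Lipschitz function has its almost everywhere derivative as weak derivative. -/
theorem hasWeakPartial_of_lipschitz {u : ℂ → ℂ} {K : NNReal} (hu : LipschitzWith K u) (e : ℂ) :
    HasWeakPartial Ω e u (fun z => fderiv ℝ u z e) := by
  intro φ h1 h2 h3
  have hsupp : ∀ z, z ∉ Ω → φ z = 0 := fun z hz =>
    image_eq_zero_of_notMem_tsupport fun h => hz (h3 h)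
  have hsupp' : ∀ z, z ∉ Ω → fderiv ℝ φ z = 0 := fun z hz =>
    image_eq_zero_of_notMem_tsupport fun h => hz (h3 (tsupport_fderiv_subset ℝ h))
  rw [setIntegral_eq_integral_of_forall_compl_eq_zero
      (fun z hz => by rw [hsupp' z hz]; simp),
    setIntegral_eq_integral_of_forall_compl_eq_zero
      (fun z hz => by rw [hsupp z hz]; simp)]
  obtain ⟨D, hφ⟩ := (h1.of_le (by simp) : ContDiff ℝ 1 φ).lipschitzWith_of_hasCompactSupport h2
    (by simp)
  have hφd : Differentiable ℝ φ := h1.differentiable (by simp)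
  have hud := hu.ae_differentiableAt (μ := (volume : Measure ℂ))
  have part : ∀ (L : ℂ →L[ℝ] ℝ), ∫ z, fderiv ℝ φ z e * L (u z) =
      - ∫ z, φ z * L (fderiv ℝ u z e) := by
    intro L
    have hL : LipschitzWith (‖L‖₊ * K) (fun z => L (u z)) := L.lipschitz.comp hu
    have h4 := LipschitzWith.integral_lineDeriv_mul_eq (μ := (volume : Measure ℂ)) hL hφ h2 e
    have h5 : ∫ z, lineDeriv ℝ (fun z => L (u z)) z e * φ z
        = ∫ z, φ z * L (fderiv ℝ u z e) := integral_congr_ae <| by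
      filter_upwards [hud] with z hz
      have h6 : HasFDerivAt (fun z => L (u z)) (L.comp (fderiv ℝ u z)) z :=
        L.hasFDerivAt.comp z hz.hasFDerivAt
      rw [(h6.hasLineDerivAt e).lineDeriv, mul_comm]
      rfl
    have h7 : ∀ z, lineDeriv ℝ φ z (-e) = - fderiv ℝ φ z e := fun z => by
      rw [((hφd z).hasFDerivAt.hasLineDerivAt (-e)).lineDeriv, map_neg]
    rw [h5] at h4
    simp only [h7, neg_mul, integral_neg] at h4
    rw [h4, neg_neg]
  have hint1 : Integrable (fun z => ((fderiv ℝ φ z e : ℝ) : ℂ) * u z) := by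
    refine Continuous.integrable_of_hasCompactSupport ?_ ?_
    · exact (Complex.continuous_ofReal.comp
        ((h1.continuous_fderiv (by simp)).clm_apply continuous_const)).mul hu.continuous
    · exact HasCompactSupport.mul_right
        ((h2.fderiv_apply ℝ e).comp_left (g := Complex.ofReal) Complex.ofReal_zero)
  have hint2 : Integrable (fun z => (φ z : ℂ) * fderiv ℝ u z e) := by
    have : Integrable (fun z => (φ z : ℂ)) := (h1.continuous.integrable_of_hasCompactSupport
      h2).ofReal
    refine this.mul_bdd (c := K * ‖e‖) ?_ ?_
    · exact (measurable_fderiv_apply_const ℝ u e).aestronglyMeasurable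
    · exact Filter.Eventually.of_forall fun z => (ContinuousLinearMap.le_opNorm _ _).trans
        (mul_le_mul_of_nonneg_right (norm_fderiv_le_of_lipschitz ℝ hu) (norm_nonneg _))
  refine Complex.ext ?_ ?_
  · have := part Complex.reCLM
    rw [← Complex.reCLM_apply, ← ContinuousLinearMap.integral_comp_comm _ hint1, Complex.neg_re,
      ← Complex.reCLM_apply, ← ContinuousLinearMap.integral_comp_comm _ hint2]
    simpa using this
  · have := part Complex.imCLM
    rw [← Complex.imCLM_apply, ← ContinuousLinearMap.integral_comp_comm _ hint1, Complex.neg_im,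
      ← Complex.imCLM_apply, ← ContinuousLinearMap.integral_comp_comm _ hint2]
    simpa using this

end Weak

/-! ### Density of smooth functions on domains star-shaped about a ball -/

/-- A bounded open set `Ω` that is star-shaped with respect to every point of the closed ball of
radius `δ > 0` about the origin. -/
structure IsStarShapedAboutBall (Ω : Set ℂ) (δ : ℝ) : Prop where
  isOpen : IsOpen Ω
  isBounded : Bornology.IsBounded Ω
  pos : 0 < δ
  zero_mem : (0 : ℂ) ∈ Ω
  segment : ∀ z ∈ Ω, ∀ y : ℂ, ‖y‖ ≤ δ → ∀ t : ℝ, 0 ≤ t → t ≤ 1 → (1 - t) • z + t • y ∈ Ω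

theorem map_smul_add_restrict_le {r : ℝ} (hr : 0 < r) (w : ℂ) {Ω Ω' : Set ℂ}
    (hΩ' : MeasurableSet Ω') (h : ∀ z ∈ Ω, r • z + w ∈ Ω') :
    (volume.restrict Ω).map (fun z : ℂ => r • z + w) ≤
      ((r⁻¹) ^ 2).toNNReal • volume.restrict Ω' := by
  have hm : Measurable (fun z : ℂ => r • z + w) := by fun_prop
  have hmap : (volume : Measure ℂ).map (fun z : ℂ => r • z + w)
      = ((r⁻¹) ^ 2).toNNReal • volume := by
    have h1 : (fun z : ℂ => r • z + w) = (fun z => z + w) ∘ (fun z : ℂ => r • z) := rfl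
    rw [h1, ← Measure.map_map (by fun_prop) (by fun_prop), Measure.map_addHaar_smul _ hr.ne',
      Measure.map_smul, map_add_right_eq_self, Complex.finrank_real_complex, ← inv_pow,
      abs_of_nonneg (by positivity)]
    rfl
  refine Measure.le_iff.2 fun s hs => ?_
  rw [Measure.map_apply hm hs, Measure.restrict_apply (hm hs), Measure.smul_apply,
    Measure.restrict_apply hs]
  calc volume ((fun z : ℂ => r • z + w) ⁻¹' s ∩ Ω)
      ≤ volume ((fun z : ℂ => r • z + w) ⁻¹' (s ∩ Ω')) :=
        measure_mono fun z hz => ⟨hz.1, h z hz.2⟩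
    _ = _ := by rw [← Measure.map_apply hm (hs.inter hΩ'), hmap, Measure.smul_apply]

section Convolution

open ContinuousLinearMap
open scoped Convolution

variable (φ : ContDiffBump (0 : ℂ))

/-- Averages do not increase the `L²` norm. -/
theorem eLpNorm_normed_convolution_le {v : ℂ → ℂ} (hv : AEStronglyMeasurable v) :
    eLpNorm (φ.normed volume ⋆[lsmul ℝ ℝ, volume] v : ℂ → ℂ) 2 volume ≤ eLpNorm v 2 volume := by
  have hcongr : (φ.normed volume ⋆[lsmul ℝ ℝ, volume] v : ℂ → ℂ)
      = φ.normed volume ⋆[lsmul ℝ ℝ, volume] (hv.mk v) :=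
    convolution_congr _ Filter.EventuallyEq.rfl hv.ae_eq_mk
  rw [hcongr, eLpNorm_congr_ae hv.ae_eq_mk]
  set w := hv.mk v
  have hw : Measurable w := hv.stronglyMeasurable_mk.measurable
  refine (ENNReal.pow_le_pow_left_iff two_ne_zero).1 ?_
  rw [eLpNorm_two_sq, eLpNorm_two_sq]
  have hφm : Measurable (fun y => ENNReal.ofReal (φ.normed volume y)) :=
    φ.continuous_normed.measurable.ennreal_ofReal
  let ν : Measure ℂ := volume.withDensity fun y => ENNReal.ofReal (φ.normed volume y)
  have hν : ν univ = 1 := by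
    rw [withDensity_apply _ MeasurableSet.univ, Measure.restrict_univ,
      ← ofReal_integral_eq_lintegral_ofReal φ.integrable_normed
        (Filter.Eventually.of_forall φ.nonneg_normed), φ.integral_normed, ENNReal.ofReal_one]
  have h1 : ∀ x, ‖(φ.normed volume ⋆[lsmul ℝ ℝ, volume] w : ℂ → ℂ) x‖ₑ ^ 2
      ≤ ∫⁻ y, ‖w (x - y)‖ₑ ^ 2 ∂ν := fun x => by
    have h2 : ‖(φ.normed volume ⋆[lsmul ℝ ℝ, volume] w : ℂ → ℂ) x‖ₑ ≤ ∫⁻ y, ‖w (x - y)‖ₑ ∂ν := by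
      rw [convolution_lsmul, lintegral_withDensity_eq_lintegral_mul _ hφm (by fun_prop)]
      refine (enorm_integral_le_lintegral_enorm _).trans (le_of_eq (lintegral_congr fun y => ?_))
      rw [enorm_smul, Real.enorm_of_nonneg (φ.nonneg_normed y)]
      rfl
    have h3 := sq_lintegral_le (μ := ν) (f := fun y => ‖w (x - y)‖ₑ) (by fun_prop)
    rw [hν, one_mul] at h3
    exact (pow_le_pow_left₀ (zero_le (a := _)) h2 2).trans h3
  calc ∫⁻ x, ‖(φ.normed volume ⋆[lsmul ℝ ℝ, volume] w : ℂ → ℂ) x‖ₑ ^ 2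
      ≤ ∫⁻ x, ∫⁻ y, ‖w (x - y)‖ₑ ^ 2 ∂ν := lintegral_mono h1
    _ = ∫⁻ y, (∫⁻ x, ‖w (x - y)‖ₑ ^ 2) ∂ν := by
        have : SFinite ν := inferInstance
        exact lintegral_lintegral_swap (μ := volume) (ν := ν) (f := fun x y => ‖w (x - y)‖ₑ ^ 2)
          (by simp only [Function.uncurry_def]; fun_prop)
    _ = ∫⁻ _, (∫⁻ x, ‖w x‖ₑ ^ 2) ∂ν := lintegral_congr fun y =>
        lintegral_sub_right_eq_self (μ := volume) (fun x => ‖w x‖ₑ ^ 2) y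
    _ = ∫⁻ x, ‖w x‖ₑ ^ 2 := by rw [lintegral_const, hν, mul_one]

/-- Weak derivatives commute with averaging over balls inside the domain. -/
theorem fderiv_normed_convolution {Ω : Set ℂ} (hΩ : MeasurableSet Ω) {u g : ℂ → ℂ} {e : ℂ}
    (hu : IntegrableOn u Ω) (h : HasWeakPartial Ω e u g) {p : ℂ}
    (hp : Metric.closedBall p φ.rOut ⊆ Ω) :
    fderiv ℝ (φ.normed volume ⋆[lsmul ℝ ℝ, volume] (Ω.indicator u) : ℂ → ℂ) p e =
      (φ.normed volume ⋆[lsmul ℝ ℝ, volume] (Ω.indicator g) : ℂ → ℂ) p := by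
  have hloc : LocallyIntegrable (Ω.indicator u) :=
    ((integrable_indicator_iff hΩ).2 hu).locallyIntegrable
  have hφ1 : ContDiff ℝ 1 (φ.normed volume) := φ.contDiff_normed
  have hd := φ.hasCompactSupport_normed.hasFDerivAt_convolution_left (μ := volume)
    (lsmul ℝ ℝ : ℝ →L[ℝ] ℂ →L[ℝ] ℂ) hφ1 hloc p
  have hex := (φ.hasCompactSupport_normed (μ := volume)).fderiv ℝ |>.convolutionExists_left
    ((lsmul ℝ ℝ : ℝ →L[ℝ] ℂ →L[ℝ] ℂ).precompL ℂ) (hφ1.continuous_fderiv one_ne_zero) hloc p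
  have hψ : ContDiff ℝ ∞ (fun z => φ.normed volume (p - z)) :=
    φ.contDiff_normed.comp (contDiff_const.sub contDiff_id)
  have hψs : tsupport (fun z => φ.normed volume (p - z)) ⊆ Metric.closedBall p φ.rOut := by
    refine closure_minimal (fun z hz => ?_) Metric.isClosed_closedBall
    have : p - z ∈ Function.support (φ.normed volume) := hz
    rw [φ.support_normed_eq, mem_ball_zero_iff] at this
    rw [Metric.mem_closedBall, dist_comm, dist_eq_norm]
    exact this.le
  have hψc : HasCompactSupport (fun z => φ.normed volume (p - z)) :=
    (isCompact_closedBall p φ.rOut).of_isClosed_subset (isClosed_tsupport _) hψs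
  have key := h _ hψ hψc (hψs.trans hp)
  have hder : ∀ z, fderiv ℝ (fun z => φ.normed volume (p - z)) z e
      = - fderiv ℝ (φ.normed volume) (p - z) e := fun z => by
    have h1 : HasFDerivAt (fun z => φ.normed volume (p - z))
        ((fderiv ℝ (φ.normed volume) (p - z)).comp (-(ContinuousLinearMap.id ℝ ℂ))) z :=
      ((hφ1.differentiable one_ne_zero (p - z)).hasFDerivAt).comp z
        ((hasFDerivAt_id z).const_sub p)
    rw [h1.fderiv]
    simp
  rw [hd.fderiv, convolution_def, ContinuousLinearMap.integral_apply hex, convolution_lsmul_swap]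
  rw [← integral_sub_left_eq_self _ volume p]
  simp only [hder, sub_sub_cancel] at key ⊢
  have e1 : ∀ z, ((lsmul ℝ ℝ : ℝ →L[ℝ] ℂ →L[ℝ] ℂ).precompL ℂ
      (fderiv ℝ (φ.normed volume) (p - z))) (Ω.indicator u z) e =
      Ω.indicator (fun z => ((fderiv ℝ (φ.normed volume) (p - z) e : ℝ) : ℂ) * u z) z := fun z => by
    by_cases hz : z ∈ Ω <;> simp [hz]
  have e2 : ∀ z, φ.normed volume (p - z) • Ω.indicator g z =
      Ω.indicator (fun z => ((φ.normed volume (p - z) : ℝ) : ℂ) * g z) z := fun z => by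
    by_cases hz : z ∈ Ω <;> simp [hz]
  simp only [e1, e2]
  rw [integral_indicator hΩ, integral_indicator hΩ]
  simp only [Complex.ofReal_neg, neg_mul, integral_neg] at key
  exact neg_injective key

/-- The average of `u` over a small ball about the contracted point `(1 - t) x`. On a domain that
is star-shaped about a ball this only involves the values of `u` inside the domain. -/
noncomputable def dilatedMollify (Ω : Set ℂ) (φ : ContDiffBump (0 : ℂ)) (t : ℝ) (u : ℂ → ℂ) (x : ℂ) : ℂ :=
  (φ.normed volume ⋆[lsmul ℝ ℝ, volume] (Ω.indicator u) : ℂ → ℂ) ((1 - t) • x)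

variable {Ω : Set ℂ} {δ : ℝ}

theorem IsStarShapedAboutBall.measurableSet (hΩ : IsStarShapedAboutBall Ω δ) : MeasurableSet Ω :=
  hΩ.isOpen.measurableSet

theorem IsStarShapedAboutBall.volume_lt_top (hΩ : IsStarShapedAboutBall Ω δ) : volume Ω < ⊤ :=
  hΩ.isBounded.measure_lt_top

theorem IsStarShapedAboutBall.isFiniteMeasure (hΩ : IsStarShapedAboutBall Ω δ) :
    IsFiniteMeasure (volume.restrict Ω) :=
  ⟨by rw [Measure.restrict_apply_univ]; exact hΩ.volume_lt_top⟩

theorem IsStarShapedAboutBall.closedBall_subset (hΩ : IsStarShapedAboutBall Ω δ) {x : ℂ}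
    (hx : x ∈ Ω) {t r : ℝ} (ht0 : 0 < t) (ht1 : t ≤ 1) (hr : r ≤ t * δ) :
    Metric.closedBall ((1 - t) • x) r ⊆ Ω := fun z hz => by
  rw [Metric.mem_closedBall, dist_eq_norm] at hz
  have h := hΩ.segment x hx (t⁻¹ • (z - (1 - t) • x)) (by
    rw [norm_smul, Real.norm_of_nonneg (by positivity), inv_mul_le_iff₀ ht0]
    linarith) t ht0.le ht1
  rwa [smul_inv_smul₀ ht0.ne', add_sub_cancel] at h

theorem IsStarShapedAboutBall.integrableOn (hΩ : IsStarShapedAboutBall Ω δ) {u : ℂ → ℂ}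
    (hu : MemLp u 2 (volume.restrict Ω)) : IntegrableOn u Ω :=
  have := hΩ.isFiniteMeasure
  hu.integrable one_le_two

theorem contDiff_dilatedMollify (hΩ : IsStarShapedAboutBall Ω δ) {u : ℂ → ℂ}
    (hu : MemLp u 2 (volume.restrict Ω)) (t : ℝ) : ContDiff ℝ ∞ (dilatedMollify Ω φ t u) := by
  have h1 : ContDiff ℝ ∞ (φ.normed volume ⋆[lsmul ℝ ℝ, volume] (Ω.indicator u) : ℂ → ℂ) :=
    φ.hasCompactSupport_normed.contDiff_convolution_left (n := (⊤ : ℕ∞)) _ φ.contDiff_normed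
      ((integrable_indicator_iff hΩ.measurableSet).2 (hΩ.integrableOn hu)).locallyIntegrable
  exact h1.comp (contDiff_const_smul (1 - t))

theorem hasCompactSupport_dilatedMollify (hΩ : IsStarShapedAboutBall Ω δ) (u : ℂ → ℂ) {t : ℝ}
    (ht : t < 1) : HasCompactSupport (dilatedMollify Ω φ t u) := by
  have h1 : HasCompactSupport (Ω.indicator u) :=
    HasCompactSupport.intro hΩ.isBounded.isCompact_closure fun x hx =>
      indicator_of_notMem (fun h => hx (subset_closure h)) u
  exact (HasCompactSupport.convolution (lsmul ℝ ℝ : ℝ →L[ℝ] ℂ →L[ℝ] ℂ) (μ := volume)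
    (φ.hasCompactSupport_normed (μ := volume)) h1).comp_smul (sub_pos.2 ht).ne'

theorem fderiv_dilatedMollify (hΩ : IsStarShapedAboutBall Ω δ) {u g : ℂ → ℂ} {e : ℂ}
    (hu : MemLp u 2 (volume.restrict Ω)) (h : HasWeakPartial Ω e u g) {t : ℝ} (ht0 : 0 < t)
    (ht1 : t ≤ 1) (hφ : φ.rOut ≤ t * δ) {x : ℂ} (hx : x ∈ Ω) :
    fderiv ℝ (dilatedMollify Ω φ t u) x e = (1 - t) • dilatedMollify Ω φ t g x := by
  have hloc := ((integrable_indicator_iff hΩ.measurableSet).2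
    (hΩ.integrableOn hu)).locallyIntegrable
  have h1 : ContDiff ℝ ∞ (φ.normed volume ⋆[lsmul ℝ ℝ, volume] (Ω.indicator u) : ℂ → ℂ) :=
    φ.hasCompactSupport_normed.contDiff_convolution_left (n := (⊤ : ℕ∞)) _ φ.contDiff_normed hloc
  have h2 := fderiv_normed_convolution φ hΩ.measurableSet (hΩ.integrableOn hu) h
    (hΩ.closedBall_subset hx ht0 ht1 hφ)
  have h3 : HasFDerivAt (dilatedMollify Ω φ t u) _ x :=
    (h1.differentiable (by simp) ((1 - t) • x)).hasFDerivAt.comp x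
      ((hasFDerivAt_id x).const_smul (1 - t))
  rw [h3.fderiv, dilatedMollify, ← h2]
  simp

theorem eLpNorm_dilatedMollify_le (hΩ : IsStarShapedAboutBall Ω δ) {u : ℂ → ℂ}
    (hu : MemLp u 2 (volume.restrict Ω)) {t : ℝ} (ht1 : t ≤ 1 / 2) :
    eLpNorm (dilatedMollify Ω φ t u) 2 (volume.restrict Ω) ≤
      2 * eLpNorm u 2 (volume.restrict Ω) := by
  have hpos : 0 < 1 - t := by linarith
  have hu' : AEStronglyMeasurable (Ω.indicator u) volume :=
    (aestronglyMeasurable_indicator_iff hΩ.measurableSet).2 hu.1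
  have hm := map_smul_add_restrict_le hpos 0 (Ω := Ω) MeasurableSet.univ (fun _ _ => mem_univ _)
  rw [Measure.restrict_univ] at hm
  have hφm : AEStronglyMeasurable
      (φ.normed volume ⋆[lsmul ℝ ℝ, volume] (Ω.indicator u) : ℂ → ℂ) volume :=
    ((φ.hasCompactSupport_normed (μ := volume)).continuous_convolution_left _ φ.continuous_normed
      ((integrable_indicator_iff hΩ.measurableSet).2
        (hΩ.integrableOn hu)).locallyIntegrable).aestronglyMeasurable
  have h1 := eLpNorm_comp_le (by fun_prop) hm hφm
  have h2 : (φ.normed volume ⋆[lsmul ℝ ℝ, volume] (Ω.indicator u) : ℂ → ℂ) ∘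
      (fun z : ℂ => (1 - t) • z + 0) = dilatedMollify Ω φ t u := by
    funext z; simp [dilatedMollify]
  rw [h2] at h1
  refine h1.trans (mul_le_mul' ?_ ?_)
  · have h3 : ((((1 - t)⁻¹ ^ 2).toNNReal : NNReal) : ENNReal) ^ (1 / 2 : ℝ)
        = ENNReal.ofReal (1 - t)⁻¹ := by
      have h4 : (0 : ℝ) ≤ (1 - t)⁻¹ := by positivity
      change ENNReal.ofReal _ ^ _ = _
      rw [ENNReal.ofReal_rpow_of_nonneg (by positivity) (by norm_num), ← Real.sqrt_eq_rpow,
        Real.sqrt_sq h4]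
    rw [h3, show (2 : ENNReal) = ENNReal.ofReal 2 by simp]
    refine ENNReal.ofReal_le_ofReal ?_
    rw [inv_le_comm₀ hpos two_pos]
    linarith
  · refine (eLpNorm_normed_convolution_le φ hu').trans (le_of_eq ?_)
    exact eLpNorm_indicator_eq_eLpNorm_restrict hΩ.measurableSet

theorem dilatedMollify_sub (hΩ : IsStarShapedAboutBall Ω δ) {u v : ℂ → ℂ}
    (hu : MemLp u 2 (volume.restrict Ω)) (hv : MemLp v 2 (volume.restrict Ω)) (t : ℝ) :
    dilatedMollify Ω φ t (u - v) = dilatedMollify Ω φ t u - dilatedMollify Ω φ t v := by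
  have hex : ∀ {w : ℂ → ℂ}, MemLp w 2 (volume.restrict Ω) →
      ∀ x, ConvolutionExistsAt (φ.normed volume) (Ω.indicator w) x
        (lsmul ℝ ℝ : ℝ →L[ℝ] ℂ →L[ℝ] ℂ) volume := fun {w} hw =>
    (φ.hasCompactSupport_normed (μ := volume)).convolutionExists_left _ φ.continuous_normed
      ((integrable_indicator_iff hΩ.measurableSet).2 (hΩ.integrableOn hw)).locallyIntegrable
  funext x
  simp only [dilatedMollify, Pi.sub_apply, convolution_def, indicator_sub']
  rw [← integral_sub (hex hu _) (hex hv _)]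
  simp [mul_sub]

/-- For a continuous function with compact support the averages converge uniformly. -/
theorem tendsto_eLpNorm_dilatedMollify_of_continuous (hΩ : IsStarShapedAboutBall Ω δ)
    {φ : ℕ → ContDiffBump (0 : ℂ)} {t : ℕ → ℝ} (ht0 : ∀ n, 0 < t n) (ht1 : ∀ n, t n ≤ 1 / 2)
    (ht : Filter.Tendsto t Filter.atTop (nhds 0)) (hφ : ∀ n, (φ n).rOut ≤ t n * δ)
    {f : ℂ → ℂ} (hf : Continuous f) (hc : HasCompactSupport f) :
    Filter.Tendsto (fun n => eLpNorm (dilatedMollify Ω (φ n) (t n) f - f) 2 (volume.restrict Ω))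
      Filter.atTop (nhds 0) := by
  have hfu : UniformContinuous f := hc.uniformContinuous_of_continuous hf
  obtain ⟨M, hM⟩ := hΩ.isBounded.exists_norm_le
  have hM0 : 0 ≤ M := (norm_nonneg _).trans (hM 0 hΩ.zero_mem)
  have hfm : AEStronglyMeasurable (Ω.indicator f) volume :=
    (hf.aestronglyMeasurable).indicator hΩ.measurableSet
  have hmain : ∀ ε : ℝ, 0 < ε → ∀ᶠ n in Filter.atTop, ∀ x ∈ Ω,
      ‖dilatedMollify Ω (φ n) (t n) f x - f x‖ ≤ ε := by
    intro ε hε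
    obtain ⟨η, hη, hfη⟩ := Metric.uniformContinuous_iff.1 hfu (ε / 2) (by positivity)
    have hev : ∀ᶠ n in Filter.atTop, t n * (δ + M + 1) < η := by
      have := ht.mul_const (δ + M + 1)
      rw [zero_mul] at this
      exact this.eventually_lt_const hη
    filter_upwards [hev] with n hn x hx
    have hsub := hΩ.closedBall_subset hx (ht0 n) ((ht1 n).trans (by norm_num)) (hφ n)
    set p := (1 - t n) • x
    have hp : p ∈ Ω := hsub (Metric.mem_closedBall_self (φ n).rOut_pos.le)
    have h1 : dist (dilatedMollify Ω (φ n) (t n) f x) (f p) ≤ ε / 2 := by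
      have := (φ n).dist_normed_convolution_le (μ := volume) (x₀ := p) (ε := ε / 2) hfm
        (fun z hz => by
          rw [indicator_of_mem (hsub (Metric.ball_subset_closedBall hz)), indicator_of_mem hp]
          refine (hfη ?_).le
          have h3 := Metric.mem_ball.1 hz
          nlinarith [hφ n, ht0 n, hΩ.pos])
      rwa [indicator_of_mem hp] at this
    have h2 : dist (f p) (f x) ≤ ε / 2 := by
      refine (hfη ?_).le
      have : p - x = -(t n • x) := by simp only [p]; module
      rw [dist_eq_norm, this, norm_neg, norm_smul, Real.norm_of_nonneg (ht0 n).le]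
      nlinarith [hM x hx, ht0 n, hΩ.pos]
    rw [← dist_eq_norm]
    linarith [dist_triangle (dilatedMollify Ω (φ n) (t n) f x) (f p) (f x)]
  rw [ENNReal.tendsto_nhds_zero]
  intro ε hε
  set V : ENNReal := (volume.restrict Ω) univ ^ (2 : ENNReal).toReal⁻¹
  have hV : V ≠ ⊤ := by
    have := hΩ.isFiniteMeasure
    exact ENNReal.rpow_ne_top_of_nonneg (by simp) (measure_ne_top _ _)
  obtain ⟨ε', hε', hle⟩ : ∃ ε' : ℝ, 0 < ε' ∧ V * ENNReal.ofReal ε' ≤ ε := by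
    have h1 : Filter.Tendsto (fun x : ℝ => V * ENNReal.ofReal x) (nhdsWithin 0 (Ioi 0))
        (nhds 0) := by
      have := ENNReal.Tendsto.const_mul (a := V)
        (ENNReal.tendsto_ofReal (tendsto_nhdsWithin_of_tendsto_nhds
          (s := Ioi (0 : ℝ)) (Filter.tendsto_id (α := ℝ) (x := nhds 0)))) (Or.inr hV)
      simpa using this
    obtain ⟨x, hx1, hx2⟩ := ((ENNReal.tendsto_nhds_zero.1 h1 ε hε).and
      self_mem_nhdsWithin).exists
    exact ⟨x, hx2, hx1⟩
  filter_upwards [hmain ε' hε'] with n hn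
  refine (eLpNorm_le_of_ae_bound (C := ε') ?_).trans hle
  filter_upwards [ae_restrict_mem hΩ.measurableSet] with x hx using hn x hx

/-- The averages converge in `L²`. -/
theorem tendsto_eLpNorm_dilatedMollify (hΩ : IsStarShapedAboutBall Ω δ)
    {φ : ℕ → ContDiffBump (0 : ℂ)} {t : ℕ → ℝ} (ht0 : ∀ n, 0 < t n) (ht1 : ∀ n, t n ≤ 1 / 2)
    (ht : Filter.Tendsto t Filter.atTop (nhds 0)) (hφ : ∀ n, (φ n).rOut ≤ t n * δ)
    {u : ℂ → ℂ} (hu : MemLp u 2 (volume.restrict Ω)) :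
    Filter.Tendsto (fun n => eLpNorm (dilatedMollify Ω (φ n) (t n) u - u) 2 (volume.restrict Ω))
      Filter.atTop (nhds 0) := by
  rw [ENNReal.tendsto_nhds_zero]
  intro ε hε
  have hε4 : ε / 4 ≠ 0 := (ENNReal.div_pos hε.ne' (by simp)).ne'
  obtain ⟨f, hfc, hfu, hf, -⟩ :=
    ((memLp_indicator_iff_restrict hΩ.measurableSet).2 hu).exists_hasCompactSupport_eLpNorm_sub_le
      (by simp) hε4
  have hfL : MemLp f 2 (volume.restrict Ω) := (hf.memLp_of_hasCompactSupport hfc).restrict Ω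
  have h1 : eLpNorm (u - f) 2 (volume.restrict Ω) ≤ ε / 4 := by
    refine le_trans ?_ hfu
    refine le_trans (le_of_eq ?_) (eLpNorm_mono_measure _ (Measure.restrict_le_self (s := Ω)))
    refine eLpNorm_congr_ae ?_
    filter_upwards [ae_restrict_mem hΩ.measurableSet] with x hx
    simp [hx]
  filter_upwards [ENNReal.tendsto_nhds_zero.1
    (tendsto_eLpNorm_dilatedMollify_of_continuous hΩ ht0 ht1 ht hφ hf hfc) (ε / 4)
    (pos_iff_ne_zero.2 hε4)] with n hn
  have hmeas : ∀ {w : ℂ → ℂ}, MemLp w 2 (volume.restrict Ω) →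
      AEStronglyMeasurable (dilatedMollify Ω (φ n) (t n) w) (volume.restrict Ω) := fun hw =>
    (contDiff_dilatedMollify (φ n) hΩ hw (t n)).continuous.aestronglyMeasurable
  have hdec : dilatedMollify Ω (φ n) (t n) u - u = dilatedMollify Ω (φ n) (t n) (u - f) +
      (dilatedMollify Ω (φ n) (t n) f - f) + (f - u) := by
    rw [dilatedMollify_sub (φ n) hΩ hu hfL]
    abel
  rw [hdec]
  calc _ ≤ _ := eLpNorm_add_le ((hmeas (hu.sub hfL)).add ((hmeas hfL).sub hfL.1))
        (hfL.1.sub hu.1) one_le_two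
    _ ≤ _ := add_le_add_left (eLpNorm_add_le (hmeas (hu.sub hfL)) ((hmeas hfL).sub hfL.1)
        one_le_two) _
    _ ≤ (2 * (ε / 4) + ε / 4) + ε / 4 := by
        refine add_le_add (add_le_add ?_ hn) ?_
        · exact (eLpNorm_dilatedMollify_le (φ n) hΩ (hu.sub hfL) (ht1 n)).trans
            (mul_le_mul_right h1 2)
        · rwa [eLpNorm_sub_comm]
    _ = ε := by
        rw [show 2 * (ε / 4) + ε / 4 + ε / 4 = 4 * (ε / 4) by ring]
        exact ENNReal.mul_div_cancel (by simp) (by simp)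

/-- Smooth functions with compact support in the plane are dense in `H¹(Ω)`. -/
theorem IsStarShapedAboutBall.exists_smooth_approx (hΩ : IsStarShapedAboutBall Ω δ)
    {u g₁ g₂ : ℂ → ℂ} (h : IsH1WithGrad Ω u g₁ g₂) :
    ∃ U : ℕ → ℂ → ℂ, (∀ n, ContDiff ℝ ∞ (U n)) ∧ (∀ n, HasCompactSupport (U n)) ∧
      Filter.Tendsto (fun n => eLpNorm (U n - u) 2 (volume.restrict Ω)) Filter.atTop (nhds 0) ∧
      Filter.Tendsto (fun n => eLpNorm ((fun z => fderiv ℝ (U n) z 1) - g₁) 2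
        (volume.restrict Ω)) Filter.atTop (nhds 0) ∧
      Filter.Tendsto (fun n => eLpNorm ((fun z => fderiv ℝ (U n) z Complex.I) - g₂) 2
        (volume.restrict Ω)) Filter.atTop (nhds 0) := by
  let t : ℕ → ℝ := fun n => 1 / ((n : ℝ) + 2)
  have ht0 : ∀ n, 0 < t n := fun n => by positivity
  have ht1 : ∀ n, t n ≤ 1 / 2 := fun n =>
    one_div_le_one_div_of_le two_pos (by linarith [n.cast_nonneg (α := ℝ)])
  have ht : Filter.Tendsto t Filter.atTop (nhds 0) := by
    have h1 := (tendsto_one_div_add_atTop_nhds_zero_nat (𝕜 := ℝ)).comp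
      (Filter.tendsto_add_atTop_nat 1)
    refine h1.congr fun n => ?_
    simp only [Function.comp_apply, t]
    push_cast
    ring_nf
  let φ : ℕ → ContDiffBump (0 : ℂ) := fun n =>
    ⟨t n * δ / 2, t n * δ, by have := ht0 n; have := hΩ.pos; positivity,
      by have := mul_pos (ht0 n) hΩ.pos; linarith⟩
  have hφ : ∀ n, (φ n).rOut ≤ t n * δ := fun n => le_rfl
  have hgrad : ∀ {e : ℂ} {g : ℂ → ℂ}, MemLp g 2 (volume.restrict Ω) → HasWeakPartial Ω e u g →
      Filter.Tendsto (fun n => eLpNorm ((fun z => fderiv ℝ (dilatedMollify Ω (φ n) (t n) u) z e)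
        - g) 2 (volume.restrict Ω)) Filter.atTop (nhds 0) := by
    intro e g hg hw
    have l1 := tendsto_eLpNorm_dilatedMollify hΩ ht0 ht1 ht hφ hg
    have l2 : Filter.Tendsto (fun n => ENNReal.ofReal (t n) * eLpNorm g 2 (volume.restrict Ω))
        Filter.atTop (nhds 0) := by
      have := ENNReal.Tendsto.mul_const (ENNReal.tendsto_ofReal ht)
        (Or.inr (hg.2.ne : eLpNorm g 2 (volume.restrict Ω) ≠ ⊤))
      simpa using this
    have l3 := l1.add l2
    rw [add_zero] at l3
    refine tendsto_of_tendsto_of_tendsto_of_le_of_le tendsto_const_nhds l3 (fun _ => zero_le)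
      fun n => ?_
    have hm : AEStronglyMeasurable (dilatedMollify Ω (φ n) (t n) g) (volume.restrict Ω) :=
      (contDiff_dilatedMollify (φ n) hΩ hg (t n)).continuous.aestronglyMeasurable
    -- The contraction by `1 - t` costs the factor `1 - t` in the derivative.
    have e1 : eLpNorm ((fun z => fderiv ℝ (dilatedMollify Ω (φ n) (t n) u) z e) - g) 2
        (volume.restrict Ω) = eLpNorm ((1 - t n) • (dilatedMollify Ω (φ n) (t n) g - g) -
          t n • g) 2 (volume.restrict Ω) := by
      refine eLpNorm_congr_ae ?_
      filter_upwards [ae_restrict_mem hΩ.measurableSet] with x hx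
      simp only [Pi.sub_apply, Pi.smul_apply]
      rw [fderiv_dilatedMollify (φ n) hΩ h.memLp hw (ht0 n) ((ht1 n).trans (by norm_num)) (hφ n)
        hx]
      module
    rw [e1]
    refine (eLpNorm_sub_le ((hm.sub hg.1).const_smul _) (hg.1.const_smul _) one_le_two).trans
      (add_le_add ?_ ?_)
    · rw [eLpNorm_const_smul]
      refine mul_le_of_le_one_left (zero_le) ?_
      rw [Real.enorm_of_nonneg (by linarith [ht1 n])]
      exact ENNReal.ofReal_le_one.2 (by linarith [ht0 n])
    · rw [eLpNorm_const_smul, Real.enorm_of_nonneg (ht0 n).le]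
  exact ⟨fun n => dilatedMollify Ω (φ n) (t n) u,
    fun n => contDiff_dilatedMollify (φ n) hΩ h.memLp (t n),
    fun n => hasCompactSupport_dilatedMollify (φ n) hΩ u (by linarith [ht1 n]),
    tendsto_eLpNorm_dilatedMollify hΩ ht0 ht1 ht hφ h.memLp,
    hgrad h.memLp_fst h.weak_fst, hgrad h.memLp_snd h.weak_snd⟩

end Convolution

/-! ### Transplantation by Lipschitz maps -/

section Transplant

/-- The chain rule for `∂ₑ(u ∘ T)`, where `(g₁, g₂)` is the gradient of `u`. -/
noncomputable def pullGrad (T : ℂ → ℂ) (e : ℂ) (g₁ g₂ : ℂ → ℂ) (z : ℂ) : ℂ :=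
  ((fderiv ℝ T z e).re : ℂ) * g₁ (T z) + ((fderiv ℝ T z e).im : ℂ) * g₂ (T z)

theorem pullGrad_sub (T : ℂ → ℂ) (e : ℂ) (g₁ g₂ h₁ h₂ : ℂ → ℂ) :
    pullGrad T e g₁ g₂ - pullGrad T e h₁ h₂ = pullGrad T e (g₁ - h₁) (g₂ - h₂) := by
  funext z
  simp only [pullGrad, Pi.sub_apply]
  ring

theorem clm_apply_eq_re_im (L : ℂ →L[ℝ] ℂ) (w : ℂ) :
    L w = (w.re : ℂ) * L 1 + (w.im : ℂ) * L Complex.I := by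
  conv_lhs => rw [← Complex.re_add_im w]
  have h1 : (w.re : ℂ) + (w.im : ℂ) * Complex.I = w.re • (1 : ℂ) + w.im • Complex.I := by simp
  rw [h1, map_add, map_smul, map_smul]
  simp

variable {D Ω : Set ℂ} {δ : ℝ} {T : ℂ → ℂ} {K C : NNReal}

theorem norm_fderiv_apply_le (hT : LipschitzWith K T) (e z : ℂ) :
    ‖fderiv ℝ T z e‖ ≤ K * ‖e‖ :=
  (ContinuousLinearMap.le_opNorm _ _).trans
    (mul_le_mul_of_nonneg_right (norm_fderiv_le_of_lipschitz ℝ hT) (norm_nonneg _))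

theorem memLp_pullGrad (hT : LipschitzWith K T)
    (hC : (volume.restrict Ω).map T ≤ C • volume.restrict D) (e : ℂ) {g₁ g₂ : ℂ → ℂ}
    (h₁ : MemLp g₁ 2 (volume.restrict D)) (h₂ : MemLp g₂ 2 (volume.restrict D)) :
    MemLp (pullGrad T e g₁ g₂) 2 (volume.restrict Ω) := by
  have hTm : Measurable T := hT.continuous.measurable
  have hm := measurable_fderiv_apply_const ℝ T e
  refine MemLp.add ?_ ?_
  · have h := memLp_comp hTm hC h₁
    refine h.of_le_mul (c := K * ‖e‖) ?_ ?_
    · exact (Complex.measurable_ofReal.comp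
        (Complex.measurable_re.comp hm)).aestronglyMeasurable.mul h.1
    · refine Filter.Eventually.of_forall fun z => ?_
      rw [norm_mul, Complex.norm_real]
      exact mul_le_mul_of_nonneg_right ((Complex.abs_re_le_norm _).trans
        (norm_fderiv_apply_le hT e z)) (norm_nonneg _)
  · have h := memLp_comp hTm hC h₂
    refine h.of_le_mul (c := K * ‖e‖) ?_ ?_
    · exact (Complex.measurable_ofReal.comp
        (Complex.measurable_im.comp hm)).aestronglyMeasurable.mul h.1
    · refine Filter.Eventually.of_forall fun z => ?_
      rw [norm_mul, Complex.norm_real]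
      exact mul_le_mul_of_nonneg_right ((Complex.abs_im_le_norm _).trans
        (norm_fderiv_apply_le hT e z)) (norm_nonneg _)

theorem eLpNorm_pullGrad_le (hT : LipschitzWith K T)
    (hC : (volume.restrict Ω).map T ≤ C • volume.restrict D) (e : ℂ) {g₁ g₂ : ℂ → ℂ}
    (h₁ : MemLp g₁ 2 (volume.restrict D)) (h₂ : MemLp g₂ 2 (volume.restrict D)) :
    eLpNorm (pullGrad T e g₁ g₂) 2 (volume.restrict Ω) ≤
      ENNReal.ofReal (K * ‖e‖) * (C : ENNReal) ^ (1 / 2 : ℝ) *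
        (eLpNorm g₁ 2 (volume.restrict D) + eLpNorm g₂ 2 (volume.restrict D)) := by
  have hTm : Measurable T := hT.continuous.measurable
  have m₁ := memLp_comp hTm hC h₁
  have m₂ := memLp_comp hTm hC h₂
  have b₁ := eLpNorm_comp_le hTm hC h₁.1
  have b₂ := eLpNorm_comp_le hTm hC h₂.1
  have key : eLpNorm (pullGrad T e g₁ g₂) 2 (volume.restrict Ω) ≤ ENNReal.ofReal (K * ‖e‖) *
      eLpNorm (fun z => ‖(g₁ ∘ T) z‖ + ‖(g₂ ∘ T) z‖) 2 (volume.restrict Ω) := by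
    refine eLpNorm_le_mul_eLpNorm_of_ae_le_mul (Filter.Eventually.of_forall fun z => ?_) 2
    rw [Real.norm_of_nonneg (by positivity), mul_add]
    refine (norm_add_le _ _).trans (add_le_add ?_ ?_)
    · rw [norm_mul, Complex.norm_real]
      exact mul_le_mul_of_nonneg_right ((Complex.abs_re_le_norm _).trans
        (norm_fderiv_apply_le hT e z)) (norm_nonneg _)
    · rw [norm_mul, Complex.norm_real]
      exact mul_le_mul_of_nonneg_right ((Complex.abs_im_le_norm _).trans
        (norm_fderiv_apply_le hT e z)) (norm_nonneg _)
  refine key.trans ?_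
  rw [mul_assoc]
  refine mul_le_mul_right ?_ _
  refine (eLpNorm_add_le m₁.1.norm m₂.1.norm one_le_two).trans ?_
  rw [eLpNorm_norm, eLpNorm_norm, mul_add]
  exact add_le_add b₁ b₂

/-- Composition with a Lipschitz map preserves `H¹`, and the chain rule holds. -/
theorem IsH1WithGrad.comp_lipschitz (hD : IsStarShapedAboutBall D δ) (hT : LipschitzWith K T)
    (hC : (volume.restrict Ω).map T ≤ C • volume.restrict D) {u g₁ g₂ : ℂ → ℂ}
    (h : IsH1WithGrad D u g₁ g₂) :
    IsH1WithGrad Ω (u ∘ T) (pullGrad T 1 g₁ g₂) (pullGrad T Complex.I g₁ g₂) := by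
  have hTm : Measurable T := hT.continuous.measurable
  obtain ⟨U, hU, hUc, l0, l1, l2⟩ := hD.exists_smooth_approx h
  have hUL : ∀ n, MemLp (U n) 2 (volume.restrict D) := fun n =>
    ((hU n).continuous.memLp_of_hasCompactSupport (hUc n)).restrict D
  have hUd : ∀ n e, MemLp (fun z => fderiv ℝ (U n) z e) 2 (volume.restrict D) := fun n e =>
    ((((hU n).continuous_fderiv (by simp)).clm_apply continuous_const).memLp_of_hasCompactSupport
      ((hUc n).fderiv_apply ℝ e)).restrict D
  have hw : ∀ e n, HasWeakPartial Ω e (U n ∘ T)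
      (pullGrad T e (fun z => fderiv ℝ (U n) z 1) (fun z => fderiv ℝ (U n) z Complex.I)) := by
    intro e n
    obtain ⟨K', hK'⟩ := ((hU n).of_le (by simp) :
      ContDiff ℝ 1 (U n)).lipschitzWith_of_hasCompactSupport (hUc n) (by simp)
    refine (hasWeakPartial_of_lipschitz (hK'.comp hT) e).congr Filter.EventuallyEq.rfl ?_
    filter_upwards [ae_restrict_of_ae (hT.ae_differentiableAt (μ := (volume : Measure ℂ)))]
      with z hz
    have h1 : HasFDerivAt (U n ∘ T) ((fderiv ℝ (U n) (T z)).comp (fderiv ℝ T z)) z :=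
      (((hU n).differentiable (by simp)) (T z)).hasFDerivAt.comp z hz.hasFDerivAt
    rw [h1.fderiv, ContinuousLinearMap.comp_apply, clm_apply_eq_re_im]
    rfl
  have lim0 : Filter.Tendsto (fun n => eLpNorm (U n ∘ T - u ∘ T) 2 (volume.restrict Ω))
      Filter.atTop (nhds 0) := by
    have := ENNReal.Tendsto.const_mul (a := (C : ENNReal) ^ (1 / 2 : ℝ)) l0
      (Or.inr (ENNReal.rpow_ne_top_of_nonneg (by norm_num) ENNReal.coe_ne_top))
    rw [mul_zero] at this
    refine tendsto_of_tendsto_of_tendsto_of_le_of_le tendsto_const_nhds this (fun _ => zero_le)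
      fun n => ?_
    have h1 := eLpNorm_comp_le (f := U n - u) hTm hC ((hUL n).sub h.memLp).1
    exact h1
  have lim : ∀ e, Filter.Tendsto (fun n => eLpNorm (pullGrad T e (fun z => fderiv ℝ (U n) z 1)
      (fun z => fderiv ℝ (U n) z Complex.I) - pullGrad T e g₁ g₂) 2 (volume.restrict Ω))
      Filter.atTop (nhds 0) := by
    intro e
    have := ENNReal.Tendsto.const_mul
      (a := ENNReal.ofReal (K * ‖e‖) * (C : ENNReal) ^ (1 / 2 : ℝ)) (l1.add l2)
      (Or.inr (ENNReal.mul_ne_top ENNReal.ofReal_ne_top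
        (ENNReal.rpow_ne_top_of_nonneg (by norm_num) ENNReal.coe_ne_top)))
    rw [add_zero, mul_zero] at this
    refine tendsto_of_tendsto_of_tendsto_of_le_of_le tendsto_const_nhds this (fun _ => zero_le)
      fun n => ?_
    rw [pullGrad_sub]
    exact eLpNorm_pullGrad_le hT hC e ((hUd n 1).sub h.memLp_fst)
      ((hUd n Complex.I).sub h.memLp_snd)
  have m0 := memLp_comp hTm hC h.memLp
  have mU := fun n => memLp_comp hTm hC (hUL n)
  have m := fun e => memLp_pullGrad hT hC e h.memLp_fst h.memLp_snd
  have mU' := fun e n => memLp_pullGrad hT hC e (hUd n 1) (hUd n Complex.I)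
  exact ⟨m0, m 1, m Complex.I, HasWeakPartial.of_tendsto (hw 1) mU m0 (mU' 1) (m 1) lim0 (lim 1),
    HasWeakPartial.of_tendsto (hw Complex.I) mU m0 (mU' Complex.I) (m Complex.I) lim0
      (lim Complex.I)⟩

end Transplant

/-! ### Approximation by averages over balls -/

section Compactness

variable {Ω : Set ℂ} {δ : ℝ}

/-- A smooth function differs little from its values at the points `(1 - t) x + t y`. -/
theorem eLpNorm_sub_comp_contraction_le_of_smooth (hΩ : IsStarShapedAboutBall Ω δ) {M : ℝ}
    (hM : ∀ x ∈ Ω, ‖x‖ ≤ M) {U : ℂ → ℂ} (hU : ContDiff ℝ ∞ U) {y : ℂ} (hy : ‖y‖ ≤ δ) {t : ℝ}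
    (ht0 : 0 ≤ t) (ht1 : t ≤ 1 / 2) :
    eLpNorm (fun x => U x - U ((1 - t) • x + t • y)) 2 (volume.restrict Ω) ≤
      ENNReal.ofReal (4 * (M + δ) * t) *
        (eLpNorm (fun z => fderiv ℝ U z 1) 2 (volume.restrict Ω) +
          eLpNorm (fun z => fderiv ℝ U z Complex.I) 2 (volume.restrict Ω)) := by
  have hM0 : 0 ≤ M := (norm_nonneg _).trans (hM 0 hΩ.zero_mem)
  have hδ := hΩ.pos
  have hUc := hU.continuous
  have hDc : Continuous (fderiv ℝ U) := hU.continuous_fderiv (by simp)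
  have hD1 : Continuous fun z => fderiv ℝ U z 1 := hDc.clm_apply continuous_const
  have hDI : Continuous fun z => fderiv ℝ U z Complex.I := hDc.clm_apply continuous_const
  set A := eLpNorm (fun z => fderiv ℝ U z 1) 2 (volume.restrict Ω)
  set B := eLpNorm (fun z => fderiv ℝ U z Complex.I) 2 (volume.restrict Ω)
  let G : ℂ → ENNReal := fun z => (‖fderiv ℝ U z 1‖ₑ + ‖fderiv ℝ U z Complex.I‖ₑ) ^ 2
  have hG : Measurable G := by
    have h1 : Measurable fun z => ‖fderiv ℝ U z 1‖ₑ := hD1.measurable.enorm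
    have h2 : Measurable fun z => ‖fderiv ℝ U z Complex.I‖ₑ := hDI.measurable.enorm
    exact (h1.add h2).pow_const 2
  have hGint : ∫⁻ z in Ω, G z ≤ (A + B) ^ 2 := by
    have h1 : ∫⁻ z in Ω, G z = eLpNorm (fun z => ‖fderiv ℝ U z 1‖ + ‖fderiv ℝ U z Complex.I‖) 2
        (volume.restrict Ω) ^ 2 := by
      rw [eLpNorm_two_sq]
      refine lintegral_congr fun z => ?_
      rw [Real.enorm_of_nonneg (by positivity),
        ENNReal.ofReal_add (norm_nonneg _) (norm_nonneg _), ofReal_norm, ofReal_norm]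
    rw [h1]
    refine pow_le_pow_left₀ zero_le ?_ 2
    refine (eLpNorm_add_le hD1.norm.aestronglyMeasurable hDI.norm.aestronglyMeasurable
      one_le_two).trans ?_
    rw [eLpNorm_norm, eLpNorm_norm]
  refine (ENNReal.pow_le_pow_left_iff two_ne_zero).1 ?_
  rw [eLpNorm_two_sq]
  have hpt : ∀ x ∈ Ω, ‖U x - U ((1 - t) • x + t • y)‖ₑ ^ 2 ≤
      ENNReal.ofReal ((M + δ) ^ 2 * t) * ∫⁻ τ in Ioc 0 t, G ((1 - τ) • x + τ • y) := by
    intro x hx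
    have hder : ∀ τ : ℝ, HasDerivAt (fun τ : ℝ => U ((1 - τ) • x + τ • y))
        (fderiv ℝ U ((1 - τ) • x + τ • y) (y - x)) τ := fun τ => by
      have h1 : HasDerivAt (fun τ : ℝ => (1 - τ) • x + τ • y) (y - x) τ := by
        have h2 := (((hasDerivAt_id τ).const_sub 1).smul_const x).add
          ((hasDerivAt_id τ).smul_const y)
        convert! h2 using 1
        module
      exact (hU.differentiable (by simp) _).hasFDerivAt.comp_hasDerivAt τ h1
    have hcont : Continuous fun τ : ℝ => fderiv ℝ U ((1 - τ) • x + τ • y) (y - x) :=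
      (hDc.comp (by fun_prop)).clm_apply continuous_const
    have hftc := intervalIntegral.integral_eq_sub_of_hasDerivAt (a := 0) (b := t)
      (fun τ _ => hder τ) (hcont.intervalIntegrable 0 t)
    simp only [sub_zero, one_smul, zero_smul, add_zero] at hftc
    have h1 : ‖U x - U ((1 - t) • x + t • y)‖ₑ ≤
        ∫⁻ τ in Ioc 0 t, ‖fderiv ℝ U ((1 - τ) • x + τ • y) (y - x)‖ₑ := by
      rw [← enorm_neg, neg_sub, ← hftc, intervalIntegral.integral_of_le ht0]
      exact enorm_integral_le_lintegral_enorm _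
    have h2 := sq_lintegral_le (μ := volume.restrict (Ioc 0 t)) hcont.enorm.aemeasurable
    have h3 : ∀ τ : ℝ, ‖fderiv ℝ U ((1 - τ) • x + τ • y) (y - x)‖ₑ ^ 2 ≤
        ENNReal.ofReal ((M + δ) ^ 2) * G ((1 - τ) • x + τ • y) := fun τ => by
      rw [ENNReal.ofReal_pow (by positivity), ← mul_pow]
      refine pow_le_pow_left₀ zero_le ?_ 2
      rw [← ofReal_norm, ← ofReal_norm, ← ofReal_norm,
        ← ENNReal.ofReal_add (norm_nonneg _) (norm_nonneg _), ← ENNReal.ofReal_mul (by positivity)]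
      refine ENNReal.ofReal_le_ofReal ?_
      rw [clm_apply_eq_re_im, mul_add]
      have h4 : ‖y - x‖ ≤ M + δ := (norm_sub_le _ _).trans (by linarith [hM x hx])
      refine (norm_add_le _ _).trans (add_le_add ?_ ?_)
      · rw [norm_mul, Complex.norm_real]
        exact mul_le_mul_of_nonneg_right ((Complex.abs_re_le_norm _).trans h4) (norm_nonneg _)
      · rw [norm_mul, Complex.norm_real]
        exact mul_le_mul_of_nonneg_right ((Complex.abs_im_le_norm _).trans h4) (norm_nonneg _)
    calc _ ≤ _ := pow_le_pow_left₀ zero_le h1 2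
      _ ≤ _ := h2
      _ ≤ ENNReal.ofReal t * ∫⁻ τ in Ioc 0 t,
          ENNReal.ofReal ((M + δ) ^ 2) * G ((1 - τ) • x + τ • y) := by
        rw [Measure.restrict_apply_univ, Real.volume_Ioc, sub_zero]
        exact mul_le_mul_right (lintegral_mono fun τ => h3 τ) _
      _ = _ := by
        rw [lintegral_const_mul' _ _ ENNReal.ofReal_ne_top, ENNReal.ofReal_mul (by positivity)]
        ring
  have hstep : ∀ τ ∈ Ioc 0 t, ∫⁻ x in Ω, G ((1 - τ) • x + τ • y) ≤ 4 * (A + B) ^ 2 := by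
    intro τ hτ
    have hpos : 0 < 1 - τ := by linarith [hτ.2]
    have hm := map_smul_add_restrict_le hpos (τ • y) hΩ.measurableSet fun z hz =>
      hΩ.segment z hz y hy τ hτ.1.le (by linarith [hτ.2])
    rw [← lintegral_map (f := G) hG (by fun_prop : Measurable fun x : ℂ => (1 - τ) • x + τ • y)]
    refine (lintegral_mono' hm le_rfl).trans ?_
    rw [lintegral_smul_measure]
    refine mul_le_mul' ?_ hGint
    change ENNReal.ofReal _ ≤ 4
    rw [show (4 : ENNReal) = ENNReal.ofReal 4 by simp]
    refine ENNReal.ofReal_le_ofReal ?_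
    have h5 : (1 - τ)⁻¹ ≤ 2 := by
      rw [inv_le_comm₀ hpos two_pos]
      linarith [hτ.2]
    have h6 : 0 < (1 - τ)⁻¹ := by positivity
    nlinarith
  calc ∫⁻ x in Ω, ‖U x - U ((1 - t) • x + t • y)‖ₑ ^ 2
      ≤ ∫⁻ x in Ω, ENNReal.ofReal ((M + δ) ^ 2 * t) *
          ∫⁻ τ in Ioc 0 t, G ((1 - τ) • x + τ • y) :=
        setLIntegral_mono' hΩ.measurableSet hpt
    _ = ENNReal.ofReal ((M + δ) ^ 2 * t) *
          ∫⁻ x in Ω, ∫⁻ τ in Ioc 0 t, G ((1 - τ) • x + τ • y) := by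
        rw [lintegral_const_mul' _ _ ENNReal.ofReal_ne_top]
    _ = ENNReal.ofReal ((M + δ) ^ 2 * t) *
          ∫⁻ τ in Ioc 0 t, ∫⁻ x in Ω, G ((1 - τ) • x + τ • y) := by
        rw [lintegral_lintegral_swap]
        exact (hG.comp (by fun_prop : Measurable fun p : ℂ × ℝ =>
          (1 - p.2) • p.1 + p.2 • y)).aemeasurable
    _ ≤ ENNReal.ofReal ((M + δ) ^ 2 * t) * ∫⁻ τ in Ioc 0 t, 4 * (A + B) ^ 2 :=
        mul_le_mul_right (setLIntegral_mono' measurableSet_Ioc hstep) _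
    _ ≤ (ENNReal.ofReal (4 * (M + δ) * t) * (A + B)) ^ 2 := by
        rw [setLIntegral_const, Real.volume_Ioc, sub_zero, mul_pow, ← ENNReal.ofReal_pow
          (by positivity), show (4 : ENNReal) = ENNReal.ofReal 4 by simp]
        have h7 : ENNReal.ofReal ((M + δ) ^ 2 * t) * (ENNReal.ofReal 4 * (A + B) ^ 2 *
            ENNReal.ofReal t) = ENNReal.ofReal ((M + δ) ^ 2 * t * 4 * t) * (A + B) ^ 2 := by
          rw [ENNReal.ofReal_mul (p := (M + δ) ^ 2 * t * 4) (by positivity),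
            ENNReal.ofReal_mul (p := (M + δ) ^ 2 * t) (by positivity)]
          ring
        rw [h7]
        refine mul_le_mul_left (ENNReal.ofReal_le_ofReal ?_) _
        have : 0 ≤ ((M + δ) * t) ^ 2 := by positivity
        nlinarith

theorem IsStarShapedAboutBall.map_contraction_le (hΩ : IsStarShapedAboutBall Ω δ) {y : ℂ}
    (hy : ‖y‖ ≤ δ) {t : ℝ} (ht0 : 0 ≤ t) (ht1 : t ≤ 1 / 2) :
    (volume.restrict Ω).map (fun z : ℂ => (1 - t) • z + t • y) ≤ (4 : NNReal) •
      volume.restrict Ω := by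
  have hpos : 0 < 1 - t := by linarith
  refine (map_smul_add_restrict_le hpos (t • y) hΩ.measurableSet fun z hz =>
      hΩ.segment z hz y hy t ht0 (by linarith)).trans ?_
  have h5 : (1 - t)⁻¹ ≤ 2 := by
    rw [inv_le_comm₀ hpos two_pos]
    linarith
  have h6 : 0 < (1 - t)⁻¹ := by positivity
  have h7 : ((1 - t)⁻¹ ^ 2).toNNReal ≤ 4 := by
    rw [Real.toNNReal_le_iff_le_coe]
    simp only [NNReal.coe_ofNat]
    nlinarith
  refine Measure.le_iff.2 fun s _ => ?_
  rw [Measure.smul_apply, Measure.smul_apply]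
  exact mul_le_mul_left (ENNReal.coe_le_coe.2 h7) _

/-- A function in `H¹` differs little from its values at the points `(1 - t) x + t y`. -/
theorem eLpNorm_sub_comp_contraction_le (hΩ : IsStarShapedAboutBall Ω δ) {M : ℝ}
    (hM : ∀ x ∈ Ω, ‖x‖ ≤ M) {u g₁ g₂ : ℂ → ℂ} (h : IsH1WithGrad Ω u g₁ g₂) {y : ℂ}
    (hy : ‖y‖ ≤ δ) {t : ℝ} (ht0 : 0 ≤ t) (ht1 : t ≤ 1 / 2) :
    eLpNorm (fun x => u x - u ((1 - t) • x + t • y)) 2 (volume.restrict Ω) ≤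
      ENNReal.ofReal (4 * (M + δ) * t) *
        (eLpNorm g₁ 2 (volume.restrict Ω) + eLpNorm g₂ 2 (volume.restrict Ω)) := by
  obtain ⟨U, hU, hUc, l0, l1, l2⟩ := hΩ.exists_smooth_approx h
  have hγ : Measurable fun z : ℂ => (1 - t) • z + t • y := by fun_prop
  have hC := hΩ.map_contraction_le hy ht0 ht1
  have hUL : ∀ n, MemLp (U n) 2 (volume.restrict Ω) := fun n =>
    ((hU n).continuous.memLp_of_hasCompactSupport (hUc n)).restrict Ω
  have hUd : ∀ n e, AEStronglyMeasurable (fun z => fderiv ℝ (U n) z e) (volume.restrict Ω) :=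
    fun n e => (((hU n).continuous_fderiv (by simp)).clm_apply
      continuous_const).aestronglyMeasurable
  set C := ENNReal.ofReal (4 * (M + δ) * t)
  have hb : ∀ n, eLpNorm (fun x => u x - u ((1 - t) • x + t • y)) 2 (volume.restrict Ω) ≤
      eLpNorm (U n - u) 2 (volume.restrict Ω) +
      C * ((eLpNorm g₁ 2 (volume.restrict Ω) +
          eLpNorm ((fun z => fderiv ℝ (U n) z 1) - g₁) 2 (volume.restrict Ω)) +
        (eLpNorm g₂ 2 (volume.restrict Ω) +
          eLpNorm ((fun z => fderiv ℝ (U n) z Complex.I) - g₂) 2 (volume.restrict Ω))) +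
      (4 : NNReal) ^ (1 / 2 : ℝ) * eLpNorm (U n - u) 2 (volume.restrict Ω) := by
    intro n
    have hd : (fun x => u x - u ((1 - t) • x + t • y)) = (u - U n) +
        (fun x => U n x - U n ((1 - t) • x + t • y)) +
        (U n - u) ∘ (fun z : ℂ => (1 - t) • z + t • y) := by
      funext x
      simp
    have m1 : AEStronglyMeasurable (fun x => U n x - U n ((1 - t) • x + t • y))
        (volume.restrict Ω) :=
      ((hU n).continuous.sub ((hU n).continuous.comp (by fun_prop))).aestronglyMeasurable
    have m2 := (memLp_comp hγ hC ((hUL n).sub h.memLp)).1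
    rw [hd]
    refine (eLpNorm_add_le ((h.memLp.1.sub (hUL n).1).add m1) m2 one_le_two).trans
      (add_le_add ((eLpNorm_add_le (h.memLp.1.sub (hUL n).1) m1 one_le_two).trans
        (add_le_add (eLpNorm_sub_comm _ _ _ _).le ?_)) ?_)
    · refine (eLpNorm_sub_comp_contraction_le_of_smooth hΩ hM (hU n) hy ht0 ht1).trans
        (mul_le_mul_right (add_le_add ?_ ?_) _)
      · conv_lhs => rw [← add_sub_cancel g₁ (fun z => fderiv ℝ (U n) z 1)]
        exact eLpNorm_add_le h.memLp_fst.1 ((hUd n 1).sub h.memLp_fst.1) one_le_two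
      · conv_lhs => rw [← add_sub_cancel g₂ (fun z => fderiv ℝ (U n) z Complex.I)]
        exact eLpNorm_add_le h.memLp_snd.1 ((hUd n Complex.I).sub h.memLp_snd.1) one_le_two
    · have h1 := eLpNorm_comp_le (f := U n - u) hγ hC ((hUL n).sub h.memLp).1
      refine h1.trans (le_of_eq ?_)
      norm_num
  have hlim := (l0.add (ENNReal.Tendsto.const_mul (a := C)
    ((tendsto_const_nhds (x := eLpNorm g₁ 2 (volume.restrict Ω))).add l1 |>.add
      ((tendsto_const_nhds (x := eLpNorm g₂ 2 (volume.restrict Ω))).add l2))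
      (Or.inr ENNReal.ofReal_ne_top))).add
    (ENNReal.Tendsto.const_mul (a := ((4 : NNReal) : ENNReal) ^ (1 / 2 : ℝ)) l0
      (Or.inr (ENNReal.rpow_ne_top_of_nonneg (by norm_num) ENNReal.coe_ne_top)))
  simp only [add_zero, mul_zero, zero_add] at hlim
  exact ge_of_tendsto' hlim hb

theorem lintegral_ball_comp (F : ℂ → ENNReal) (w : ℂ) {t : ℝ} (ht : 0 < t) (δ : ℝ) :
    ∫⁻ z in Metric.ball w (t * δ), F z =
      ENNReal.ofReal (t ^ 2) * ∫⁻ y in Metric.ball (0 : ℂ) δ, F (w + t • y) := by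
  have hinj : Function.Injective fun y : ℂ => w + t • y := fun a b hab =>
    smul_right_injective ℂ ht.ne' (add_left_cancel hab)
  have h := lintegral_image_eq_lintegral_abs_det_fderiv_mul volume
    (s := Metric.ball (0 : ℂ) δ) measurableSet_ball (f := fun y : ℂ => w + t • y)
    (f' := fun _ => t • ContinuousLinearMap.id ℝ ℂ)
    (fun x _ => (((hasFDerivAt_id x).const_smul t).const_add w).hasFDerivWithinAt)
    hinj.injOn F
  have himg : (fun y : ℂ => w + t • y) '' Metric.ball (0 : ℂ) δ = Metric.ball w (t * δ) := by
    have h1 : (fun y : ℂ => w + t • y) = (fun y => w + y) ∘ (fun y : ℂ => t • y) := rfl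
    rw [h1, image_comp, image_smul, smul_ball ht.ne', smul_zero, Real.norm_of_nonneg ht.le]
    simp
  have hdet : ContinuousLinearMap.det (t • ContinuousLinearMap.id ℝ ℂ) = t ^ 2 := by
    rw [ContinuousLinearMap.det, ContinuousLinearMap.toLinearMap_smul, LinearMap.det_smul]
    simp
  rw [himg, hdet, abs_of_nonneg (sq_nonneg t)] at h
  rw [h, lintegral_const_mul' _ _ ENNReal.ofReal_ne_top]

/-- The oscillation of `u` about its average over a ball near `(1 - t) x` is controlled by the
differences of `u` along the contractions towards the points of the ball of radius `δ`. -/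
theorem enorm_sub_average_sq_le (hΩ : IsStarShapedAboutBall Ω δ) {u : ℂ → ℂ} (hum : Measurable u)
    (hu : MemLp u 2 (volume.restrict Ω)) {t : ℝ} (ht0 : 0 < t) (ht1 : t ≤ 1 / 2) {x c : ℂ}
    (hc : c ∈ Ω) (hxc : ‖x - c‖ ≤ t * δ / 2) :
    ‖u x - ⨍ w in Metric.ball ((1 - t) • c) (t * δ / 2), u w‖ₑ ^ 2 ≤
      4 * (volume (Metric.ball (0 : ℂ) δ))⁻¹ *
        ∫⁻ y in Metric.ball (0 : ℂ) δ, ‖u x - u ((1 - t) • x + t • y)‖ₑ ^ 2 := by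
  have hδ := hΩ.pos
  set B := Metric.ball ((1 - t) • c) (t * δ / 2)
  have hr : 0 < t * δ / 2 := by positivity
  have hBΩ : B ⊆ Ω := Metric.ball_subset_closedBall.trans
    (hΩ.closedBall_subset hc ht0 (by linarith) (by linarith))
  have hB0 : volume B ≠ 0 := (Metric.measure_ball_pos volume _ hr).ne'
  have hBt : volume B ≠ ⊤ := measure_ball_lt_top.ne
  have hint : IntegrableOn u B := (hΩ.integrableOn hu).mono_set hBΩ
  -- The ball about `(1 - t) c` is replaced by one about `(1 - t) x`, of twice the radius.
  have hsub : B ⊆ Metric.ball ((1 - t) • x) (t * δ) := fun w hw => by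
    rw [Metric.mem_ball, dist_eq_norm] at hw ⊢
    have h1 : w - (1 - t) • x = (w - (1 - t) • c) - (1 - t) • (x - c) := by module
    have h2 : ‖(1 - t) • (x - c)‖ ≤ t * δ / 2 := by
      rw [norm_smul, Real.norm_of_nonneg (by linarith)]
      nlinarith [norm_nonneg (x - c)]
    rw [h1]
    linarith [norm_sub_le (w - (1 - t) • c) ((1 - t) • (x - c))]
  have hfin : IsFiniteMeasure (volume.restrict B) := ⟨by
    rw [Measure.restrict_apply_univ]; exact hBt.lt_top⟩
  have havg : u x - ⨍ w in B, u w = ⨍ w in B, (u x - u w) := by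
    have : NeZero (volume.restrict B) := ⟨by
      rw [Ne, Measure.restrict_eq_zero]; exact hB0⟩
    have h1 := average_const (volume.restrict B) (u x)
    rw [average_eq] at h1
    rw [average_eq, average_eq, integral_sub (integrable_const _) hint, smul_sub, h1]
  rw [havg, average_eq, enorm_smul, mul_pow]
  have hV : ‖((volume.restrict B).real univ)⁻¹‖ₑ = (volume B)⁻¹ := by
    rw [Measure.real, Measure.restrict_apply_univ, Real.enorm_of_nonneg (by positivity),
      ENNReal.ofReal_inv_of_pos (ENNReal.toReal_pos hB0 hBt), ENNReal.ofReal_toReal hBt]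
  have h3 : ‖∫ w in B, (u x - u w)‖ₑ ^ 2 ≤ volume B * ∫⁻ w in B, ‖u x - u w‖ₑ ^ 2 := by
    have h4 := sq_lintegral_le (μ := volume.restrict B) (f := fun w => ‖u x - u w‖ₑ)
      (by fun_prop)
    rw [Measure.restrict_apply_univ] at h4
    exact (pow_le_pow_left₀ zero_le (enorm_integral_le_lintegral_enorm _) 2).trans h4
  have hvol : ENNReal.ofReal (t ^ 2) * (volume B)⁻¹ = 4 * (volume (Metric.ball (0 : ℂ) δ))⁻¹ := by
    rw [Complex.volume_ball, Complex.volume_ball]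
    have e1 : ENNReal.ofReal (t * δ / 2) ^ 2 * (NNReal.pi : ENNReal)
        = ENNReal.ofReal ((t * δ / 2) ^ 2 * π) := by
      rw [ENNReal.ofReal_mul (by positivity), ENNReal.ofReal_pow hr.le,
        ENNReal.ofReal_eq_coe_nnreal Real.pi_pos.le]
      rfl
    have e2 : ENNReal.ofReal δ ^ 2 * (NNReal.pi : ENNReal) = ENNReal.ofReal (δ ^ 2 * π) := by
      rw [ENNReal.ofReal_mul (by positivity), ENNReal.ofReal_pow hδ.le,
        ENNReal.ofReal_eq_coe_nnreal Real.pi_pos.le]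
      rfl
    have hπ := Real.pi_pos
    rw [e1, e2, ← ENNReal.ofReal_inv_of_pos (by positivity), ← ENNReal.ofReal_inv_of_pos
      (by positivity), show (4 : ENNReal) = ENNReal.ofReal 4 by simp,
      ← ENNReal.ofReal_mul (by positivity), ← ENNReal.ofReal_mul (by positivity)]
    congr 1
    field_simp
    norm_num
  calc ‖((volume.restrict B).real univ)⁻¹‖ₑ ^ 2 * ‖∫ w in B, (u x - u w)‖ₑ ^ 2
      ≤ (volume B)⁻¹ ^ 2 * (volume B * ∫⁻ w in B, ‖u x - u w‖ₑ ^ 2) := by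
        rw [hV]; exact mul_le_mul_right h3 _
    _ = (volume B)⁻¹ * ∫⁻ w in B, ‖u x - u w‖ₑ ^ 2 := by
        rw [pow_two, mul_assoc, ← mul_assoc _ (volume B), ENNReal.inv_mul_cancel hB0 hBt, one_mul]
    _ ≤ (volume B)⁻¹ * ∫⁻ w in Metric.ball ((1 - t) • x) (t * δ), ‖u x - u w‖ₑ ^ 2 :=
        mul_le_mul_right (lintegral_mono_set hsub) _
    _ = _ := by
        rw [lintegral_ball_comp _ _ ht0, ← mul_assoc, mul_comm _ (ENNReal.ofReal _), hvol]

/-- Replacing `u` by its averages near the values of a map `s` close to the identity is a small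
perturbation in `L²`, uniformly for bounded gradients. -/
theorem eLpNorm_sub_average_le (hΩ : IsStarShapedAboutBall Ω δ) {M : ℝ}
    (hM : ∀ x ∈ Ω, ‖x‖ ≤ M) {u g₁ g₂ : ℂ → ℂ} (hum : Measurable u)
    (h : IsH1WithGrad Ω u g₁ g₂) {t : ℝ} (ht0 : 0 < t) (ht1 : t ≤ 1 / 2) {s : ℂ → ℂ}
    (hs : ∀ x ∈ Ω, s x ∈ Ω ∧ ‖x - s x‖ ≤ t * δ / 2) :
    eLpNorm (fun x => u x - ⨍ w in Metric.ball ((1 - t) • s x) (t * δ / 2), u w) 2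
        (volume.restrict Ω) ≤
      ENNReal.ofReal (8 * (M + δ) * t) *
        (eLpNorm g₁ 2 (volume.restrict Ω) + eLpNorm g₂ 2 (volume.restrict Ω)) := by
  have hδ := hΩ.pos
  set V := volume (Metric.ball (0 : ℂ) δ)
  have hV0 : V ≠ 0 := (Metric.measure_ball_pos volume _ hδ).ne'
  have hVt : V ≠ ⊤ := measure_ball_lt_top.ne
  set S := eLpNorm g₁ 2 (volume.restrict Ω) + eLpNorm g₂ 2 (volume.restrict Ω)
  set C := ENNReal.ofReal (4 * (M + δ) * t) * S
  refine (ENNReal.pow_le_pow_left_iff two_ne_zero).1 ?_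
  rw [eLpNorm_two_sq]
  calc ∫⁻ x in Ω, ‖u x - ⨍ w in Metric.ball ((1 - t) • s x) (t * δ / 2), u w‖ₑ ^ 2
      ≤ ∫⁻ x in Ω, 4 * V⁻¹ *
          ∫⁻ y in Metric.ball (0 : ℂ) δ, ‖u x - u ((1 - t) • x + t • y)‖ₑ ^ 2 :=
        setLIntegral_mono' hΩ.measurableSet fun x hx =>
          enorm_sub_average_sq_le hΩ hum h.memLp ht0 ht1 (hs x hx).1 (hs x hx).2
    _ = 4 * V⁻¹ * ∫⁻ x in Ω,
          ∫⁻ y in Metric.ball (0 : ℂ) δ, ‖u x - u ((1 - t) • x + t • y)‖ₑ ^ 2 :=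
        lintegral_const_mul' _ _ (ENNReal.mul_ne_top (by simp) (ENNReal.inv_ne_top.2 hV0))
    _ = 4 * V⁻¹ * ∫⁻ y in Metric.ball (0 : ℂ) δ,
          ∫⁻ x in Ω, ‖u x - u ((1 - t) • x + t • y)‖ₑ ^ 2 := by
        rw [lintegral_lintegral_swap]
        refine Measurable.aemeasurable ?_
        have h1 : Measurable fun p : ℂ × ℂ => u ((1 - t) • p.1 + t • p.2) :=
          hum.comp (by fun_prop)
        exact ((hum.comp measurable_fst).sub h1).enorm.pow_const 2
    _ ≤ 4 * V⁻¹ * ∫⁻ y in Metric.ball (0 : ℂ) δ, C ^ 2 := by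
        refine mul_le_mul_right (setLIntegral_mono' measurableSet_ball fun y hy => ?_) _
        rw [← eLpNorm_two_sq (fun x => u x - u ((1 - t) • x + t • y))]
        exact pow_le_pow_left₀ zero_le (eLpNorm_sub_comp_contraction_le hΩ hM h
          (mem_ball_zero_iff.1 hy).le ht0.le ht1) 2
    _ = (2 * C) ^ 2 := by
        rw [setLIntegral_const, mul_comm (C ^ 2), mul_assoc, ← mul_assoc V⁻¹,
          ENNReal.inv_mul_cancel hV0 hVt, one_mul]
        ring
    _ = _ := by
        rw [← mul_assoc, show (2 : ENNReal) = ENNReal.ofReal 2 by simp,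
          ← ENNReal.ofReal_mul (by norm_num)]
        congr 3
        ring

/-- A bounded set is mapped to finitely many of its points by a measurable map close to the
identity. -/
theorem exists_simpleFunc_near_id {Ω : Set ℂ} (hb : Bornology.IsBounded Ω) (hne : Ω.Nonempty)
    {r : ℝ} (hr : 0 < r) : ∃ s : SimpleFunc ℂ ℂ, (∀ x, s x ∈ Ω) ∧ ∀ x ∈ Ω, ‖x - s x‖ ≤ r := by
  obtain ⟨F, hFΩ, hFf, hF⟩ := Metric.finite_approx_of_totallyBounded
    (hb.isCompact_closure.totallyBounded.subset subset_closure) r hr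
  have hFne : F.Nonempty := by
    obtain ⟨x, hx⟩ := hne
    obtain ⟨y, hy, -⟩ := mem_iUnion₂.1 (hF hx)
    exact ⟨y, hy⟩
  obtain ⟨e, he⟩ := hFf.countable.exists_eq_range hFne
  have hidx : ∀ y ∈ F, ∃ k, e k = y := fun y hy => by rwa [he] at hy
  choose! k hk using hidx
  obtain ⟨N, hN⟩ := (hFf.image k).bddAbove
  refine ⟨SimpleFunc.nearestPt e N, fun x => ?_, fun x hx => ?_⟩
  · refine hFΩ ?_
    rw [he]
    exact ⟨_, rfl⟩
  · obtain ⟨y, hy, hxy⟩ := mem_iUnion₂.1 (hF hx)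
    have h1 := SimpleFunc.edist_nearestPt_le e x (hN ⟨y, hy, rfl⟩)
    rw [hk y hy, edist_dist, edist_dist, ENNReal.ofReal_le_ofReal_iff dist_nonneg] at h1
    rw [← dist_eq_norm, dist_comm]
    rw [Metric.mem_ball, dist_comm] at hxy
    exact h1.trans hxy.le

end Compactness

/-! ### The magnetic Sobolev space -/

section Magnetic

variable {β : ℝ} {Ω : Set ℂ} {δ : ℝ}

/-- The space `L²(Ω; ℂ)`. -/
abbrev SquareIntegrable (Ω : Set ℂ) : Type := Lp ℂ 2 (volume.restrict Ω)

/-- A component `i g + a u` of `(i∇ + F) u`. -/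
noncomputable def covariantPartial (a : ℂ → ℝ) (u g : ℂ → ℂ) (z : ℂ) : ℂ :=
  Complex.I * g z + a z * u z

/-- The ordinary partial derivative `-i (p - a u)` recovered from the component `p = i g + a u` of
`(i∇ + F) u`. -/
noncomputable def ordinaryPartial (a : ℂ → ℝ) (u p : ℂ → ℂ) (z : ℂ) : ℂ :=
  -Complex.I * (p z - a z * u z)

theorem covariantPartial_ordinaryPartial (a : ℂ → ℝ) (u p : ℂ → ℂ) :
    covariantPartial a u (ordinaryPartial a u p) = p := by
  funext z
  simp only [covariantPartial, ordinaryPartial]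
  linear_combination (-(p z - a z * u z)) * Complex.I_mul_I

theorem ordinaryPartial_covariantPartial (a : ℂ → ℝ) (u g : ℂ → ℂ) :
    ordinaryPartial a u (covariantPartial a u g) = g := by
  funext z
  simp only [covariantPartial, ordinaryPartial]
  linear_combination (-g z) * Complex.I_mul_I

theorem continuous_potential₁ (β : ℝ) (Ω : Set ℂ) : Continuous (potential₁ β Ω) := by
  unfold potential₁; fun_prop

theorem continuous_potential₂ (β : ℝ) (Ω : Set ℂ) : Continuous (potential₂ β Ω) := by
  unfold potential₂; fun_prop

theorem memLp_continuous_mul (hb : Bornology.IsBounded Ω) (hm : MeasurableSet Ω) {a : ℂ → ℝ}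
    (ha : Continuous a) {u : ℂ → ℂ} (hu : MemLp u 2 (volume.restrict Ω)) :
    MemLp (fun z => (a z : ℂ) * u z) 2 (volume.restrict Ω) := by
  obtain ⟨A, hA⟩ := hb.isCompact_closure.exists_bound_of_continuousOn ha.continuousOn
  refine hu.of_le_mul (c := A)
    ((Complex.continuous_ofReal.comp ha).aestronglyMeasurable.mul hu.1) ?_
  filter_upwards [ae_restrict_mem hm] with z hz
  rw [norm_mul, Complex.norm_real]
  exact mul_le_mul_of_nonneg_right (hA z (subset_closure hz)) (norm_nonneg _)

theorem memLp_covariantPartial (hb : Bornology.IsBounded Ω) (hm : MeasurableSet Ω) {a : ℂ → ℝ}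
    (ha : Continuous a) {u g : ℂ → ℂ} (hu : MemLp u 2 (volume.restrict Ω))
    (hg : MemLp g 2 (volume.restrict Ω)) :
    MemLp (covariantPartial a u g) 2 (volume.restrict Ω) :=
  (hg.const_mul Complex.I).add (memLp_continuous_mul hb hm ha hu)

theorem memLp_ordinaryPartial (hb : Bornology.IsBounded Ω) (hm : MeasurableSet Ω) {a : ℂ → ℝ}
    (ha : Continuous a) {u p : ℂ → ℂ} (hu : MemLp u 2 (volume.restrict Ω))
    (hp : MemLp p 2 (volume.restrict Ω)) :
    MemLp (ordinaryPartial a u p) 2 (volume.restrict Ω) :=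
  (hp.sub (memLp_continuous_mul hb hm ha hu)).const_mul (-Complex.I)

/-- The functional `f ↦ ∫ k f` on `L²(Ω)`. -/
noncomputable def pairing {k : ℂ → ℂ} (hk : MemLp k 2 (volume.restrict Ω)) :
    SquareIntegrable Ω →L[ℂ] ℂ :=
  innerSL ℂ ((hk.star : MemLp (fun z => conj (k z)) 2 (volume.restrict Ω)).toLp _)

theorem pairing_apply {k : ℂ → ℂ} (hk : MemLp k 2 (volume.restrict Ω)) (f : SquareIntegrable Ω) :
    pairing hk f = ∫ z in Ω, k z * f z := by
  rw [pairing, innerSL_apply_apply, L2.inner_def]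
  refine integral_congr_ae ?_
  filter_upwards [(hk.star : MemLp (fun z => conj (k z)) 2 (volume.restrict Ω)).coeFn_toLp]
    with a h1
  rw [h1, RCLike.inner_apply, Pi.star_apply, RCLike.star_def, Complex.conj_conj, mul_comm]

theorem inner_toLp {f g : ℂ → ℂ} (hf : MemLp f 2 (volume.restrict Ω))
    (hg : MemLp g 2 (volume.restrict Ω)) :
    inner ℂ (hf.toLp f) (hg.toLp g) = ∫ z in Ω, g z * conj (f z) := by
  rw [L2.inner_def]
  refine integral_congr_ae ?_
  filter_upwards [hf.coeFn_toLp, hg.coeFn_toLp] with z h1 h2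
  rw [h1, h2, RCLike.inner_apply]

/-- The pair of components of `(i∇ + F) u` as an element of `L² × L²`. -/
noncomputable def gradLp {p₁ p₂ : ℂ → ℂ} (h₁ : MemLp p₁ 2 (volume.restrict Ω))
    (h₂ : MemLp p₂ 2 (volume.restrict Ω)) :
    WithLp 2 (SquareIntegrable Ω × SquareIntegrable Ω) :=
  WithLp.toLp 2 (h₁.toLp p₁, h₂.toLp p₂)

theorem inner_gradLp {p₁ p₂ q₁ q₂ : ℂ → ℂ} (h₁ : MemLp p₁ 2 (volume.restrict Ω))
    (h₂ : MemLp p₂ 2 (volume.restrict Ω)) (k₁ : MemLp q₁ 2 (volume.restrict Ω))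
    (k₂ : MemLp q₂ 2 (volume.restrict Ω)) :
    inner ℂ (gradLp h₁ h₂) (gradLp k₁ k₂) =
      ∫ z in Ω, (q₁ z * conj (p₁ z) + q₂ z * conj (p₂ z)) := by
  rw [WithLp.prod_inner_apply]
  simp only [gradLp]
  rw [inner_toLp, inner_toLp, integral_add]
  · exact k₁.integrable_mul h₁.star
  · exact k₂.integrable_mul h₂.star

/-- The magnetic form is the inner product of the magnetic gradients. -/
theorem magneticForm_eq_inner {u g₁ g₂ v h₁ h₂ : ℂ → ℂ}
    (hu₁ : MemLp (covariantPartial (potential₁ β Ω) u g₁) 2 (volume.restrict Ω))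
    (hu₂ : MemLp (covariantPartial (potential₂ β Ω) u g₂) 2 (volume.restrict Ω))
    (hv₁ : MemLp (covariantPartial (potential₁ β Ω) v h₁) 2 (volume.restrict Ω))
    (hv₂ : MemLp (covariantPartial (potential₂ β Ω) v h₂) 2 (volume.restrict Ω)) :
    magneticForm β Ω u g₁ g₂ v h₁ h₂ = inner ℂ (gradLp hv₁ hv₂) (gradLp hu₁ hu₂) := by
  rw [inner_gradLp]
  rfl

theorem weakPartial_iff_covariant
    {a : ℂ → ℝ} (ha : Continuous a) {u p : ℂ → ℂ} (hu : MemLp u 2 (volume.restrict Ω))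
    (hp : MemLp p 2 (volume.restrict Ω)) {φ : ℂ → ℝ} (h1 : ContDiff ℝ ∞ φ)
    (h2 : HasCompactSupport φ) (e : ℂ) :
    (∫ z in Ω, ((fderiv ℝ φ z e : ℝ) : ℂ) * u z = - ∫ z in Ω, (φ z : ℂ) * ordinaryPartial a u p z)
    ↔ ∫ z in Ω, (((fderiv ℝ φ z e : ℝ) : ℂ) + Complex.I * ((φ z * a z : ℝ) : ℂ)) * u z =
      Complex.I * ∫ z in Ω, (φ z : ℂ) * p z := by
  have i1 : Integrable (fun z => ((fderiv ℝ φ z e : ℝ) : ℂ) * u z) (volume.restrict Ω) :=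
    (memLp_fderiv_of_hasCompactSupport h1 h2 e Ω).integrable_mul hu
  have i2 : Integrable (fun z => (φ z : ℂ) * p z) (volume.restrict Ω) :=
    (memLp_ofReal_of_hasCompactSupport h1.continuous h2 Ω).integrable_mul hp
  have i3 : Integrable (fun z => ((φ z * a z : ℝ) : ℂ) * u z) (volume.restrict Ω) :=
    (memLp_ofReal_of_hasCompactSupport (h1.continuous.mul ha) h2.mul_right Ω).integrable_mul hu
  have e1 : ∫ z in Ω, (φ z : ℂ) * ordinaryPartial a u p z = -Complex.I *
      ((∫ z in Ω, (φ z : ℂ) * p z) - ∫ z in Ω, ((φ z * a z : ℝ) : ℂ) * u z) := by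
    rw [← integral_sub i2 i3, ← integral_const_mul]
    refine integral_congr_ae (Filter.Eventually.of_forall fun z => ?_)
    simp only [ordinaryPartial]
    push_cast
    ring
  have e2 : ∫ z in Ω, (((fderiv ℝ φ z e : ℝ) : ℂ) + Complex.I * ((φ z * a z : ℝ) : ℂ)) * u z =
      (∫ z in Ω, ((fderiv ℝ φ z e : ℝ) : ℂ) * u z) +
        Complex.I * ∫ z in Ω, ((φ z * a z : ℝ) : ℂ) * u z := by
    rw [← integral_const_mul, ← integral_add i1 (i3.const_mul _)]
    refine integral_congr_ae (Filter.Eventually.of_forall fun z => ?_)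
    ring
  rw [e1, e2]
  constructor
  · intro h
    rw [h]
    ring
  · intro h
    linear_combination h

theorem memLp_twisted {a : ℂ → ℝ} (ha : Continuous a) {φ : ℂ → ℝ} (h1 : ContDiff ℝ ∞ φ)
    (h2 : HasCompactSupport φ) (e : ℂ) (Ω : Set ℂ) :
    MemLp (fun z => ((fderiv ℝ φ z e : ℝ) : ℂ) + Complex.I * ((φ z * a z : ℝ) : ℂ)) 2
      (volume.restrict Ω) :=
  (memLp_fderiv_of_hasCompactSupport h1 h2 e Ω).add
    ((memLp_ofReal_of_hasCompactSupport (h1.continuous.mul ha) h2.mul_right Ω).const_mul _)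

/-- The Hilbert space `L² × (L² × L²)`, which contains the triples `(u, (i∇ + F) u)`. -/
abbrev MagneticAmbient (Ω : Set ℂ) : Type :=
  WithLp 2 (SquareIntegrable Ω × WithLp 2 (SquareIntegrable Ω × SquareIntegrable Ω))

/-- The projection of a triple to the function. -/
noncomputable def ambientFunction (Ω : Set ℂ) : MagneticAmbient Ω →L[ℂ] SquareIntegrable Ω :=
  WithLp.fstL 2 ℂ (SquareIntegrable Ω) (WithLp 2 (SquareIntegrable Ω × SquareIntegrable Ω))

/-- The projection of a triple to the magnetic gradient. -/
noncomputable def ambientGradient (Ω : Set ℂ) :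
    MagneticAmbient Ω →L[ℂ] WithLp 2 (SquareIntegrable Ω × SquareIntegrable Ω) :=
  WithLp.sndL 2 ℂ (SquareIntegrable Ω) (WithLp 2 (SquareIntegrable Ω × SquareIntegrable Ω))

/-- The functional on triples which vanishes when `p` is the covariant derivative of the function
in the direction `e`, as tested against `φ`; here `pr` is the projection of the triple to `p`. -/
noncomputable def covariantTest {a : ℂ → ℝ} (ha : Continuous a)
    (pr : WithLp 2 (SquareIntegrable Ω × SquareIntegrable Ω) →L[ℂ] SquareIntegrable Ω) (e : ℂ)
    {φ : ℂ → ℝ} (h1 : ContDiff ℝ ∞ φ) (h2 : HasCompactSupport φ) : MagneticAmbient Ω →L[ℂ] ℂ :=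
  (pairing (memLp_twisted ha h1 h2 e Ω)).comp (ambientFunction Ω) -
    Complex.I • ((pairing (memLp_ofReal_of_hasCompactSupport h1.continuous h2 Ω)).comp
      (pr.comp (ambientGradient Ω)))

theorem covariantTest_eq_zero_iff {a : ℂ → ℝ} (ha : Continuous a)
    (pr : WithLp 2 (SquareIntegrable Ω × SquareIntegrable Ω) →L[ℂ] SquareIntegrable Ω) (e : ℂ)
    {φ : ℂ → ℝ} (h1 : ContDiff ℝ ∞ φ) (h2 : HasCompactSupport φ) (w : MagneticAmbient Ω) :
    covariantTest ha pr e h1 h2 w = 0 ↔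
      ∫ z in Ω, ((fderiv ℝ φ z e : ℝ) : ℂ) * w.fst z =
        - ∫ z in Ω, (φ z : ℂ) * ordinaryPartial a w.fst (pr w.snd) z := by
  rw [weakPartial_iff_covariant ha (Lp.memLp w.fst) (Lp.memLp (pr w.snd)) h1 h2 e,
    covariantTest, sub_apply, smul_apply,
    ContinuousLinearMap.comp_apply, ContinuousLinearMap.comp_apply,
    ContinuousLinearMap.comp_apply, pairing_apply, pairing_apply, sub_eq_zero, smul_eq_mul]
  rfl

/-- The Hilbert space of the triples `(u, (i∇ + F) u)` with `u ∈ H¹(Ω)`, as a closed subspace of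
`L² × (L² × L²)`. Its norm is the graph norm of the magnetic gradient. -/
noncomputable def magneticSpace (β : ℝ) (Ω : Set ℂ) : Submodule ℂ (MagneticAmbient Ω) :=
  ⨅ φ : {φ : ℂ → ℝ // ContDiff ℝ ∞ φ ∧ HasCompactSupport φ ∧ tsupport φ ⊆ Ω},
    (covariantTest (continuous_potential₁ β Ω)
        (WithLp.fstL 2 ℂ (SquareIntegrable Ω) (SquareIntegrable Ω)) 1 φ.2.1 φ.2.2.1).ker ⊓
      (covariantTest (continuous_potential₂ β Ω)
        (WithLp.sndL 2 ℂ (SquareIntegrable Ω) (SquareIntegrable Ω)) Complex.I φ.2.1 φ.2.2.1).ker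

theorem isClosed_magneticSpace (β : ℝ) (Ω : Set ℂ) :
    IsClosed (magneticSpace β Ω : Set (MagneticAmbient Ω)) := by
  rw [magneticSpace, Submodule.coe_iInf]
  refine isClosed_iInter fun φ => ?_
  rw [Submodule.coe_inf]
  exact (ContinuousLinearMap.isClosed_ker _).inter (ContinuousLinearMap.isClosed_ker _)

instance completeSpace_magneticSpace (β : ℝ) (Ω : Set ℂ) : CompleteSpace (magneticSpace β Ω) :=
  (isClosed_magneticSpace β Ω).completeSpace_coe

/-- The elements of the magnetic space are the `H¹` functions with their magnetic gradients. -/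
theorem mem_magneticSpace_iff (hb : Bornology.IsBounded Ω) (hm : MeasurableSet Ω)
    (w : MagneticAmbient Ω) :
    w ∈ magneticSpace β Ω ↔ IsH1WithGrad Ω w.fst
      (ordinaryPartial (potential₁ β Ω) w.fst w.snd.fst)
      (ordinaryPartial (potential₂ β Ω) w.fst w.snd.snd) := by
  have c₁ := continuous_potential₁ β Ω
  have c₂ := continuous_potential₂ β Ω
  have m0 := Lp.memLp w.fst
  have m1 := Lp.memLp w.snd.fst
  have m2 := Lp.memLp w.snd.snd
  have hmem : w ∈ magneticSpace β Ω ↔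
      HasWeakPartial Ω 1 w.fst (ordinaryPartial (potential₁ β Ω) w.fst w.snd.fst) ∧
      HasWeakPartial Ω Complex.I w.fst (ordinaryPartial (potential₂ β Ω) w.fst w.snd.snd) := by
    rw [magneticSpace, Submodule.mem_iInf]
    simp only [Submodule.mem_inf, LinearMap.mem_ker, ContinuousLinearMap.coe_coe,
      covariantTest_eq_zero_iff]
    constructor
    · intro h
      exact ⟨fun φ a b c => (h ⟨φ, a, b, c⟩).1, fun φ a b c => (h ⟨φ, a, b, c⟩).2⟩
    · rintro ⟨h1, h2⟩ φ
      exact ⟨h1 φ.1 φ.2.1 φ.2.2.1 φ.2.2.2, h2 φ.1 φ.2.1 φ.2.2.1 φ.2.2.2⟩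
  rw [hmem]
  exact ⟨fun h => ⟨m0, memLp_ordinaryPartial hb hm c₁ m0 m1, memLp_ordinaryPartial hb hm c₂ m0 m2,
    h.1, h.2⟩, fun h => ⟨h.weak_fst, h.weak_snd⟩⟩

theorem toLp_mem_magneticSpace (hb : Bornology.IsBounded Ω) (hm : MeasurableSet Ω)
    {u g₁ g₂ : ℂ → ℂ} (h : IsH1WithGrad Ω u g₁ g₂)
    (h₁ : MemLp (covariantPartial (potential₁ β Ω) u g₁) 2 (volume.restrict Ω))
    (h₂ : MemLp (covariantPartial (potential₂ β Ω) u g₂) 2 (volume.restrict Ω)) :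
    WithLp.toLp 2 (h.memLp.toLp u, gradLp h₁ h₂) ∈ magneticSpace β Ω := by
  rw [mem_magneticSpace_iff hb hm]
  have key : ∀ {a : ℂ → ℝ} {g : ℂ → ℂ} (hp : MemLp (covariantPartial a u g) 2
      (volume.restrict Ω)), g =ᵐ[volume.restrict Ω]
      ordinaryPartial a (h.memLp.toLp u) (hp.toLp _) := fun {a g} hp => by
    filter_upwards [h.memLp.coeFn_toLp, hp.coeFn_toLp] with z h1 h2
    have := congrFun (ordinaryPartial_covariantPartial a u g) z
    simp only [ordinaryPartial] at this ⊢
    rw [h1, h2, this]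
  have k0 : u =ᵐ[volume.restrict Ω] h.memLp.toLp u := h.memLp.coeFn_toLp.symm
  exact ⟨h.memLp.ae_eq k0, h.memLp_fst.ae_eq (key h₁), h.memLp_snd.ae_eq (key h₂),
    h.weak_fst.congr k0 (key h₁), h.weak_snd.congr k0 (key h₂)⟩

/-- The embedding of the magnetic Sobolev space into `L²`. -/
noncomputable def magneticEmbedding (β : ℝ) (Ω : Set ℂ) :
    magneticSpace β Ω →L[ℂ] SquareIntegrable Ω :=
  (ambientFunction Ω).comp (magneticSpace β Ω).subtypeL

end Magnetic

/-! ### Compactness of the embedding -/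

section Compactness

variable {β : ℝ} {Ω : Set ℂ} {δ : ℝ}

theorem isCompactOperator_smulRight {E F : Type*} [NormedAddCommGroup E] [NormedSpace ℂ E]
    [NormedAddCommGroup F] [NormedSpace ℂ F] (l : E →L[ℂ] ℂ) (y : F) :
    IsCompactOperator (l.smulRight y) := by
  have h : IsCompactOperator (ContinuousLinearMap.toSpanSingleton ℂ y) :=
    isCompactOperator_of_locallyCompactSpace_rng _
  exact h.comp_clm l

theorem isCompactOperator_of_forall_norm_sub_lt {E F : Type*} [NormedAddCommGroup E]
    [NormedSpace ℂ E] [NormedAddCommGroup F] [NormedSpace ℂ F] [CompleteSpace F] {f : E →L[ℂ] F}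
    (h : ∀ ε > 0, ∃ P : E →L[ℂ] F, IsCompactOperator P ∧ ‖f - P‖ < ε) : IsCompactOperator f := by
  refine (isClosed_setOfPred_isCompactOperator (σ₁₂ := RingHom.id ℂ) (M₁ := E)
    (M₂ := F)).closure_subset ?_
  rw [Metric.mem_closure_iff]
  intro ε hε
  obtain ⟨P, hP, hn⟩ := h ε hε
  exact ⟨P, hP, by rwa [dist_eq_norm]⟩

/-- Averages over small balls, one for each cell of a finite measurable partition, form an operator
of finite rank. -/
theorem exists_isCompactOperator_average (hfin : volume Ω ≠ ⊤) (s : SimpleFunc ℂ ℂ)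
    (B : ℂ → Set ℂ) (hBm : ∀ c, MeasurableSet (B c)) (hB : ∀ c ∈ s.range, B c ⊆ Ω) :
    ∃ P : SquareIntegrable Ω →L[ℂ] SquareIntegrable Ω, IsCompactOperator P ∧
      ∀ f, P f =ᵐ[volume.restrict Ω] fun x => ⨍ w in B (s x), f w := by
  have hfin' : ∀ A : Set ℂ, volume.restrict Ω A ≠ ⊤ := fun A =>
    ((measure_mono (subset_univ A)).trans_lt (by simpa using hfin.lt_top)).ne
  set l : ℂ → SquareIntegrable Ω →L[ℂ] ℂ := fun c =>
    (((volume.real (B c))⁻¹ : ℝ) : ℂ) •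
      innerSL ℂ (indicatorConstLp 2 (hBm c) (hfin' (B c)) (1 : ℂ))
  have hl : ∀ c ∈ s.range, ∀ f : SquareIntegrable Ω, l c f = ⨍ w in B c, f w := by
    intro c hc f
    simp only [l]
    rw [smul_apply, innerSL_apply_apply, L2.inner_indicatorConstLp_one, setAverage_eq,
      Measure.restrict_restrict (hBm c), inter_eq_left.2 (hB c hc), smul_eq_mul,
      Complex.real_smul]
  refine ⟨∑ c ∈ s.range, (l c).smulRight
    (indicatorConstLp 2 (s.measurableSet_fiber c) (hfin' _) (1 : ℂ)), ?_, ?_⟩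
  · have : ∑ c ∈ s.range, (l c).smulRight
        (indicatorConstLp 2 (s.measurableSet_fiber c) (hfin' _) (1 : ℂ)) ∈
        compactOperator (RingHom.id ℂ) (SquareIntegrable Ω) (SquareIntegrable Ω) :=
      sum_mem fun c _ => isCompactOperator_smulRight _ _
    exact this
  · intro f
    rw [sum_apply]
    have h1 := Lp.coeFn_fun_finsetSum s.range fun c => ((l c).smulRight
      (indicatorConstLp 2 (s.measurableSet_fiber c) (hfin' _) (1 : ℂ)) : _ →L[ℂ] SquareIntegrable Ω) f
    have h2 : ∀ᵐ x ∂(volume.restrict Ω), ∀ c ∈ s.range, (((l c).smulRight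
        (indicatorConstLp 2 (s.measurableSet_fiber c) (hfin' _) (1 : ℂ)) :
          _ →L[ℂ] SquareIntegrable Ω) f) x = l c f * (s ⁻¹' {c}).indicator (fun _ => (1 : ℂ)) x := by
      rw [Finset.eventually_all]
      intro c _
      rw [ContinuousLinearMap.smulRight_apply]
      filter_upwards [Lp.coeFn_smul (l c f) (indicatorConstLp 2 (s.measurableSet_fiber c)
        (hfin' _) (1 : ℂ)), indicatorConstLp_coeFn (p := 2) (hs := s.measurableSet_fiber c)
        (hμs := hfin' _) (c := (1 : ℂ))] with x h3 h4
      rw [h3, Pi.smul_apply, h4, smul_eq_mul]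
    filter_upwards [h1, h2] with x h3 h4
    rw [h3, Finset.sum_congr rfl h4, Finset.sum_eq_single (s x)]
    · rw [indicator_of_mem (by simp), mul_one, hl _ (s.mem_range_self x)]
    · intro c _ hc
      rw [indicator_of_notMem (by simpa using fun h => hc h.symm), mul_zero]
    · intro h
      exact absurd (s.mem_range_self x) h

theorem eLpNorm_ordinaryPartial_le (hm : MeasurableSet Ω) {a : ℂ → ℝ} (ha : Continuous a) {A : ℝ}
    (hA : ∀ z ∈ Ω, |a z| ≤ A) (u p : SquareIntegrable Ω) :
    eLpNorm (ordinaryPartial a u p) 2 (volume.restrict Ω) ≤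
      ENNReal.ofReal (‖p‖ + A * ‖u‖) := by
  have hae : ∀ᵐ z ∂(volume.restrict Ω), ‖(a z : ℂ) * u z‖ ≤ A * ‖u z‖ := by
    filter_upwards [ae_restrict_mem hm] with z hz
    rw [norm_mul, Complex.norm_real]
    exact mul_le_mul_of_nonneg_right (hA z hz) (norm_nonneg _)
  have m1 : AEStronglyMeasurable (fun z => (a z : ℂ) * u z) (volume.restrict Ω) :=
    (Complex.continuous_ofReal.comp ha).aestronglyMeasurable.mul (Lp.aestronglyMeasurable u)
  have e1 : eLpNorm (ordinaryPartial a u p) 2 (volume.restrict Ω) =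
      eLpNorm ((p : ℂ → ℂ) - fun z => (a z : ℂ) * u z) 2 (volume.restrict Ω) := by
    refine eLpNorm_congr_norm_ae (Filter.Eventually.of_forall fun z => ?_)
    simp [ordinaryPartial]
  have h0 : ∀ f : SquareIntegrable Ω, eLpNorm f 2 (volume.restrict Ω) = ENNReal.ofReal ‖f‖ :=
    fun f => by rw [Lp.norm_def, ENNReal.ofReal_toReal (Lp.eLpNorm_ne_top f)]
  rw [e1]
  rcases lt_or_ge A 0 with hA0 | hA0
  · -- a negative bound leaves no room for points of `Ω`
    have hΩ : Ω = ∅ := by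
      by_contra hne
      obtain ⟨z, hz⟩ := nonempty_iff_ne_empty.2 hne
      exact absurd ((abs_nonneg _).trans (hA z hz)) (not_le.2 hA0)
    subst hΩ
    simp
  calc _ ≤ eLpNorm p 2 (volume.restrict Ω) + eLpNorm (fun z => (a z : ℂ) * u z) 2
        (volume.restrict Ω) := eLpNorm_sub_le (Lp.aestronglyMeasurable p) m1 (by norm_num)
    _ ≤ eLpNorm p 2 (volume.restrict Ω) +
        ENNReal.ofReal A * eLpNorm u 2 (volume.restrict Ω) := by
      gcongr
      exact eLpNorm_le_mul_eLpNorm_of_ae_le_mul hae 2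
    _ = _ := by
      rw [h0, h0, ← ENNReal.ofReal_mul hA0, ← ENNReal.ofReal_add (norm_nonneg _) (by positivity)]

/-- Rellich's theorem: the embedding is a limit of averaging operators of finite rank. -/
theorem isCompactOperator_magneticEmbedding (β : ℝ) (hΩ : IsStarShapedAboutBall Ω δ) :
    IsCompactOperator (magneticEmbedding β Ω) := by
  have hm := hΩ.measurableSet
  have hδ := hΩ.pos
  obtain ⟨M, hM⟩ := hΩ.isBounded.exists_norm_le
  have hM0 : 0 ≤ M := by simpa using hM 0 hΩ.zero_mem
  have c₁ := continuous_potential₁ β Ω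
  have c₂ := continuous_potential₂ β Ω
  have hbd : ∀ a : ℂ → ℝ, Continuous a → ∃ A, ∀ z ∈ Ω, |a z| ≤ A := fun a ha => by
    obtain ⟨A, hA⟩ := hΩ.isBounded.isCompact_closure.exists_bound_of_continuousOn ha.continuousOn
    exact ⟨A, fun z hz => hA z (subset_closure hz)⟩
  obtain ⟨A₁, hA₁⟩ := hbd _ c₁
  obtain ⟨A₂, hA₂⟩ := hbd _ c₂
  have hA₁0 : 0 ≤ A₁ := (abs_nonneg _).trans (hA₁ 0 hΩ.zero_mem)
  have hA₂0 : 0 ≤ A₂ := (abs_nonneg _).trans (hA₂ 0 hΩ.zero_mem)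
  set C := 8 * (M + δ) * (2 + A₁ + A₂)
  have hC : 0 < C := by positivity
  have happrox : ∀ t : ℝ, 0 < t → t ≤ 1 / 2 → ∃ P : magneticSpace β Ω →L[ℂ] SquareIntegrable Ω,
      IsCompactOperator P ∧ ‖magneticEmbedding β Ω - P‖ ≤ C * t := by
    intro t ht0 ht1
    obtain ⟨s, hs1, hs2⟩ := exists_simpleFunc_near_id hΩ.isBounded ⟨0, hΩ.zero_mem⟩
      (r := t * δ / 2) (by positivity)
    obtain ⟨P, hPc, hP⟩ := exists_isCompactOperator_average hΩ.volume_lt_top.ne s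
      (fun c => Metric.ball ((1 - t) • c) (t * δ / 2)) (fun c => measurableSet_ball) (by
        intro c hc
        obtain ⟨x, rfl⟩ := SimpleFunc.mem_range.1 hc
        exact Metric.ball_subset_closedBall.trans
          (hΩ.closedBall_subset (hs1 x) ht0 (by linarith) (by nlinarith)))
    refine ⟨P.comp (magneticEmbedding β Ω), hPc.comp_clm _, ?_⟩
    refine ContinuousLinearMap.opNorm_le_bound _ (by positivity) fun w => ?_
    have hw := (mem_magneticSpace_iff hΩ.isBounded hm (w : MagneticAmbient Ω)).1 w.2
    set u := (w : MagneticAmbient Ω).fst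
    set p₁ := (w : MagneticAmbient Ω).snd.fst
    set p₂ := (w : MagneticAmbient Ω).snd.snd
    have n0 : ‖u‖ ≤ ‖w‖ := WithLp.norm_fst_le _ (w : MagneticAmbient Ω)
    have n3 : ‖(w : MagneticAmbient Ω).snd‖ ≤ ‖w‖ := WithLp.norm_snd_le _ (w : MagneticAmbient Ω)
    have n1 : ‖p₁‖ ≤ ‖w‖ := (WithLp.norm_fst_le _ _).trans n3
    have n2 : ‖p₂‖ ≤ ‖w‖ := (WithLp.norm_snd_le _ _).trans n3
    have key := eLpNorm_sub_average_le hΩ hM (Lp.stronglyMeasurable u).measurable hw ht0 ht1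
      (s := s) fun x hx => ⟨hs1 x, hs2 x hx⟩
    have e : (magneticEmbedding β Ω - P.comp (magneticEmbedding β Ω)) w = u - P u := rfl
    rw [e, Lp.norm_def]
    refine ENNReal.toReal_le_of_le_ofReal (by positivity) ?_
    have hae : (u - P u : SquareIntegrable Ω) =ᵐ[volume.restrict Ω] fun x =>
        u x - ⨍ w in Metric.ball ((1 - t) • s x) (t * δ / 2), u w := by
      filter_upwards [Lp.coeFn_sub u (P u), hP u] with x h1 h2
      rw [h1, Pi.sub_apply, h2]
    rw [eLpNorm_congr_ae hae]
    refine key.trans ?_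
    calc _ ≤ ENNReal.ofReal (8 * (M + δ) * t) *
          (ENNReal.ofReal (‖p₁‖ + A₁ * ‖u‖) + ENNReal.ofReal (‖p₂‖ + A₂ * ‖u‖)) := by
          gcongr
          · exact eLpNorm_ordinaryPartial_le hm c₁ hA₁ u p₁
          · exact eLpNorm_ordinaryPartial_le hm c₂ hA₂ u p₂
      _ = ENNReal.ofReal (8 * (M + δ) * t * ((‖p₁‖ + A₁ * ‖u‖) + (‖p₂‖ + A₂ * ‖u‖))) := by
          rw [← ENNReal.ofReal_add (by positivity) (by positivity),
            ← ENNReal.ofReal_mul (by positivity)]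
      _ ≤ _ := by
          refine ENNReal.ofReal_le_ofReal ?_
          have : (‖p₁‖ + A₁ * ‖u‖) + (‖p₂‖ + A₂ * ‖u‖) ≤ (2 + A₁ + A₂) * ‖w‖ := by nlinarith
          calc _ ≤ 8 * (M + δ) * t * ((2 + A₁ + A₂) * ‖w‖) := by gcongr
            _ = _ := by simp only [C]; ring
  refine isCompactOperator_of_forall_norm_sub_lt fun ε hε => ?_
  have ht : 0 < min (1 / 2) (ε / (2 * C)) := by positivity
  obtain ⟨P, hP, hn⟩ := happrox _ ht (min_le_left _ _)
  refine ⟨P, hP, hn.trans_lt ?_⟩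
  calc C * min (1 / 2) (ε / (2 * C)) ≤ C * (ε / (2 * C)) := by gcongr; exact min_le_right _ _
    _ = ε / 2 := by field_simp
    _ < ε := by linarith

end Compactness

/-! ### Existence and positivity of the Neumann spectrum -/

section Spectrum

variable {β : ℝ} {Ω : Set ℂ} {δ : ℝ}

theorem isH1WithGrad_ofReal {φ : ℂ → ℝ} (h1 : ContDiff ℝ ∞ φ) (h2 : HasCompactSupport φ)
    (Ω : Set ℂ) :
    IsH1WithGrad Ω (fun z => (φ z : ℂ)) (fun z => ((fderiv ℝ φ z 1 : ℝ) : ℂ))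
      (fun z => ((fderiv ℝ φ z Complex.I : ℝ) : ℂ)) := by
  obtain ⟨K, hK⟩ := (h1.of_le (by simp) : ContDiff ℝ 1 φ).lipschitzWith_of_hasCompactSupport h2
    (by simp)
  have hL : LipschitzWith K (fun z => (φ z : ℂ)) := fun x y => by
    have := hK x y
    rwa [edist_nndist, edist_nndist, ← Complex.isometry_ofReal.nndist_eq (φ x),
      ← edist_nndist, ← edist_nndist] at this
  have hd : ∀ z e, fderiv ℝ (fun z => (φ z : ℂ)) z e = ((fderiv ℝ φ z e : ℝ) : ℂ) := fun z e => by
    have h := Complex.ofRealCLM.hasFDerivAt.comp z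
      (h1.differentiable (by simp) z).hasFDerivAt
    exact congrArg (fun L : ℂ →L[ℝ] ℂ => L e) h.fderiv
  refine ⟨memLp_ofReal_of_hasCompactSupport h1.continuous h2 Ω,
    memLp_fderiv_of_hasCompactSupport h1 h2 1 Ω,
    memLp_fderiv_of_hasCompactSupport h1 h2 Complex.I Ω, ?_, ?_⟩
  · simpa only [hd] using hasWeakPartial_of_lipschitz (Ω := Ω) hL 1
  · simpa only [hd] using hasWeakPartial_of_lipschitz (Ω := Ω) hL Complex.I

theorem IsStarShapedAboutBall.eq_zero_of_integral_eq_zero (hΩ : IsStarShapedAboutBall Ω δ)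
    (f : SquareIntegrable Ω)
    (h : ∀ φ : ℂ → ℝ, ContDiff ℝ ∞ φ → HasCompactSupport φ → tsupport φ ⊆ Ω →
      ∫ z in Ω, (φ z : ℂ) * f z = 0) : f = 0 := by
  refine Lp.ext ?_
  have h1 := hΩ.isOpen.ae_eq_zero_of_integral_contDiff_smul_eq_zero (μ := volume) (f := f)
    (hΩ.integrableOn (Lp.memLp f)).locallyIntegrableOn (fun φ a b c => by
      rw [← h φ a b c, setIntegral_eq_integral_of_forall_compl_eq_zero]
      · rfl
      · intro z hz
        rw [image_eq_zero_of_notMem_tsupport fun h' => hz (c h')]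
        simp)
  filter_upwards [(ae_restrict_iff' hΩ.measurableSet).2 h1, Lp.coeFn_zero ℂ 2
    (volume.restrict Ω)] with z h2 h3
  rw [h2, h3, Pi.zero_apply]

theorem denseRange_magneticEmbedding (β : ℝ) (hΩ : IsStarShapedAboutBall Ω δ) :
    DenseRange (magneticEmbedding β Ω) := by
  have h1 : (LinearMap.range (magneticEmbedding β Ω : magneticSpace β Ω →ₗ[ℂ]
      SquareIntegrable Ω)).topologicalClosure = ⊤ := by
    rw [Submodule.topologicalClosure_eq_top_iff, Submodule.eq_bot_iff]
    intro f hf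
    refine hΩ.eq_zero_of_integral_eq_zero f fun φ a b c => ?_
    have hH := isH1WithGrad_ofReal a b Ω
    have m₁ := memLp_covariantPartial hΩ.isBounded hΩ.measurableSet (continuous_potential₁ β Ω)
      hH.memLp hH.memLp_fst
    have m₂ := memLp_covariantPartial hΩ.isBounded hΩ.measurableSet (continuous_potential₂ β Ω)
      hH.memLp hH.memLp_snd
    have hw := toLp_mem_magneticSpace hΩ.isBounded hΩ.measurableSet hH m₁ m₂
    have h2 := hf (hH.memLp.toLp _) ⟨⟨_, hw⟩, rfl⟩
    rw [L2.inner_def] at h2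
    rw [← h2]
    refine integral_congr_ae ?_
    filter_upwards [hH.memLp.coeFn_toLp] with z hz
    rw [hz, RCLike.inner_apply, Complex.conj_ofReal, mul_comm]
  have h2 := congrArg (fun S : Submodule ℂ (SquareIntegrable Ω) => (S : Set (SquareIntegrable Ω))) h1
  simp only [Submodule.topologicalClosure_coe, Submodule.top_coe] at h2
  exact dense_iff_closure_eq.2 h2

theorem IsStarShapedAboutBall.not_finiteDimensional (hΩ : IsStarShapedAboutBall Ω δ) :
    ¬ FiniteDimensional ℂ (SquareIntegrable Ω) := by
  intro hfd
  have hδ := hΩ.pos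
  have ha : Antitone fun n : ℕ => δ / (n + 1) := fun m n h => by
    have : (m : ℝ) ≤ n := by exact_mod_cast h
    simp only
    gcongr
  -- The indicators of disjoint annuli are linearly independent.
  set S : ℕ → Set ℂ := fun n => (fun z : ℂ => ‖z‖) ⁻¹' Ioo (δ / ((n + 1 : ℕ) + 1)) (δ / (n + 1))
  have hSo : ∀ n, IsOpen (S n) := fun n => isOpen_Ioo.preimage continuous_norm
  have hSd : Pairwise (Function.onFun Disjoint S) := fun i j h =>
    (ha.pairwise_disjoint_on_Ioo_succ h).preimage _
  have hSΩ : ∀ n, S n ⊆ Ω := fun n z hz => by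
    have h1 : ‖z‖ ≤ δ := hz.2.le.trans (div_le_self hδ.le (by simp))
    simpa using hΩ.segment 0 hΩ.zero_mem z h1 1 zero_le_one le_rfl
  have hfin : ∀ n, volume.restrict Ω (S n) ≠ ⊤ := fun n =>
    ((measure_mono (subset_univ _)).trans_lt (by simpa using hΩ.volume_lt_top)).ne
  have hpos : ∀ n, 0 < (volume.restrict Ω).real (S n) := fun n => by
    refine ENNReal.toReal_pos ?_ (hfin n)
    rw [Measure.restrict_apply (hSo n).measurableSet, inter_eq_left.2 (hSΩ n)]
    refine ((hSo n).measure_pos _ ?_).ne'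
    have hlt : δ / ((n + 1 : ℕ) + 1) < δ / (n + 1) := by
      push_cast
      gcongr
      linarith
    obtain ⟨x, hx⟩ : ∃ x, x ∈ Ioo (δ / ((n + 1 : ℕ) + 1)) (δ / (n + 1)) := exists_between hlt
    have hx0 : 0 < x := (by positivity : (0 : ℝ) < δ / ((n + 1 : ℕ) + 1)).trans hx.1
    refine ⟨x, ?_⟩
    change ‖(x : ℂ)‖ ∈ Ioo _ _
    rw [Complex.norm_real, Real.norm_of_nonneg hx0.le]
    exact hx
  have hli := linearIndependent_of_ne_zero_of_inner_eq_zero (𝕜 := ℂ)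
    (v := fun n => indicatorConstLp 2 (hSo n).measurableSet (hfin n) (1 : ℂ)) (fun n h => by
      have := L2.inner_indicatorConstLp_one_indicatorConstLp_one (𝕜 := ℂ) (hSo n).measurableSet
        (hSo n).measurableSet (hfin n) (hfin n)
      rw [h, inner_zero_left, inter_self] at this
      exact (hpos n).ne (Complex.ofReal_injective (by rw [Complex.ofReal_zero]; exact this))) (fun i j hij => by
      beta_reduce
      rw [L2.inner_indicatorConstLp_one_indicatorConstLp_one (𝕜 := ℂ) (hSo i).measurableSet
        (hSo j).measurableSet (hfin i) (hfin j), (hSd hij).inter_eq]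
      simp)
  have := hli.finite
  exact not_finite ℕ

theorem inner_toLp_left {f : ℂ → ℂ} (hf : MemLp f 2 (volume.restrict Ω)) (g : SquareIntegrable Ω) :
    inner ℂ (hf.toLp f) g = ∫ z in Ω, g z * conj (f z) := by
  conv_lhs => rw [← Lp.toLp_coeFn g (Lp.memLp g)]
  exact inner_toLp hf (Lp.memLp g)

/-- The eigenvalue problem for a form given by `u ↦ p` on the graph `W` of all pairs `(u, p)`. -/
theorem exists_hilbertBasis_of_graph {H G : Type*} [NormedAddCommGroup H] [InnerProductSpace ℂ H]
    [CompleteSpace H] [NormedAddCommGroup G] [InnerProductSpace ℂ G]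
    (hH : ¬ FiniteDimensional ℂ H) (W : Submodule ℂ (WithLp 2 (H × G))) [CompleteSpace W]
    (J : W →L[ℂ] H) (hJ : ∀ w, J w = (w : WithLp 2 (H × G)).fst) (hc : IsCompactOperator J)
    (hd : DenseRange J) :
    ∃ (μ : ℕ → ℝ) (b : HilbertBasis ℕ ℂ H) (p : ℕ → G), Monotone μ ∧
      (∀ j, WithLp.toLp 2 (b j, p j) ∈ W) ∧
      ∀ j, ∀ v ∈ W, inner ℂ v.snd (p j) = (μ j : ℂ) * inner ℂ v.fst (b j) := by
  obtain ⟨κ, b, w, hκ, hpos, hw, hinner⟩ := exists_hilbertBasis_of_compact_embedding hH J hc hd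
  -- The inner product of the graph is `⟪u, v⟫` plus the form, hence the shift by one.
  refine ⟨fun j => (κ j)⁻¹ - 1, b, fun j => (w j : WithLp 2 (H × G)).snd, fun i j h => ?_,
    fun j => ?_, fun j v hv => ?_⟩
  · have := inv_anti₀ (hpos j) (hκ h)
    simp only
    linarith
  · rw [← hw j, hJ]
    exact (w j).2
  · have h := hinner j ⟨v, hv⟩
    rw [Submodule.coe_inner, WithLp.prod_inner_apply, hJ] at h
    have e : inner ℂ v.fst (w j : WithLp 2 (H × G)).fst = inner ℂ v.fst (b j) := by
      rw [← hw j, hJ]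
    have h' : inner ℂ v.fst (w j : WithLp 2 (H × G)).fst +
      inner ℂ v.snd (w j : WithLp 2 (H × G)).snd = ((κ j)⁻¹ : ℂ) * inner ℂ v.fst (b j) := h
    push_cast
    linear_combination h' - e

theorem inner_gradLp_left {q₁ q₂ : ℂ → ℂ} (h₁ : MemLp q₁ 2 (volume.restrict Ω))
    (h₂ : MemLp q₂ 2 (volume.restrict Ω))
    (P : WithLp 2 (SquareIntegrable Ω × SquareIntegrable Ω)) :
    inner ℂ (gradLp h₁ h₂) P = ∫ z in Ω, (P.fst z * conj (q₁ z) + P.snd z * conj (q₂ z)) := by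
  rw [WithLp.prod_inner_apply, integral_add]
  · exact congrArg₂ (· + ·) (inner_toLp_left h₁ P.fst) (inner_toLp_left h₂ P.snd)
  · exact (Lp.memLp P.fst).integrable_mul h₁.star
  · exact (Lp.memLp P.snd).integrable_mul h₂.star

theorem magneticForm_ordinaryPartial (u : ℂ → ℂ)
    (P : WithLp 2 (SquareIntegrable Ω × SquareIntegrable Ω)) {v h₁ h₂ : ℂ → ℂ}
    (hv₁ : MemLp (covariantPartial (potential₁ β Ω) v h₁) 2 (volume.restrict Ω))
    (hv₂ : MemLp (covariantPartial (potential₂ β Ω) v h₂) 2 (volume.restrict Ω)) :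
    magneticForm β Ω u (ordinaryPartial (potential₁ β Ω) u P.fst)
      (ordinaryPartial (potential₂ β Ω) u P.snd) v h₁ h₂ = inner ℂ (gradLp hv₁ hv₂) P := by
  rw [inner_gradLp_left, magneticForm]
  refine integral_congr_ae (Filter.Eventually.of_forall fun z => ?_)
  have e₁ := congrFun (covariantPartial_ordinaryPartial (potential₁ β Ω) u P.fst) z
  have e₂ := congrFun (covariantPartial_ordinaryPartial (potential₂ β Ω) u P.snd) z
  simp only [covariantPartial] at e₁ e₂
  simp only [e₁, e₂, covariantPartial]

/-- The Neumann spectrum exists: the embedding of the magnetic Sobolev space into `L²` is compact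
and has dense range. -/
theorem IsStarShapedAboutBall.exists_isNeumannSpectrum (hΩ : IsStarShapedAboutBall Ω δ) (β : ℝ) :
    ∃ μ : ℕ → ℝ, IsNeumannSpectrum β Ω μ := by
  have hb := hΩ.isBounded
  have hm := hΩ.measurableSet
  have c₁ := continuous_potential₁ β Ω
  have c₂ := continuous_potential₂ β Ω
  obtain ⟨μ, b, p, hμ, hp, hinner⟩ := exists_hilbertBasis_of_graph
    hΩ.not_finiteDimensional (magneticSpace β Ω) (magneticEmbedding β Ω) (fun _ => rfl)
    (isCompactOperator_magneticEmbedding β hΩ) (denseRange_magneticEmbedding β hΩ)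
  refine ⟨μ, hμ, b, fun j => ?_⟩
  refine ⟨_, _, (mem_magneticSpace_iff hb hm _).1 (hp j), fun v h₁ h₂ hv => ?_⟩
  have m₁ := memLp_covariantPartial hb hm c₁ hv.memLp hv.memLp_fst
  have m₂ := memLp_covariantPartial hb hm c₂ hv.memLp hv.memLp_snd
  refine (magneticForm_ordinaryPartial (b j) (p j) m₁ m₂).trans ?_
  rw [← inner_toLp_left hv.memLp]
  exact hinner j _ (toLp_mem_magneticSpace hb hm hv m₁ m₂)

/-- A square integrable `u` with `(i∇ + F) u = 0` vanishes, because `F = c (-x₂, x₁)` has the nonzero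
curl `2 c`, whereas the mixed second derivatives of a test function commute. -/
theorem eq_zero_of_covariantPartial_eq_zero (hΩ : IsStarShapedAboutBall Ω δ) {c : ℝ} (hc : c ≠ 0)
    {a₁ a₂ : ℂ → ℝ} (ha₁ : ∀ z, a₁ z = c * -z.im) (ha₂ : ∀ z, a₂ z = c * z.re)
    (u : SquareIntegrable Ω) {g₁ g₂ : ℂ → ℂ} (h : IsH1WithGrad Ω u g₁ g₂)
    (h₁ : covariantPartial a₁ u g₁ =ᵐ[volume.restrict Ω] 0)
    (h₂ : covariantPartial a₂ u g₂ =ᵐ[volume.restrict Ω] 0) : u = 0 := by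
  have hda₁ : ContDiff ℝ ∞ a₁ := by
    rw [funext ha₁]; exact contDiff_const.mul (Complex.imCLM.contDiff.neg)
  have hda₂ : ContDiff ℝ ∞ a₂ := by
    rw [funext ha₂]; exact contDiff_const.mul Complex.reCLM.contDiff
  have key : ∀ {a : ℂ → ℝ} {g : ℂ → ℂ} {e : ℂ}, HasWeakPartial Ω e u g →
      covariantPartial a u g =ᵐ[volume.restrict Ω] 0 →
      ∀ φ : ℂ → ℝ, ContDiff ℝ ∞ φ → HasCompactSupport φ → tsupport φ ⊆ Ω →
        ∫ z in Ω, ((fderiv ℝ φ z e : ℝ) : ℂ) * u z =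
          -Complex.I * ∫ z in Ω, ((φ z * a z : ℝ) : ℂ) * u z := by
    intro a g e hw hz φ d1 d2 d3
    rw [hw φ d1 d2 d3, neg_mul, ← integral_const_mul]
    congr 1
    refine integral_congr_ae ?_
    filter_upwards [hz] with z hz
    simp only [covariantPartial, Pi.zero_apply] at hz
    push_cast
    linear_combination (-Complex.I * φ z) * hz + φ z * g z * Complex.I_mul_I
  refine hΩ.eq_zero_of_integral_eq_zero u fun φ d1 d2 d3 => ?_
  have dd : ∀ e, ContDiff ℝ ∞ fun z => fderiv ℝ φ z e := fun e =>
    (d1.fderiv_right (m := ∞) (by simp)).clm_apply contDiff_const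
  have dc : ∀ e, HasCompactSupport fun z => fderiv ℝ φ z e := fun e => d2.fderiv_apply ℝ e
  have ds : ∀ e, tsupport (fun z => fderiv ℝ φ z e) ⊆ Ω := fun e =>
    (tsupport_fderiv_apply_subset ℝ e).trans d3
  have hsymm : ∀ z, fderiv ℝ (fun z => fderiv ℝ φ z Complex.I) z 1 =
      fderiv ℝ (fun z => fderiv ℝ φ z 1) z Complex.I := by
    intro z
    have hs := (d1.contDiffAt (x := z)).isSymmSndFDerivAt
      (by
      rw [minSmoothness_of_isRCLikeNormedField]; exact WithTop.coe_le_coe.2 (le_top (α := ℕ∞)))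
    have hd : DifferentiableAt ℝ (fderiv ℝ φ) z :=
      (d1.fderiv_right (m := ∞) (by simp)).differentiable (by simp) z
    rw [fderiv_clm_apply hd (differentiableAt_const _),
      fderiv_clm_apply hd (differentiableAt_const _)]
    simpa using hs 1 Complex.I
  -- Testing with `∂₂φ`, `∂₁φ` and with `φ a₁`, `φ a₂` amounts to computing the commutator of
  -- the two components of `i∇ + F` in the weak sense.
  have e1 := key h.weak_fst h₁ (fun z => fderiv ℝ φ z Complex.I) (dd _) (dc _) (ds _)
  have e2 := key h.weak_snd h₂ (fun z => fderiv ℝ φ z 1) (dd _) (dc _) (ds _)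
  have e3 := key h.weak_snd h₂ (fun z => φ z * a₁ z) (d1.mul hda₁) d2.mul_right
    ((tsupport_mul_subset_left).trans d3)
  have e4 := key h.weak_fst h₁ (fun z => φ z * a₂ z) (d1.mul hda₂) d2.mul_right
    ((tsupport_mul_subset_left).trans d3)
  have f3 : ∀ z, fderiv ℝ (fun z => φ z * a₁ z) z Complex.I =
      fderiv ℝ φ z Complex.I * a₁ z - φ z * c := by
    intro z
    have hL : HasFDerivAt a₁ (c • -Complex.imCLM) z := by
      rw [funext ha₁]
      exact (Complex.imCLM.hasFDerivAt.neg).const_mul c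
    rw [show (fun z => φ z * a₁ z) = φ * a₁ from rfl,
      ((d1.differentiable (by simp) z).hasFDerivAt.mul hL).fderiv]
    simp
    ring
  have f4 : ∀ z, fderiv ℝ (fun z => φ z * a₂ z) z 1 =
      fderiv ℝ φ z 1 * a₂ z + φ z * c := by
    intro z
    have hL : HasFDerivAt a₂ (c • Complex.reCLM) z := by
      rw [funext ha₂]
      exact (Complex.reCLM.hasFDerivAt).const_mul c
    rw [show (fun z => φ z * a₂ z) = φ * a₂ from rfl,
      ((d1.differentiable (by simp) z).hasFDerivAt.mul hL).fderiv]
    simp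
    ring
  have hI : ∀ {ψ : ℂ → ℝ}, Continuous ψ → HasCompactSupport ψ →
      Integrable (fun z => (ψ z : ℂ) * u z) (volume.restrict Ω) := fun h1 h2 =>
    (memLp_ofReal_of_hasCompactSupport h1 h2 Ω).integrable_mul (Lp.memLp u)
  have i0 := hI d1.continuous d2
  have i1 : Integrable (fun z => ((fderiv ℝ φ z Complex.I * a₁ z : ℝ) : ℂ) * u z)
      (volume.restrict Ω) := hI ((dd Complex.I).continuous.mul hda₁.continuous) (dc Complex.I).mul_right
  have i2 : Integrable (fun z => ((fderiv ℝ φ z 1 * a₂ z : ℝ) : ℂ) * u z)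
      (volume.restrict Ω) := hI ((dd 1).continuous.mul hda₂.continuous) (dc 1).mul_right
  have g3 : ∫ z in Ω, ((fderiv ℝ (fun z => φ z * a₁ z) z Complex.I : ℝ) : ℂ) * u z =
      (∫ z in Ω, ((fderiv ℝ φ z Complex.I * a₁ z : ℝ) : ℂ) * u z) -
        c * ∫ z in Ω, (φ z : ℂ) * u z := by
    rw [← integral_const_mul, ← integral_sub i1 (i0.const_mul _)]
    refine integral_congr_ae (Filter.Eventually.of_forall fun z => ?_)
    simp only [f3]
    push_cast
    ring
  have g4 : ∫ z in Ω, ((fderiv ℝ (fun z => φ z * a₂ z) z 1 : ℝ) : ℂ) * u z =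
      (∫ z in Ω, ((fderiv ℝ φ z 1 * a₂ z : ℝ) : ℂ) * u z) +
        c * ∫ z in Ω, (φ z : ℂ) * u z := by
    rw [← integral_const_mul, ← integral_add i2 (i0.const_mul _)]
    refine integral_congr_ae (Filter.Eventually.of_forall fun z => ?_)
    simp only [f4]
    push_cast
    ring
  simp only [hsymm] at e1
  have e5 : ∫ z in Ω, ((φ z * a₂ z * a₁ z : ℝ) : ℂ) * u z =
      ∫ z in Ω, ((φ z * a₁ z * a₂ z : ℝ) : ℂ) * u z := by
    congr 1
    funext z
    push_cast
    ring
  rw [g3] at e3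
  rw [g4, e5] at e4
  have e6 := e1.symm.trans e2
  have hc' : (2 * c : ℂ) ≠ 0 := by exact_mod_cast mul_ne_zero two_ne_zero hc
  refine (mul_eq_zero.1 (?_ : (2 * c : ℂ) * ∫ z in Ω, (φ z : ℂ) * u z = 0)).resolve_left hc'
  have e7 := mul_left_cancel₀ (neg_ne_zero.2 Complex.I_ne_zero) e6
  linear_combination e4 - e3 + e7

theorem IsStarShapedAboutBall.area_pos (hΩ : IsStarShapedAboutBall Ω δ) : 0 < area Ω :=
  ENNReal.toReal_pos (hΩ.isOpen.measure_pos volume ⟨0, hΩ.zero_mem⟩).ne' hΩ.volume_lt_top.ne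

theorem eigenvalue_eq_norm_gradLp_sq {u : SquareIntegrable Ω} (hu : ‖u‖ = 1) {g₁ g₂ : ℂ → ℂ}
    (m₁ : MemLp (covariantPartial (potential₁ β Ω) u g₁) 2 (volume.restrict Ω))
    (m₂ : MemLp (covariantPartial (potential₂ β Ω) u g₂) 2 (volume.restrict Ω)) {μ : ℝ}
    (h : magneticForm β Ω u g₁ g₂ u g₁ g₂ = μ * ∫ z in Ω, u z * conj (u z)) :
    μ = ‖gradLp m₁ m₂‖ ^ 2 := by
  have h1 : ∫ z in Ω, u z * conj (u z) = 1 := by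
    rw [← inner_toLp_left (Lp.memLp u), Lp.toLp_coeFn, inner_self_eq_norm_sq_to_K, hu]
    simp
  rw [magneticForm_eq_inner m₁ m₂ m₁ m₂, h1, mul_one, inner_self_eq_norm_sq_to_K] at h
  have h' : ((‖gradLp m₁ m₂‖ ^ 2 : ℝ) : ℂ) = (μ : ℂ) := by push_cast; exact h
  exact (by exact_mod_cast h'.symm)

/-- Diamagnetism: with a nonzero flux, all Neumann eigenvalues are positive. -/
theorem IsStarShapedAboutBall.neumannSpectrum_pos (hΩ : IsStarShapedAboutBall Ω δ) (hβ : β ≠ 0)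
    {μ : ℕ → ℝ} (hμ : IsNeumannSpectrum β Ω μ) (j : ℕ) : 0 < μ j := by
  obtain ⟨-, u, hu⟩ := hμ
  obtain ⟨g₁, g₂, hH, hform⟩ := hu j
  have hb := hΩ.isBounded
  have hm := hΩ.measurableSet
  have m₁ := memLp_covariantPartial hb hm (continuous_potential₁ β Ω) hH.memLp hH.memLp_fst
  have m₂ := memLp_covariantPartial hb hm (continuous_potential₂ β Ω) hH.memLp hH.memLp_snd
  have hnorm : ‖u j‖ = 1 := u.orthonormal.1 j
  rw [eigenvalue_eq_norm_gradLp_sq hnorm m₁ m₂ (hform _ _ _ hH)]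
  refine pow_pos (norm_pos_iff.2 fun h0 => ?_) 2
  have p₁ : m₁.toLp _ = 0 := congrArg WithLp.fst h0
  have p₂ : m₂.toLp _ = 0 := congrArg WithLp.snd h0
  have hu0 := eq_zero_of_covariantPartial_eq_zero hΩ (c := β / (2 * area Ω))
    (div_ne_zero hβ (mul_ne_zero two_ne_zero hΩ.area_pos.ne')) (a₁ := potential₁ β Ω)
    (a₂ := potential₂ β Ω) (fun z => rfl) (fun z => rfl) (u j) hH
    ((MemLp.toLp_eq_toLp_iff m₁ MemLp.zero).1 p₁) ((MemLp.toLp_eq_toLp_iff m₂ MemLp.zero).1 p₂)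
  rw [hu0, norm_zero] at hnorm
  exact zero_ne_one hnorm

end Spectrum

/-! ### Starlike domains -/

section Starlike

theorem Function.Periodic.comp_arg {E : Type*} {h : ℝ → E} (hh : Function.Periodic h (2 * π))
    {r : ℝ} (hr : 0 < r) (θ : ℝ) : h (Complex.arg (r * Complex.exp (θ * Complex.I))) = h θ := by
  rw [Complex.arg_real_mul _ hr, Complex.arg_exp_mul_I, toIocMod, hh.sub_zsmul_eq]

theorem norm_sub_le_of_periodic {E : Type*} [NormedAddCommGroup E] {h : ℝ → E} {L : NNReal}
    (hh : Function.Periodic h (2 * π))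
    (hL : LipschitzWith L h) (x y : ℝ) :
    ‖h x - h y‖ ≤ L * (π / 2 * ‖Complex.exp (x * Complex.I) - Complex.exp (y * Complex.I)‖) := by
  have h1 := Complex.angle_le_mul_norm_sub (Complex.norm_exp_ofReal_mul_I x)
    (Complex.norm_exp_ofReal_mul_I y)
  rw [Complex.angle_exp_exp, toIocMod] at h1
  have h2 := hL.dist_le_mul (x - toIocDiv Real.two_pi_pos (-π) (x - y) • (2 * π)) y
  rw [hh.sub_zsmul_eq, dist_eq_norm, Real.dist_eq] at h2
  refine h2.trans (mul_le_mul_of_nonneg_left ?_ L.2)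
  rwa [sub_right_comm]

/-- The extension of a function on the unit circle (in terms of the angle) to a positively
homogeneous function on the plane. -/
noncomputable def homogeneousExtension {E : Type*} [NormedAddCommGroup E] [NormedSpace ℝ E]
    (h : ℝ → E) (z : ℂ) : E :=
  ‖z‖ • h (Complex.arg z)

section HomogeneousExtension

variable {E : Type*} [NormedAddCommGroup E] [NormedSpace ℝ E] {h : ℝ → E}

theorem homogeneousExtension_polar (hh : Function.Periodic h (2 * π)) {r : ℝ} (hr : 0 ≤ r)
    (θ : ℝ) : homogeneousExtension h (r * Complex.exp (θ * Complex.I)) = r • h θ := by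
  rcases hr.eq_or_lt with rfl | hr
  · simp [homogeneousExtension]
  · rw [homogeneousExtension, hh.comp_arg hr, norm_mul, Complex.norm_exp_ofReal_mul_I, mul_one,
      Complex.norm_real, Real.norm_of_nonneg hr.le]

theorem homogeneousExtension_smul {t : ℝ} (ht : 0 ≤ t) (z : ℂ) :
    homogeneousExtension h (t • z) = t • homogeneousExtension h z := by
  rcases ht.eq_or_lt with rfl | ht
  · simp [homogeneousExtension]
  · rw [homogeneousExtension, homogeneousExtension, norm_smul, Real.norm_of_nonneg ht.le,
      Complex.real_smul, Complex.arg_real_mul _ ht, mul_smul]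

theorem exists_lipschitzWith_homogeneousExtension {L : NNReal}
    (hh : Function.Periodic h (2 * π)) (hL : LipschitzWith L h) :
    ∃ K, LipschitzWith K (homogeneousExtension h) := by
  have hB : ∀ z : ℂ, ‖h (Complex.arg z)‖ ≤ ‖h 0‖ + L * π := fun z => by
    have h1 := hL.dist_le_mul (Complex.arg z) 0
    rw [dist_eq_norm, Real.dist_eq, sub_zero] at h1
    have h2 : L * |Complex.arg z| ≤ L * π := mul_le_mul_of_nonneg_left (Complex.abs_arg_le_pi z) L.2
    linarith [norm_le_norm_add_norm_sub' (h (Complex.arg z)) (h 0)]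
  refine ⟨⟨‖h 0‖ + L * π + L * π, by positivity⟩, LipschitzWith.of_dist_le_mul fun z w => ?_⟩
  rw [dist_eq_norm, dist_eq_norm]
  change _ ≤ (‖h 0‖ + L * π + L * π) * ‖z - w‖
  have e : homogeneousExtension h z - homogeneousExtension h w =
      (‖z‖ - ‖w‖) • h (Complex.arg z) + ‖w‖ • (h (Complex.arg z) - h (Complex.arg w)) := by
    simp only [homogeneousExtension]
    module
  have h1 : ‖w‖ * ‖Complex.exp (Complex.arg z * Complex.I) -
      Complex.exp (Complex.arg w * Complex.I)‖ ≤ 2 * ‖z - w‖ := by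
    have e1 : (‖w‖ : ℂ) * (Complex.exp (Complex.arg z * Complex.I) -
        Complex.exp (Complex.arg w * Complex.I)) =
        ((‖w‖ - ‖z‖ : ℝ) : ℂ) * Complex.exp (Complex.arg z * Complex.I) + (z - w) := by
      have hz := Complex.norm_mul_exp_arg_mul_I z
      have hw := Complex.norm_mul_exp_arg_mul_I w
      push_cast
      linear_combination hz - hw
    have e2 := congrArg norm e1
    rw [norm_mul, Complex.norm_real, norm_norm] at e2
    rw [e2]
    refine (norm_add_le _ _).trans ?_
    rw [norm_mul, Complex.norm_exp_ofReal_mul_I, mul_one, Complex.norm_real, Real.norm_eq_abs]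
    have := abs_norm_sub_norm_le w z
    rw [norm_sub_rev w z] at this
    linarith
  rw [e]
  refine (norm_add_le _ _).trans ?_
  rw [norm_smul, norm_smul, norm_norm, Real.norm_eq_abs, add_mul]
  refine add_le_add ?_ ?_
  · rw [mul_comm]
    exact mul_le_mul (hB z) (abs_norm_sub_norm_le z w) (abs_nonneg _) (by positivity)
  · calc _ ≤ ‖w‖ * (L * (π / 2 * ‖Complex.exp (Complex.arg z * Complex.I) -
          Complex.exp (Complex.arg w * Complex.I)‖)) :=
          mul_le_mul_of_nonneg_left (norm_sub_le_of_periodic hh hL _ _) (norm_nonneg _)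
      _ = L * (π / 2) * (‖w‖ * ‖Complex.exp (Complex.arg z * Complex.I) -
          Complex.exp (Complex.arg w * Complex.I)‖) := by ring
      _ ≤ L * (π / 2) * (2 * ‖z - w‖) := mul_le_mul_of_nonneg_left h1 (by positivity)
      _ = _ := by ring

end HomogeneousExtension

variable {R : ℝ → ℝ}

theorem IsRadiusFunction.continuous (hR : IsRadiusFunction R) : Continuous R := by
  obtain ⟨K, hK⟩ := hR.lipschitz
  exact hK.continuous

theorem IsRadiusFunction.exists_bounds (hR : IsRadiusFunction R) :
    ∃ a b : ℝ, 0 < a ∧ ∀ θ, a ≤ R θ ∧ R θ ≤ b := by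
  have hne : (Icc 0 (0 + 2 * π)).Nonempty := nonempty_Icc.2 (by linarith [Real.pi_pos])
  obtain ⟨x, -, hx⟩ := isCompact_Icc.exists_isMinOn hne hR.continuous.continuousOn
  obtain ⟨y, -, hy⟩ := isCompact_Icc.exists_isMaxOn hne hR.continuous.continuousOn
  refine ⟨R x, R y, hR.pos x, fun θ => ?_⟩
  obtain ⟨t, ht, hRt⟩ := hR.periodic.exists_mem_Ico₀ Real.two_pi_pos θ
  have ht' : t ∈ Icc 0 (0 + 2 * π) := ⟨ht.1, by linarith [ht.2]⟩
  rw [hRt]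
  exact ⟨hx ht', hy ht'⟩

theorem isRadiusFunction_const {ρ : ℝ} (hρ : 0 < ρ) : IsRadiusFunction fun _ => ρ :=
  ⟨fun _ => hρ, fun _ => rfl, 0, LipschitzWith.const ρ⟩

theorem IsRadiusFunction.exists_lipschitzWith_inv (hR : IsRadiusFunction R) :
    ∃ L, LipschitzWith L fun θ => (R θ)⁻¹ := by
  obtain ⟨a, b, ha, hab⟩ := hR.exists_bounds
  obtain ⟨K, hK⟩ := hR.lipschitz
  refine ⟨⟨K * (a⁻¹) ^ 2, by positivity⟩, LipschitzWith.of_dist_le_mul fun x y => ?_⟩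
  have h1 := hK.dist_le_mul x y
  have hx : (R x)⁻¹ ≤ a⁻¹ := inv_anti₀ ha (hab x).1
  have hy : (R y)⁻¹ ≤ a⁻¹ := inv_anti₀ ha (hab y).1
  have hx0 := hR.pos x
  have hy0 := hR.pos y
  rw [Real.dist_eq] at h1 ⊢
  change _ ≤ K * (a⁻¹) ^ 2 * dist x y
  have e : (R x)⁻¹ - (R y)⁻¹ = (R x)⁻¹ * (R y)⁻¹ * -(R x - R y) := by
    field_simp
    ring
  rw [e, abs_mul, abs_neg, abs_of_pos (by positivity : 0 < (R x)⁻¹ * (R y)⁻¹)]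
  calc _ ≤ a⁻¹ * a⁻¹ * (K * dist x y) := by gcongr
    _ = _ := by ring

theorem mem_starlikeDomain_iff (hR : IsRadiusFunction R) (z : ℂ) :
    z ∈ starlikeDomain R ↔ ‖z‖ < R (Complex.arg z) := by
  constructor
  · rintro ⟨r, θ, hr0, hr, rfl⟩
    rcases hr0.eq_or_lt with rfl | hr0
    · simpa using hR.pos 0
    · rwa [hR.periodic.comp_arg hr0, norm_mul, Complex.norm_exp_ofReal_mul_I, mul_one,
        Complex.norm_real, Real.norm_of_nonneg hr0.le]
  · intro h
    exact ⟨‖z‖, Complex.arg z, norm_nonneg _, h, (Complex.norm_mul_exp_arg_mul_I z).symm⟩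

theorem mem_starlikeDomain_iff_gauge (hR : IsRadiusFunction R) (z : ℂ) :
    z ∈ starlikeDomain R ↔ homogeneousExtension (fun θ => (R θ)⁻¹) z < 1 := by
  rw [mem_starlikeDomain_iff hR, homogeneousExtension, smul_eq_mul, ← div_eq_mul_inv,
    div_lt_one (hR.pos _)]

/-- A domain which is starlike with a Lipschitz radius is star-shaped with respect to a whole ball,
because its gauge is Lipschitz. -/
theorem IsRadiusFunction.exists_isStarShapedAboutBall (hR : IsRadiusFunction R) :
    ∃ δ, IsStarShapedAboutBall (starlikeDomain R) δ := by
  obtain ⟨a, b, ha, hab⟩ := hR.exists_bounds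
  obtain ⟨L, hL⟩ := hR.exists_lipschitzWith_inv
  have hper : Function.Periodic (fun θ => (R θ)⁻¹) (2 * π) := fun θ => by
    simp only [hR.periodic θ]
  obtain ⟨K, hK⟩ := exists_lipschitzWith_homogeneousExtension hper hL
  set N := homogeneousExtension fun θ => (R θ)⁻¹ with hN
  have hmem : ∀ z, z ∈ starlikeDomain R ↔ N z < 1 := mem_starlikeDomain_iff_gauge hR
  refine ⟨1 / (K + 1), ?_, ?_, by positivity, ?_, ?_⟩
  · have : starlikeDomain R = N ⁻¹' Iio 1 := Set.ext hmem
    rw [this]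
    exact isOpen_Iio.preimage hK.continuous
  · refine isBounded_iff_forall_norm_le.2 ⟨b, fun z hz => ?_⟩
    exact ((mem_starlikeDomain_iff hR z).1 hz).le.trans (hab _).2
  · rw [hmem, hN]
    simp [homogeneousExtension]
  · intro z hz y hy t ht0 ht1
    rw [hmem] at hz ⊢
    have h1 := hK.dist_le_mul ((1 - t) • z + t • y) ((1 - t) • z)
    rw [hN, homogeneousExtension_smul (by linarith : 0 ≤ 1 - t), ← hN, dist_eq_norm,
      dist_eq_norm, add_sub_cancel_left, norm_smul, Real.norm_of_nonneg ht0, smul_eq_mul] at h1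
    have h2 := (le_abs_self _).trans h1
    have h3 : K * ‖y‖ ≤ K / (K + 1) := by
      rw [div_eq_mul_one_div]
      exact mul_le_mul_of_nonneg_left hy K.2
    have h4 : (K : ℝ) / (K + 1) < 1 := by
      rw [div_lt_one (by positivity)]
      linarith
    have h5 : K * (t * ‖y‖) = t * (K * ‖y‖) := by ring
    rw [h5] at h2
    rcases ht1.eq_or_lt with rfl | ht1
    · linarith
    · have h6 : (1 - t) * N z < (1 - t) * 1 := mul_lt_mul_of_pos_left hz (by linarith)
      have h7 : t * (K * ‖y‖) ≤ t * 1 := mul_le_mul_of_nonneg_left (by linarith) ht0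
      linarith

end Starlike

/-! ### Integration in polar coordinates -/

section Polar

variable {R : ℝ → ℝ} {ρ : ℝ}

theorem setLIntegral_Ioo_of_periodic {f : ℝ → ENNReal} (hf : Function.Periodic f (2 * π)) (a : ℝ) :
    ∫⁻ t in Ioo a (a + 2 * π), f t = ∫⁻ t in Ioo (-π) π, f t := by
  have h := (isAddFundamentalDomain_Ioc Real.two_pi_pos a volume).setLIntegral_eq
    (isAddFundamentalDomain_Ioc Real.two_pi_pos (-π) volume) f (by
      rintro ⟨g, hg⟩ x
      obtain ⟨k, rfl⟩ := AddSubgroup.mem_zmultiples_iff.1 hg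
      have := hf.zsmul k x
      rwa [add_comm] at this)
  rw [show -π + 2 * π = π by ring] at h
  rwa [setLIntegral_congr Ioo_ae_eq_Ioc, setLIntegral_congr Ioo_ae_eq_Ioc]

/-- Change of variables on the circle. -/
theorem setLIntegral_comp_circle {φ w : ℝ → ℝ} (hφ : ∀ θ, HasDerivAt φ (w θ) θ)
    (hw : ∀ θ, 0 < w θ) (hp : φ π = φ (-π) + 2 * π) {f : ℝ → ENNReal}
    (hf : Function.Periodic f (2 * π)) :
    ∫⁻ θ in Ioo (-π) π, ENNReal.ofReal (w θ) * f (φ θ) = ∫⁻ t in Ioo (-π) π, f t := by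
  have hmono : StrictMono φ := strictMono_of_deriv_pos fun θ => by
    rw [(hφ θ).deriv]
    exact hw θ
  have hcont : Continuous φ := continuous_iff_continuousAt.2 fun θ => (hφ θ).continuousAt
  have himage : φ '' Ioo (-π) π = Ioo (φ (-π)) (φ (-π) + 2 * π) := by
    rw [← hp]
    refine Subset.antisymm ?_
      (intermediate_value_Ioo (by linarith [Real.pi_pos]) hcont.continuousOn)
    rintro _ ⟨t, ht, rfl⟩
    exact ⟨hmono ht.1, hmono ht.2⟩
  rw [← setLIntegral_Ioo_of_periodic hf (φ (-π)), ← himage,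
    lintegral_image_eq_lintegral_abs_deriv_mul measurableSet_Ioo
      (fun θ _ => (hφ θ).hasDerivWithinAt) hmono.injective.injOn]
  simp only [abs_of_pos (hw _)]

theorem setLIntegral_add_right_of_periodic {f : ℝ → ENNReal} (hf : Function.Periodic f (2 * π))
    (a : ℝ) : ∫⁻ t in Ioo (-π) π, f (a + t) = ∫⁻ t in Ioo (-π) π, f t := by
  have h := setLIntegral_comp_circle (φ := fun t => a + t) (w := fun _ => 1)
    (fun θ => (hasDerivAt_id θ).const_add a) (fun _ => one_pos) (by ring) hf
  simpa using h

/-- Polar coordinates on a starlike domain, with the radius scaled to the interval `(0, ρ)`. -/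
theorem setLIntegral_starlikeDomain (hR : IsRadiusFunction R) (hρ : 0 < ρ)
    {K : ℝ → ℝ → ENNReal} (hK : Measurable (Function.uncurry K)) :
    ∫⁻ z in starlikeDomain R, K (ρ / R (Complex.arg z) * ‖z‖) (Complex.arg z) =
      ∫⁻ θ in Ioo (-π) π, ENNReal.ofReal (R θ ^ 2 / ρ ^ 2) *
        ∫⁻ s in Ioo 0 ρ, ENNReal.ofReal s * K s θ := by
  have hRm := hR.continuous.measurable
  obtain ⟨δ, hΩ⟩ := hR.exists_isStarShapedAboutBall
  set G : ℝ × ℝ → ENNReal := fun p =>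
    {p : ℝ × ℝ | p.1 < R p.2}.indicator (fun p => ENNReal.ofReal p.1 * K (ρ / R p.2 * p.1) p.2) p
  have hG : Measurable G := by
    refine Measurable.indicator ?_ (measurableSet_lt measurable_fst (hRm.comp measurable_snd))
    have : Measurable fun p : ℝ × ℝ => ((ρ / R p.2 * p.1, p.2) : ℝ × ℝ) := by fun_prop
    exact (ENNReal.measurable_ofReal.comp measurable_fst).mul (hK.comp this)
  rw [← lintegral_indicator hΩ.measurableSet, ← Complex.lintegral_comp_polarCoord_symm]
  have h1 : ∫⁻ p in polarCoord.target, ENNReal.ofReal p.1 •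
      (starlikeDomain R).indicator (fun z => K (ρ / R (Complex.arg z) * ‖z‖) (Complex.arg z))
        (Complex.polarCoord.symm p) = ∫⁻ p in polarCoord.target, G p := by
    refine setLIntegral_congr_fun polarCoord.open_target.measurableSet fun p hp => ?_
    have hp1 : 0 < p.1 := hp.1
    have e : Complex.polarCoord.symm p = p.1 * Complex.exp (p.2 * Complex.I) := by
      rw [Complex.polarCoord_symm_apply, Complex.exp_mul_I]
      push_cast
      rfl
    have e1 : ‖Complex.polarCoord.symm p‖ = p.1 := by
      rw [Complex.norm_polarCoord_symm, abs_of_pos hp1]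
    have e2 : Complex.arg (Complex.polarCoord.symm p) = p.2 := by
      rw [e, Complex.arg_real_mul _ hp1, Complex.arg_exp_mul_I]
      refine (toIocMod_eq_self _).2 ⟨hp.2.1, ?_⟩
      have := hp.2.2.le
      linarith
    have e3 : Complex.polarCoord.symm p ∈ starlikeDomain R ↔ p.1 < R p.2 := by
      rw [mem_starlikeDomain_iff hR, e1, e2]
    simp only [G]
    by_cases h : p.1 < R p.2
    · rw [indicator_of_mem (e3.2 h), indicator_of_mem (show p ∈ {p : ℝ × ℝ | p.1 < R p.2} from h),
        e1, e2, smul_eq_mul]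
    · rw [indicator_of_notMem (fun h' => h (e3.1 h')),
        indicator_of_notMem (show p ∉ {p : ℝ × ℝ | p.1 < R p.2} from h), smul_zero]
  rw [h1, show polarCoord.target = Ioi (0 : ℝ) ×ˢ Ioo (-π) π from rfl, Measure.volume_eq_prod,
    ← Measure.prod_restrict, lintegral_prod_symm' _ hG]
  refine lintegral_congr fun θ => ?_
  have hRθ := hR.pos θ
  have h2 : ∫⁻ r in Ioi 0, G (r, θ) =
      ∫⁻ r in Ioo 0 (R θ), ENNReal.ofReal r * K (ρ / R θ * r) θ := by
    have : (fun r => G (r, θ)) =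
        (Iio (R θ)).indicator fun r => ENNReal.ofReal r * K (ρ / R θ * r) θ := rfl
    rw [this, lintegral_indicator measurableSet_Iio, Measure.restrict_restrict measurableSet_Iio,
      Iio_inter_Ioi]
  have h3 : Ioo 0 (R θ) = (fun s => R θ / ρ * s) '' Ioo 0 ρ := by
    rw [image_mul_left_Ioo (by positivity : 0 < R θ / ρ), mul_zero, div_mul_cancel₀ _ hρ.ne']
  have hc : 0 < R θ / ρ := by positivity
  rw [h2, h3, lintegral_image_eq_lintegral_abs_deriv_mul (f' := fun _ => R θ / ρ)
    measurableSet_Ioo (fun s _ => by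
      simpa using ((hasDerivAt_id s).const_mul (R θ / ρ)).hasDerivWithinAt)
    (mul_right_injective₀ hc.ne').injOn, ← lintegral_const_mul']
  · refine lintegral_congr fun s => ?_
    have e1 : R θ ^ 2 / ρ ^ 2 = R θ / ρ * (R θ / ρ) := by ring
    have e2 : ρ / R θ * (R θ / ρ * s) = s := by field_simp
    rw [abs_of_pos hc, ENNReal.ofReal_mul hc.le, e2, e1, ENNReal.ofReal_mul hc.le]
    ring
  · exact ENNReal.ofReal_ne_top

/-- The point with polar coordinates `s` and `t`. -/
noncomputable def polarPoint (s t : ℝ) : ℂ := s * Complex.exp (t * Complex.I)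

theorem measurable_polarPoint : Measurable (Function.uncurry polarPoint) := by
  have : Continuous (Function.uncurry polarPoint) := by
    unfold polarPoint
    fun_prop
  exact this.measurable

theorem periodic_polarPoint (s : ℝ) : Function.Periodic (polarPoint s) (2 * π) := fun t => by
  have : ((t + 2 * π : ℝ) : ℂ) * Complex.I = t * Complex.I + 2 * π * Complex.I := by
    push_cast; ring
  rw [polarPoint, this, Complex.exp_periodic]
  rfl

theorem norm_polarPoint {s : ℝ} (hs : 0 ≤ s) (t : ℝ) : ‖polarPoint s t‖ = s := by
  rw [polarPoint, norm_mul, Complex.norm_exp_ofReal_mul_I, mul_one, Complex.norm_real,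
    Real.norm_of_nonneg hs]

theorem setLIntegral_disk (hρ : 0 < ρ) {P : ℂ → ENNReal} (hP : Measurable P) :
    ∫⁻ w in starlikeDomain fun _ => ρ, P w =
      ∫⁻ s in Ioo 0 ρ, ENNReal.ofReal s * ∫⁻ t in Ioo (-π) π, P (polarPoint s t) := by
  have hm : Measurable (Function.uncurry fun s t => P (polarPoint s t)) :=
    hP.comp measurable_polarPoint
  have h := setLIntegral_starlikeDomain (isRadiusFunction_const hρ) hρ
    (K := fun s t => P (polarPoint s t)) hm
  have e : ∀ z : ℂ, polarPoint (ρ / ρ * ‖z‖) (Complex.arg z) = z := fun z => by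
    rw [div_self hρ.ne', one_mul]
    exact Complex.norm_mul_exp_arg_mul_I z
  simp only [e] at h
  rw [h]
  simp only [div_self (pow_pos hρ 2).ne', ENNReal.ofReal_one, one_mul]
  rw [lintegral_lintegral_swap]
  · refine lintegral_congr fun s => ?_
    rw [lintegral_const_mul]
    exact hP.comp (measurable_polarPoint.comp measurable_prodMk_left)
  · refine Measurable.aemeasurable ?_
    exact (ENNReal.measurable_ofReal.comp measurable_snd).mul (hm.comp measurable_swap)

/-- The mean of `R²` over the circle. -/
noncomputable def meanSquare (R : ℝ → ℝ) : ℝ := 1 / (2 * π) * ∫ θ in (0 : ℝ)..(2 * π), R θ ^ 2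

/-- The angle, in the disk, of the image of the ray with angle `θ`: it grows at a rate proportional
to `R²`, so that sectors of equal area go to sectors of equal area. The rotation by `η` is left
free. -/
noncomputable def equalAreaAngle (R : ℝ → ℝ) (η θ : ℝ) : ℝ :=
  η + ∫ t in (0 : ℝ)..θ, R t ^ 2 / meanSquare R

theorem meanSquare_pos (hR : IsRadiusFunction R) : 0 < meanSquare R := by
  refine mul_pos (by positivity) ?_
  exact intervalIntegral.intervalIntegral_pos_of_pos_on
    ((hR.continuous.pow 2).intervalIntegrable _ _) (fun θ _ => pow_pos (hR.pos θ) 2)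
    Real.two_pi_pos

theorem hasDerivAt_equalAreaAngle (hR : IsRadiusFunction R) (η θ : ℝ) :
    HasDerivAt (equalAreaAngle R η) (R θ ^ 2 / meanSquare R) θ :=
  ((((hR.continuous.pow 2).div_const (meanSquare R)).integral_hasStrictDerivAt 0 θ).hasDerivAt).const_add
    η

theorem equalAreaAngle_add (hR : IsRadiusFunction R) (η θ : ℝ) :
    equalAreaAngle R η (θ + 2 * π) = equalAreaAngle R η θ + 2 * π := by
  have hm := meanSquare_pos hR
  have hc : Continuous fun t => R t ^ 2 / meanSquare R :=
    (hR.continuous.pow 2).div_const (meanSquare R)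
  have hp : Function.Periodic (fun t => R t ^ 2 / meanSquare R) (2 * π) := fun t => by
    simp only [hR.periodic t]
  have h1 := hp.intervalIntegral_add_eq θ 0
  rw [zero_add, intervalIntegral.integral_div (a := 0)] at h1
  have h2 : (∫ θ in (0 : ℝ)..(2 * π), R θ ^ 2) = 2 * π * meanSquare R := by
    rw [meanSquare]
    field_simp
  rw [h2, mul_div_cancel_right₀ _ hm.ne'] at h1
  rw [equalAreaAngle, equalAreaAngle, ← intervalIntegral.integral_add_adjacent_intervals
    (hc.intervalIntegrable 0 θ) (hc.intervalIntegrable θ (θ + 2 * π)), h1, add_assoc]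

theorem equalAreaAngle_eq (η θ : ℝ) : equalAreaAngle R η θ = η + equalAreaAngle R 0 θ := by
  simp [equalAreaAngle]

theorem continuous_equalAreaAngle (hR : IsRadiusFunction R) (η : ℝ) :
    Continuous (equalAreaAngle R η) :=
  continuous_iff_continuousAt.2 fun θ => (hasDerivAt_equalAreaAngle hR η θ).continuousAt

/-- The restriction to a ray, with values in the disk of radius `ρ`, of the homogeneous map of the
starlike domain onto the disk. -/
noncomputable def diskRay (R : ℝ → ℝ) (ρ η θ : ℝ) : ℂ := polarPoint (ρ / R θ) (equalAreaAngle R η θ)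

/-- The homogeneous map of a starlike domain onto the disk of radius `ρ` which multiplies all areas
by the same factor, followed by the rotation by `η`. -/
noncomputable def diskMap (R : ℝ → ℝ) (ρ η : ℝ) : ℂ → ℂ := homogeneousExtension (diskRay R ρ η)

theorem periodic_diskRay (hR : IsRadiusFunction R) (ρ η : ℝ) :
    Function.Periodic (diskRay R ρ η) (2 * π) := fun θ => by
  rw [diskRay, diskRay, hR.periodic, equalAreaAngle_add hR, periodic_polarPoint]

theorem diskMap_eq (z : ℂ) (η : ℝ) :
    diskMap R ρ η z = polarPoint (ρ / R (Complex.arg z) * ‖z‖)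
      (η + equalAreaAngle R 0 (Complex.arg z)) := by
  rw [diskMap, homogeneousExtension, diskRay, polarPoint, polarPoint, Complex.real_smul,
    ← equalAreaAngle_eq]
  push_cast
  ring

theorem measurable_polarPoint_equalAreaAngle (hR : IsRadiusFunction R) :
    Measurable fun p : ℝ × ℝ × ℝ => polarPoint p.2.1 (p.1 + equalAreaAngle R 0 p.2.2) := by
  have := (continuous_equalAreaAngle hR 0).measurable
  exact measurable_polarPoint.comp (measurable_snd.fst.prodMk
    (measurable_fst.add (this.comp measurable_snd.snd)))

/-- The map of a starlike domain onto the disk has constant Jacobian. -/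
theorem setLIntegral_comp_diskMap (hR : IsRadiusFunction R) (hρ : 0 < ρ) (η : ℝ)
    {P : ℂ → ENNReal} (hP : Measurable P) :
    ∫⁻ z in starlikeDomain R, P (diskMap R ρ η z) =
      ENNReal.ofReal (meanSquare R / ρ ^ 2) * ∫⁻ w in starlikeDomain fun _ => ρ, P w := by
  have hm := meanSquare_pos hR
  have hRm := hR.continuous.measurable
  have hK : Measurable (Function.uncurry fun s θ => P (polarPoint s (η + equalAreaAngle R 0 θ))) :=
    hP.comp ((measurable_polarPoint_equalAreaAngle hR).comp measurable_prodMk_left)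
  have hpol : ∀ s, Measurable fun t => P (polarPoint s t) := fun s =>
    hP.comp (measurable_polarPoint.comp measurable_prodMk_left)
  have h1 := setLIntegral_starlikeDomain hR hρ hK
  simp only [← diskMap_eq] at h1
  rw [h1, setLIntegral_disk hρ hP, ← lintegral_const_mul' _ _ ENNReal.ofReal_ne_top]
  have h2 : ∀ θ, ENNReal.ofReal (R θ ^ 2 / ρ ^ 2) * ∫⁻ s in Ioo 0 ρ, ENNReal.ofReal s *
      P (polarPoint s (η + equalAreaAngle R 0 θ)) = ∫⁻ s in Ioo 0 ρ, ENNReal.ofReal (R θ ^ 2 / ρ ^ 2)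
        * (ENNReal.ofReal s * P (polarPoint s (η + equalAreaAngle R 0 θ))) := fun θ => by
    rw [lintegral_const_mul' _ _ ENNReal.ofReal_ne_top]
  simp only [h2]
  rw [lintegral_lintegral_swap]
  · refine lintegral_congr fun s => ?_
    have h3 := setLIntegral_comp_circle (hasDerivAt_equalAreaAngle hR η)
      (fun θ => div_pos (pow_pos (hR.pos θ) 2) hm) (by
        have := equalAreaAngle_add hR η (-π)
        rwa [show -π + 2 * π = π by ring] at this)
      (f := fun t => P (polarPoint s t)) (fun t => by simp only [periodic_polarPoint s t])
    rw [← h3, ← mul_assoc, ← lintegral_const_mul']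
    · refine lintegral_congr fun θ => ?_
      rw [equalAreaAngle_eq η]
      have e : R θ ^ 2 / ρ ^ 2 = meanSquare R / ρ ^ 2 * (R θ ^ 2 / meanSquare R) := by
        field_simp
      rw [e, ENNReal.ofReal_mul (by positivity)]
      ring
    · exact ENNReal.mul_ne_top ENNReal.ofReal_ne_top ENNReal.ofReal_ne_top
  · refine Measurable.aemeasurable ?_
    refine Measurable.mul ?_ ?_
    · exact ENNReal.measurable_ofReal.comp (((hRm.comp measurable_fst).pow_const 2).div_const _)
    · exact (ENNReal.measurable_ofReal.comp measurable_snd).mul (hK.comp measurable_swap)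

/-- Averaging over all rotations separates the angle in the starlike domain from the point of the
disk. -/
theorem lintegral_lintegral_comp_diskMap (hR : IsRadiusFunction R) (hρ : 0 < ρ)
    {f : ℝ → ENNReal} (hf : Measurable f) {P : ℂ → ENNReal} (hP : Measurable P) :
    ∫⁻ η in Ioo (-π) π, ∫⁻ z in starlikeDomain R, f (Complex.arg z) * P (diskMap R ρ η z) =
      (∫⁻ θ in Ioo (-π) π, ENNReal.ofReal (R θ ^ 2 / ρ ^ 2) * f θ) *
        ∫⁻ w in starlikeDomain fun _ => ρ, P w := by
  have hRm := hR.continuous.measurable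
  set p : ℝ → ENNReal := fun s => ∫⁻ t in Ioo (-π) π, P (polarPoint s t)
  have hp : Measurable p := (hP.comp measurable_polarPoint).lintegral_prod_right'
  have hT : Measurable fun q : ℝ × ℂ => diskMap R ρ q.1 q.2 := by
    simp only [diskMap_eq]
    refine (measurable_polarPoint_equalAreaAngle hR).comp (measurable_fst.prodMk
      (Measurable.prodMk ?_ (Complex.measurable_arg.comp measurable_snd)))
    exact ((hRm.comp (Complex.measurable_arg.comp measurable_snd)).const_div ρ).mul
      measurable_snd.norm
  rw [lintegral_lintegral_swap]
  · have h1 : ∀ z, ∫⁻ η in Ioo (-π) π, f (Complex.arg z) * P (diskMap R ρ η z) =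
        f (Complex.arg z) * p (ρ / R (Complex.arg z) * ‖z‖) := fun z => by
      have hz : Measurable fun η => P (diskMap R ρ η z) :=
        hP.comp (hT.comp measurable_prodMk_right)
      rw [lintegral_const_mul _ hz]
      congr 1
      simp only [diskMap_eq, p]
      rw [← setLIntegral_add_right_of_periodic (f := fun t => P (polarPoint _ t))
        (fun t => by simp only [periodic_polarPoint _ t]) (equalAreaAngle R 0 (Complex.arg z))]
      simp only [add_comm]
    simp only [h1]
    rw [setLIntegral_starlikeDomain hR hρ (K := fun s θ => f θ * p s)
      ((hf.comp measurable_snd).mul (hp.comp measurable_fst)), setLIntegral_disk hρ hP,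
      ← lintegral_mul_const]
    · refine lintegral_congr fun θ => ?_
      rw [mul_assoc]
      congr 1
      change _ = f θ * ∫⁻ s in Ioo 0 ρ, ENNReal.ofReal s * p s
      have hsp : Measurable fun s => ENNReal.ofReal s * p s := ENNReal.measurable_ofReal.mul hp
      rw [← lintegral_const_mul _ hsp]
      refine lintegral_congr fun s => ?_
      ring
    · exact (ENNReal.measurable_ofReal.comp ((hRm.pow_const 2).div_const _)).mul hf
  · exact ((hf.comp (Complex.measurable_arg.comp measurable_snd)).mul (hP.comp hT)).aemeasurable

theorem lintegral_circle_sq (hR : IsRadiusFunction R) :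
    ∫⁻ θ in Ioo (-π) π, ENNReal.ofReal (R θ ^ 2) = ENNReal.ofReal (2 * π * meanSquare R) := by
  have hi : IntegrableOn (fun θ => R θ ^ 2) (Ioc 0 (2 * π)) :=
    (hR.continuous.pow 2).integrableOn_Icc.mono_set Ioc_subset_Icc_self
  rw [← setLIntegral_Ioo_of_periodic (fun θ => by simp only [hR.periodic θ]) 0, zero_add,
    setLIntegral_congr Ioo_ae_eq_Ioc, ← ofReal_integral_eq_lintegral_ofReal hi
      (Filter.Eventually.of_forall fun θ => sq_nonneg _),
    ← intervalIntegral.integral_of_le Real.two_pi_pos.le, meanSquare]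
  congr 1
  field_simp

theorem area_starlikeDomain (hR : IsRadiusFunction R) :
    area (starlikeDomain R) = π * meanSquare R := by
  have h := setLIntegral_starlikeDomain hR one_pos (K := fun _ _ => 1) measurable_const
  have hs : ∫⁻ s in Ioo (0 : ℝ) 1, ENNReal.ofReal s * 1 = ENNReal.ofReal (1 / 2) := by
    simp only [mul_one]
    have hi : IntegrableOn (fun s : ℝ => s) (Ioc 0 1) :=
      continuous_id.integrableOn_Icc.mono_set Ioc_subset_Icc_self
    rw [setLIntegral_congr Ioo_ae_eq_Ioc, ← ofReal_integral_eq_lintegral_ofReal hi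
      ((ae_restrict_mem measurableSet_Ioc).mono fun s hs => hs.1.le),
      ← intervalIntegral.integral_of_le zero_le_one, integral_id]
    norm_num
  simp only [hs, one_pow, div_one, setLIntegral_one] at h
  rw [lintegral_mul_const' _ _ ENNReal.ofReal_ne_top, lintegral_circle_sq hR,
    ← ENNReal.ofReal_mul (by have := meanSquare_pos hR; positivity)] at h
  rw [area, measureReal_def, h, ENNReal.toReal_ofReal (by have := meanSquare_pos hR; positivity)]
  ring

end Polar

/-! ### The equal area map onto the disk -/

section DiskMap

variable {R : ℝ → ℝ} {ρ : ℝ}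

theorem norm_polarPoint_sub_le (s s' t t' : ℝ) :
    ‖polarPoint s t - polarPoint s' t'‖ ≤ |s - s'| + |s'| * |t - t'| := by
  have h1 : ‖Complex.exp (t * Complex.I) - Complex.exp (t' * Complex.I)‖ ≤ |t - t'| := by
    have h := Real.norm_exp_I_mul_ofReal_sub_one_le (x := t - t')
    have e : Complex.exp (t * Complex.I) - Complex.exp (t' * Complex.I) =
        Complex.exp (t' * Complex.I) * (Complex.exp (Complex.I * (t - t' : ℝ)) - 1) := by
      rw [mul_sub, ← Complex.exp_add, mul_one]
      congr 2
      push_cast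
      ring
    rw [e, norm_mul, Complex.norm_exp_ofReal_mul_I, one_mul]
    exact h
  have e : polarPoint s t - polarPoint s' t' = ((s - s' : ℝ) : ℂ) * Complex.exp (t * Complex.I) +
      (s' : ℂ) * (Complex.exp (t * Complex.I) - Complex.exp (t' * Complex.I)) := by
    simp only [polarPoint]
    push_cast
    ring
  rw [e]
  refine (norm_add_le _ _).trans ?_
  rw [norm_mul, norm_mul, Complex.norm_exp_ofReal_mul_I, mul_one, Complex.norm_real,
    Complex.norm_real, Real.norm_eq_abs, Real.norm_eq_abs]
  gcongr

theorem exists_lipschitzWith_diskMap (hR : IsRadiusFunction R) (hρ : 0 < ρ) (η : ℝ) :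
    ∃ K, LipschitzWith K (diskMap R ρ η) := by
  obtain ⟨a, b, ha, hab⟩ := hR.exists_bounds
  obtain ⟨L, hL⟩ := hR.exists_lipschitzWith_inv
  have hm := meanSquare_pos hR
  have hb : 0 ≤ b := ha.le.trans ((hab 0).1.trans (hab 0).2)
  have hφ : LipschitzWith ⟨b ^ 2 / meanSquare R, by positivity⟩ (equalAreaAngle R η) := by
    refine lipschitzWith_of_nnnorm_deriv_le
      (fun θ => (hasDerivAt_equalAreaAngle hR η θ).differentiableAt) fun θ => ?_
    refine NNReal.coe_le_coe.1 ?_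
    change ‖deriv (equalAreaAngle R η) θ‖ ≤ b ^ 2 / meanSquare R
    rw [(hasDerivAt_equalAreaAngle hR η θ).deriv, Real.norm_of_nonneg (by positivity)]
    have := (hR.pos θ).le
    have := (hab θ).2
    gcongr
  refine exists_lipschitzWith_homogeneousExtension (periodic_diskRay hR ρ η)
    (L := ⟨ρ * L + ρ / a * (b ^ 2 / meanSquare R), by positivity⟩)
    (LipschitzWith.of_dist_le_mul fun x y => ?_)
  rw [dist_eq_norm]
  refine (norm_polarPoint_sub_le _ _ _ _).trans ?_
  have h1 := hL.dist_le_mul x y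
  have h2 := hφ.dist_le_mul x y
  rw [Real.dist_eq] at h1 h2
  change |equalAreaAngle R η x - equalAreaAngle R η y| ≤ b ^ 2 / meanSquare R * dist x y at h2
  change _ ≤ (ρ * L + ρ / a * (b ^ 2 / meanSquare R)) * dist x y
  rw [add_mul]
  refine add_le_add ?_ ?_
  · rw [div_eq_mul_inv, div_eq_mul_inv, ← mul_sub, abs_mul, abs_of_pos hρ, mul_assoc]
    exact mul_le_mul_of_nonneg_left h1 hρ.le
  · rw [mul_assoc, abs_of_pos (div_pos hρ (hR.pos y))]
    exact mul_le_mul (div_le_div_of_nonneg_left hρ.le ha (hab y).1) h2 (abs_nonneg _)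
      (by positivity)

theorem measurable_diskMap (hR : IsRadiusFunction R) (ρ : ℝ) :
    Measurable fun q : ℝ × ℂ => diskMap R ρ q.1 q.2 := by
  have hRm := hR.continuous.measurable
  simp only [diskMap_eq]
  refine (measurable_polarPoint_equalAreaAngle hR).comp (measurable_fst.prodMk
    (Measurable.prodMk ?_ (Complex.measurable_arg.comp measurable_snd)))
  exact ((hRm.comp (Complex.measurable_arg.comp measurable_snd)).const_div ρ).mul
    measurable_snd.norm

theorem map_diskMap (hR : IsRadiusFunction R) (hρ : 0 < ρ) (η : ℝ) :
    (volume.restrict (starlikeDomain R)).map (diskMap R ρ η) =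
      ENNReal.ofReal (meanSquare R / ρ ^ 2) • volume.restrict (starlikeDomain fun _ => ρ) := by
  have hT : Measurable (diskMap R ρ η) := (measurable_diskMap hR ρ).comp measurable_prodMk_left
  ext S hS
  have h := setLIntegral_comp_diskMap hR hρ η (P := S.indicator 1)
    (measurable_one.indicator hS)
  have e : (fun z => S.indicator (1 : ℂ → ENNReal) (diskMap R ρ η z)) =
      (diskMap R ρ η ⁻¹' S).indicator 1 := rfl
  rw [e, lintegral_indicator_one (hT hS), lintegral_indicator_one hS] at h
  rw [Measure.map_apply hT hS, h, Measure.smul_apply, smul_eq_mul]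

/-- Averaging over all rotations decouples the angle from its image in the disk. -/
theorem map_arg_diskMap (hR : IsRadiusFunction R) (hρ : 0 < ρ) :
    ((volume.restrict (Ioo (-π) π)).prod (volume.restrict (starlikeDomain R))).map
        (fun q : ℝ × ℂ => (Complex.arg q.2, diskMap R ρ q.1 q.2)) =
      ((volume.restrict (Ioo (-π) π)).withDensity fun θ => ENNReal.ofReal (R θ ^ 2 / ρ ^ 2)).prod
        (volume.restrict (starlikeDomain fun _ => ρ)) := by
  have hRm := hR.continuous.measurable
  have hw : Measurable fun θ => R θ ^ 2 / ρ ^ 2 := (hRm.pow_const 2).div_const _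
  have : SigmaFinite ((volume.restrict (Ioo (-π) π)).withDensity
      fun θ => ENNReal.ofReal (R θ ^ 2 / ρ ^ 2)) := SigmaFinite.withDensity_ofReal _
  have hT := measurable_diskMap hR ρ
  have hm : Measurable fun q : ℝ × ℂ => (Complex.arg q.2, diskMap R ρ q.1 q.2) :=
    (Complex.measurable_arg.comp measurable_snd).prodMk hT
  symm
  refine Measure.prod_eq fun s t hs ht => ?_
  have h := lintegral_lintegral_comp_diskMap hR hρ (f := s.indicator 1)
    (measurable_one.indicator hs) (P := t.indicator 1) (measurable_one.indicator ht)
  have e1 : ∫⁻ θ in Ioo (-π) π, ENNReal.ofReal (R θ ^ 2 / ρ ^ 2) * s.indicator 1 θ =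
      ((volume.restrict (Ioo (-π) π)).withDensity fun θ => ENNReal.ofReal (R θ ^ 2 / ρ ^ 2)) s := by
    rw [withDensity_apply _ hs, ← lintegral_indicator hs]
    refine lintegral_congr fun θ => ?_
    by_cases hθ : θ ∈ s <;> simp [hθ]
  rw [e1, lintegral_indicator_one ht] at h
  rw [← h, Measure.map_apply hm (hs.prod ht), ← lintegral_indicator_one (hm (hs.prod ht)),
    lintegral_prod _ ((measurable_one.indicator (hm (hs.prod ht))).aemeasurable)]
  refine lintegral_congr fun η => lintegral_congr fun z => ?_
  by_cases h1 : Complex.arg z ∈ s <;> by_cases h2 : diskMap R ρ η z ∈ t <;>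
    simp [indicator, h1, h2]

/-- At a point where the map onto the disk is differentiable, so is the radius function, and the
derivative in the radial and in the angular direction is explicit. -/
theorem fderiv_diskMap (hR : IsRadiusFunction R) (hρ : 0 < ρ) (η : ℝ) {z : ℂ} (hz : z ≠ 0)
    (hT : DifferentiableAt ℝ (diskMap R ρ η) z) :
    fderiv ℝ (diskMap R ρ η) z (Complex.exp (Complex.arg z * Complex.I)) =
        diskRay R ρ η (Complex.arg z) ∧
      fderiv ℝ (diskMap R ρ η) z (Complex.I * Complex.exp (Complex.arg z * Complex.I)) =
        ((-(deriv R (Complex.arg z) / R (Complex.arg z)) : ℝ) +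
          (R (Complex.arg z) ^ 2 / meanSquare R : ℝ) * Complex.I) *
            diskRay R ρ η (Complex.arg z) := by
  set θ := Complex.arg z
  set T := diskMap R ρ η
  set h := diskRay R ρ η
  have hper : Function.Periodic h (2 * π) := periodic_diskRay hR ρ η
  have hz0 : 0 < ‖z‖ := norm_pos_iff.2 hz
  have hzθ : (‖z‖ : ℂ) * Complex.exp (θ * Complex.I) = z := Complex.norm_mul_exp_arg_mul_I z
  have hT' : HasFDerivAt T (fderiv ℝ T z) ((‖z‖ : ℂ) * Complex.exp (θ * Complex.I)) := by
    rw [hzθ]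
    exact hT.hasFDerivAt
  constructor
  · have h1 : HasDerivAt (fun r : ℝ => (r : ℂ) * Complex.exp (θ * Complex.I))
        (Complex.exp (θ * Complex.I)) ‖z‖ := by
      simpa using (Complex.ofRealCLM.hasDerivAt (x := ‖z‖)).mul_const
        (Complex.exp (θ * Complex.I))
    have h2 := hT'.comp_hasDerivAt ‖z‖ h1
    have h3 : HasDerivAt (fun r : ℝ => r • h θ) (h θ) ‖z‖ := by
      simpa using (hasDerivAt_id ‖z‖).smul_const (h θ)
    refine (h2.congr_of_eventuallyEq ?_).unique h3
    filter_upwards [lt_mem_nhds hz0] with r hr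
    exact (homogeneousExtension_polar hper hr.le θ).symm
  · have h1 : HasDerivAt (fun t : ℝ => (‖z‖ : ℂ) * Complex.exp (t * Complex.I))
        ((‖z‖ : ℂ) * (Complex.exp (θ * Complex.I) * Complex.I)) θ := by
      have := ((Complex.ofRealCLM.hasDerivAt (x := θ)).mul_const Complex.I).cexp
      simpa using this.const_mul (‖z‖ : ℂ)
    have h2 := hT'.comp_hasDerivAt θ h1
    have h3 : T ∘ (fun t : ℝ => (‖z‖ : ℂ) * Complex.exp (t * Complex.I)) = fun t => ‖z‖ • h t :=
      funext fun t => homogeneousExtension_polar hper hz0.le t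
    rw [h3] at h2
    have h4 : HasDerivAt h (fderiv ℝ T z (Complex.I * Complex.exp (θ * Complex.I))) θ := by
      have h5 := h2.const_smul ‖z‖⁻¹
      have e1 : (fun t => ‖z‖⁻¹ • ‖z‖ • h t) = h := funext fun t => inv_smul_smul₀ hz0.ne' _
      have e2 : (‖z‖ : ℂ) * (Complex.exp (θ * Complex.I) * Complex.I) =
          ‖z‖ • (Complex.I * Complex.exp (θ * Complex.I)) := by
        rw [Complex.real_smul]
        ring
      rw [e2, map_smul, inv_smul_smul₀ hz0.ne'] at h5
      have h6 : HasDerivAt (fun t => ‖z‖⁻¹ • ‖z‖ • h t) _ θ := h5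
      rwa [e1] at h6
    -- The radius function is recovered from the norm of the image.
    have hnorm : ∀ t, ‖h t‖ = ρ / R t := fun t => norm_polarPoint (div_pos hρ (hR.pos t)).le _
    have hhθ : h θ ≠ 0 := norm_pos_iff.1 (by rw [hnorm]; exact div_pos hρ (hR.pos θ))
    have hRd : DifferentiableAt ℝ R θ := by
      have e : R = fun t => ρ / ‖h t‖ := funext fun t => by
        rw [hnorm]
        field_simp [(hR.pos t).ne']
      rw [e]
      exact (differentiableAt_const ρ).div (h4.differentiableAt.norm ℝ hhθ)
        (norm_ne_zero_iff.2 hhθ)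
    have hRθ := (hR.pos θ).ne'
    have h5 : HasDerivAt (fun t => ((ρ / R t : ℝ) : ℂ))
        ((-(ρ * deriv R θ) / R θ ^ 2 : ℝ) : ℂ) θ := by
      have := (hRd.hasDerivAt.fun_inv hRθ).const_mul ρ
      have h6 : HasDerivAt (fun t => ρ / R t) (-(ρ * deriv R θ) / R θ ^ 2) θ := by
        simp only [div_eq_mul_inv ρ]
        exact this.congr_deriv (by ring)
      exact h6.ofReal_comp
    have h6 : HasDerivAt (fun t => Complex.exp ((equalAreaAngle R η t : ℝ) * Complex.I))
        (Complex.exp ((equalAreaAngle R η θ : ℝ) * Complex.I) *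
          ((R θ ^ 2 / meanSquare R : ℝ) * Complex.I)) θ :=
      ((hasDerivAt_equalAreaAngle hR η θ).ofReal_comp.mul_const Complex.I).cexp
    have h7 : HasDerivAt h _ θ := h5.mul h6
    rw [h4.unique h7]
    simp only [h, diskRay, polarPoint]
    have hRθ' : (R θ : ℂ) ≠ 0 := by exact_mod_cast hRθ
    push_cast
    field_simp

/-- The radial component of a covector field. -/
noncomputable def radialComponent (p₁ p₂ : ℂ → ℂ) (w : ℂ) : ℂ :=
  Real.cos (Complex.arg w) * p₁ w + Real.sin (Complex.arg w) * p₂ w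

/-- The angular component of a covector field. -/
noncomputable def angularComponent (p₁ p₂ : ℂ → ℂ) (w : ℂ) : ℂ :=
  -Real.sin (Complex.arg w) * p₁ w + Real.cos (Complex.arg w) * p₂ w

theorem norm_sq_rotate (x y : ℝ) (h : x ^ 2 + y ^ 2 = 1) (p q : ℂ) :
    ‖(x : ℂ) * p + y * q‖ ^ 2 + ‖-(y : ℂ) * p + x * q‖ ^ 2 = ‖p‖ ^ 2 + ‖q‖ ^ 2 := by
  rw [← Complex.normSq_eq_norm_sq, ← Complex.normSq_eq_norm_sq, ← Complex.normSq_eq_norm_sq,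
    ← Complex.normSq_eq_norm_sq]
  simp only [Complex.normSq_apply, Complex.add_re, Complex.add_im, Complex.mul_re, Complex.mul_im,
    Complex.neg_re, Complex.neg_im, Complex.ofReal_re, Complex.ofReal_im]
  linear_combination (p.re ^ 2 + p.im ^ 2 + q.re ^ 2 + q.im ^ 2) * h

theorem norm_sq_radialComponent_add (p₁ p₂ : ℂ → ℂ) (w : ℂ) :
    ‖radialComponent p₁ p₂ w‖ ^ 2 + ‖angularComponent p₁ p₂ w‖ ^ 2 = ‖p₁ w‖ ^ 2 + ‖p₂ w‖ ^ 2 :=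
  norm_sq_rotate _ _ (Real.cos_sq_add_sin_sq _) _ _

theorem memLp_radialComponent {μ : Measure ℂ} {p₁ p₂ : ℂ → ℂ} (h₁ : MemLp p₁ 2 μ)
    (h₂ : MemLp p₂ 2 μ) : MemLp (radialComponent p₁ p₂) 2 μ := by
  have hc : Measurable fun w : ℂ => (Real.cos (Complex.arg w) : ℂ) := by fun_prop
  have hs : Measurable fun w : ℂ => (Real.sin (Complex.arg w) : ℂ) := by fun_prop
  refine MemLp.add (h₁.of_le (hc.aestronglyMeasurable.mul h₁.1) ?_)
    (h₂.of_le (hs.aestronglyMeasurable.mul h₂.1) ?_)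
  · refine Filter.Eventually.of_forall fun w => ?_
    rw [norm_mul, Complex.norm_real]
    exact mul_le_of_le_one_left (norm_nonneg _) (Real.abs_cos_le_one _)
  · refine Filter.Eventually.of_forall fun w => ?_
    rw [norm_mul, Complex.norm_real]
    exact mul_le_of_le_one_left (norm_nonneg _) (Real.abs_sin_le_one _)

theorem memLp_angularComponent {μ : Measure ℂ} {p₁ p₂ : ℂ → ℂ} (h₁ : MemLp p₁ 2 μ)
    (h₂ : MemLp p₂ 2 μ) : MemLp (angularComponent p₁ p₂) 2 μ := by
  have hc : Measurable fun w : ℂ => (Real.cos (Complex.arg w) : ℂ) := by fun_prop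
  have hs : Measurable fun w : ℂ => (-Real.sin (Complex.arg w) : ℂ) := by fun_prop
  refine MemLp.add (h₁.of_le (hs.aestronglyMeasurable.mul h₁.1) ?_)
    (h₂.of_le (hc.aestronglyMeasurable.mul h₂.1) ?_)
  · refine Filter.Eventually.of_forall fun w => ?_
    rw [norm_mul, norm_neg, Complex.norm_real]
    exact mul_le_of_le_one_left (norm_nonneg _) (Real.abs_sin_le_one _)
  · refine Filter.Eventually.of_forall fun w => ?_
    rw [norm_mul, Complex.norm_real]
    exact mul_le_of_le_one_left (norm_nonneg _) (Real.abs_cos_le_one _)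

end DiskMap

/-! ### The average energy of the transplanted functions -/

section Energy

variable {R : ℝ → ℝ} {ρ β η : ℝ}

theorem meanSquare_const (ρ : ℝ) : meanSquare (fun _ => ρ) = ρ ^ 2 := by
  rw [meanSquare, intervalIntegral.integral_const, smul_eq_mul, sub_zero]
  field_simp

theorem cos_arg_polarPoint {s : ℝ} (hs : 0 < s) (t : ℝ) :
    Real.cos (Complex.arg (polarPoint s t)) = Real.cos t :=
  Real.cos_periodic.comp_arg hs t

theorem sin_arg_polarPoint {s : ℝ} (hs : 0 < s) (t : ℝ) :
    Real.sin (Complex.arg (polarPoint s t)) = Real.sin t :=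
  Real.sin_periodic.comp_arg hs t

theorem polarPoint_eq (s t : ℝ) :
    polarPoint s t = ⟨s * Real.cos t, s * Real.sin t⟩ := by
  rw [polarPoint, Complex.exp_mul_I, ← Complex.ofReal_cos, ← Complex.ofReal_sin]
  apply Complex.ext <;> simp only [Complex.mul_re, Complex.mul_im, Complex.add_re, Complex.add_im,
    Complex.ofReal_re, Complex.ofReal_im, Complex.I_re, Complex.I_im] <;> ring

/-- The magnetic gradient of a function transplanted from the disk, in polar components. -/
theorem components_comp_diskMap (hR : IsRadiusFunction R) (hρ : 0 < ρ) {z : ℂ} (hz : z ≠ 0)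
    (hT : DifferentiableAt ℝ (diskMap R ρ η) z) (u g₁ g₂ : ℂ → ℂ) {q₁ q₂ p₁ p₂ : ℂ → ℂ}
    (hq₁ : q₁ = covariantPartial (potential₁ β (starlikeDomain R)) (u ∘ diskMap R ρ η)
      (pullGrad (diskMap R ρ η) 1 g₁ g₂))
    (hq₂ : q₂ = covariantPartial (potential₂ β (starlikeDomain R)) (u ∘ diskMap R ρ η)
      (pullGrad (diskMap R ρ η) Complex.I g₁ g₂))
    (hp₁ : p₁ = covariantPartial (potential₁ β (starlikeDomain fun _ => ρ)) u g₁)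
    (hp₂ : p₂ = covariantPartial (potential₂ β (starlikeDomain fun _ => ρ)) u g₂) :
    radialComponent q₁ q₂ z = (ρ / R (Complex.arg z) : ℝ) *
        radialComponent p₁ p₂ (diskMap R ρ η z) ∧
      angularComponent q₁ q₂ z = (ρ / R (Complex.arg z) : ℝ) *
        (-(deriv R (Complex.arg z) / R (Complex.arg z) : ℝ) *
            radialComponent p₁ p₂ (diskMap R ρ η z) +
          (R (Complex.arg z) ^ 2 / meanSquare R : ℝ) *
            angularComponent p₁ p₂ (diskMap R ρ η z)) := by
  subst hq₁ hq₂ hp₁ hp₂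
  obtain ⟨h1, h2⟩ := fderiv_diskMap hR hρ η hz hT
  have hm := meanSquare_pos hR
  have hRθ := hR.pos (Complex.arg z)
  have hz0 : 0 < ‖z‖ := norm_pos_iff.2 hz
  have hzp : z = polarPoint ‖z‖ (Complex.arg z) := (Complex.norm_mul_exp_arg_mul_I z).symm
  have hω : diskMap R ρ η z = polarPoint (ρ / R (Complex.arg z) * ‖z‖)
      (equalAreaAngle R η (Complex.arg z)) := by
    rw [diskMap_eq, ← equalAreaAngle_eq]
  have hσ : 0 < ρ / R (Complex.arg z) * ‖z‖ := by positivity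
  have a1 : area (starlikeDomain R) = π * meanSquare R := area_starlikeDomain hR
  have a2 : area (starlikeDomain fun _ => ρ) = π * ρ ^ 2 := by
    rw [area_starlikeDomain (isRadiusFunction_const hρ), meanSquare_const]
  have e1 : Complex.exp (Complex.arg z * Complex.I) = polarPoint 1 (Complex.arg z) := by
    simp [polarPoint]
  rw [clm_apply_eq_re_im] at h1 h2
  rw [e1, polarPoint_eq, diskRay, polarPoint_eq] at h1 h2
  simp only [Complex.mul_re, Complex.mul_im, Complex.I_re, Complex.I_im, one_mul, zero_mul,
    zero_sub, zero_add] at h1 h2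
  have hzre : z.re = ‖z‖ * Real.cos (Complex.arg z) := by
    conv_lhs => rw [hzp, polarPoint_eq]
  have hzim : z.im = ‖z‖ * Real.sin (Complex.arg z) := by
    conv_lhs => rw [hzp, polarPoint_eq]
  have hωre : (diskMap R ρ η z).re = ρ / R (Complex.arg z) * ‖z‖ *
      Real.cos (equalAreaAngle R η (Complex.arg z)) := by rw [hω, polarPoint_eq]
  have hωim : (diskMap R ρ η z).im = ρ / R (Complex.arg z) * ‖z‖ *
      Real.sin (equalAreaAngle R η (Complex.arg z)) := by rw [hω, polarPoint_eq]
  have hωcos : Real.cos (Complex.arg (diskMap R ρ η z)) =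
      Real.cos (equalAreaAngle R η (Complex.arg z)) := by rw [hω, cos_arg_polarPoint hσ]
  have hωsin : Real.sin (Complex.arg (diskMap R ρ η z)) =
      Real.sin (equalAreaAngle R η (Complex.arg z)) := by rw [hω, sin_arg_polarPoint hσ]
  have r1 := congrArg Complex.re h1
  have i1 := congrArg Complex.im h1
  have r2 := congrArg Complex.re h2
  have i2 := congrArg Complex.im h2
  simp only [Complex.add_re, Complex.add_im, Complex.mul_re, Complex.mul_im, Complex.ofReal_re,
    Complex.ofReal_im, Complex.I_re, Complex.I_im, zero_mul, sub_zero, mul_zero, add_zero,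
    mul_one, zero_add, sub_self] at r1 i1 r2 i2
  simp only [radialComponent, angularComponent, covariantPartial, pullGrad, Function.comp_apply,
    potential₁, potential₂, hωre, hωim, hωcos, hωsin, hzre, hzim, a1, a2]
  have hcs := Real.cos_sq_add_sin_sq (Complex.arg z)
  have hCS := Real.cos_sq_add_sin_sq (equalAreaAngle R η (Complex.arg z))
  set a := fderiv ℝ (diskMap R ρ η) z 1
  set b := fderiv ℝ (diskMap R ρ η) z Complex.I
  set w := diskMap R ρ η z
  set C := Real.cos (equalAreaAngle R η (Complex.arg z))
  set S := Real.sin (equalAreaAngle R η (Complex.arg z))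
  set c := Real.cos (Complex.arg z)
  set s := Real.sin (Complex.arg z)
  set κ := ρ / R (Complex.arg z)
  set k := deriv R (Complex.arg z) / R (Complex.arg z)
  set q := R (Complex.arg z) ^ 2 / meanSquare R
  set γ := β / (2 * (π * meanSquare R)) * ‖z‖
  set γ' := β / (2 * (π * ρ ^ 2)) * (κ * ‖z‖)
  -- The potentials of the two domains, each normalized by its area, correspond to each other.
  have hγ : γ = κ * q * γ' := by
    simp only [γ, γ', κ, q]
    field_simp
  have f1 : β / (2 * (π * meanSquare R)) * -(‖z‖ * s) = -(γ * s) := by ring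
  have f2 : β / (2 * (π * meanSquare R)) * (‖z‖ * c) = γ * c := by ring
  have f3 : β / (2 * (π * ρ ^ 2)) * -(κ * ‖z‖ * S) = -(γ' * S) := by ring
  have f4 : β / (2 * (π * ρ ^ 2)) * (κ * ‖z‖ * C) = γ' * C := by ring
  rw [f1, f2, f3, f4, hγ]
  have r1' := congrArg (fun x : ℝ => (x : ℂ)) r1
  have i1' := congrArg (fun x : ℝ => (x : ℂ)) i1
  have r2' := congrArg (fun x : ℝ => (x : ℂ)) r2
  have i2' := congrArg (fun x : ℝ => (x : ℂ)) i2
  have hcs' := congrArg (fun x : ℝ => (x : ℂ)) hcs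
  have hCS' := congrArg (fun x : ℝ => (x : ℂ)) hCS
  push_cast at r1' i1' r2' i2' hcs' hCS' ⊢
  constructor
  · linear_combination (Complex.I * g₁ w) * r1' + (Complex.I * g₂ w) * i1'
  · linear_combination (Complex.I * g₁ w) * r2' + (Complex.I * g₂ w) * i2' +
      κ * q * γ' * u w * (hcs' - hCS')

theorem norm_sq_neg_mul_add (k q : ℝ) (x y : ℂ) :
    ‖-(k : ℂ) * x + q * y‖ ^ 2 = k ^ 2 * ‖x‖ ^ 2 + q ^ 2 * ‖y‖ ^ 2 -
      2 * (k * q) * (x * conj y).re := by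
  rw [← Complex.normSq_eq_norm_sq, ← Complex.normSq_eq_norm_sq, ← Complex.normSq_eq_norm_sq]
  simp only [Complex.normSq_apply, Complex.add_re, Complex.add_im, Complex.mul_re, Complex.mul_im,
    Complex.neg_re, Complex.neg_im, Complex.ofReal_re, Complex.ofReal_im, Complex.conj_re,
    Complex.conj_im]
  ring

/-- A bounded measurable function of the angle is integrable. -/
theorem integrableOn_circle_of_bound {f : ℝ → ℝ} (hf : Measurable f) {C : ℝ}
    (hC : ∀ θ, |f θ| ≤ C) : IntegrableOn f (Ioo (-π) π) :=
  Measure.integrableOn_of_bounded (by simp) hf.aestronglyMeasurable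
    (Filter.Eventually.of_forall hC)

theorem setIntegral_circle_eq_of_periodic {f : ℝ → ℝ} (hf : Function.Periodic f (2 * π)) :
    ∫ θ in Ioo (-π) π, f θ = ∫ θ in (0 : ℝ)..(2 * π), f θ := by
  have h := hf.intervalIntegral_add_eq (-π) 0
  rw [show -π + 2 * π = π by ring, zero_add] at h
  rw [← h, intervalIntegral.integral_of_le (by linarith [Real.pi_pos]), integral_Ioc_eq_integral_Ioo]

theorem IsRadiusFunction.periodic_deriv (hR : IsRadiusFunction R) :
    Function.Periodic (deriv R) (2 * π) := fun θ => by
  rw [← deriv_comp_add_const]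
  congr 1
  exact funext hR.periodic

theorem IsRadiusFunction.exists_bound_deriv (hR : IsRadiusFunction R) :
    ∃ C, ∀ θ, |deriv R θ / R θ| ≤ C := by
  obtain ⟨K, hK⟩ := hR.lipschitz
  obtain ⟨a, b, ha, hab⟩ := hR.exists_bounds
  refine ⟨K / a, fun θ => ?_⟩
  rw [abs_div, abs_of_pos (hR.pos θ)]
  exact div_le_div₀ K.2 (norm_deriv_le_of_lipschitz hK) ha (hab θ).1

theorem IsRadiusFunction.measurable_logDeriv (hR : IsRadiusFunction R) :
    Measurable fun θ => deriv R θ / R θ :=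
  (measurable_deriv R).div hR.continuous.measurable

theorem setIntegral_geomG0 (hR : IsRadiusFunction R) :
    IntegrableOn (fun θ => 1 + (deriv R θ / R θ) ^ 2) (Ioo (-π) π) ∧
      ∫ θ in Ioo (-π) π, (1 + (deriv R θ / R θ) ^ 2) = 2 * π * geomG0 R := by
  obtain ⟨C, hC⟩ := hR.exists_bound_deriv
  obtain ⟨K, hK⟩ := hR.lipschitz
  have hi : IntegrableOn (fun θ => (deriv R θ / R θ) ^ 2) (Ioo (-π) π) :=
    integrableOn_circle_of_bound (hR.measurable_logDeriv.pow_const 2) (C := C ^ 2) fun θ => by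
      rw [abs_pow]
      exact pow_le_pow_left₀ (abs_nonneg _) (hC θ) 2
  have h1 : IntegrableOn (fun _ => (1 : ℝ)) (Ioo (-π) π) :=
    integrableOn_circle_of_bound measurable_const (C := 1) (by simp)
  refine ⟨h1.add hi, ?_⟩
  rw [integral_add h1 hi, setIntegral_circle_eq_of_periodic (f := fun θ => (deriv R θ / R θ) ^ 2)
    (fun θ => by simp only [hR.periodic_deriv θ, hR.periodic θ])]
  have e : ∫ θ in (0 : ℝ)..(2 * π), (deriv (fun t => Real.log (R t)) θ) ^ 2 =
      ∫ θ in (0 : ℝ)..(2 * π), (deriv R θ / R θ) ^ 2 := by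
    refine intervalIntegral.integral_congr_ae ?_
    filter_upwards [hK.ae_differentiableAt] with θ hθ _
    rw [(hθ.hasDerivAt.log (hR.pos θ).ne').deriv]
  rw [geomG0, e, setIntegral_const, smul_eq_mul, mul_one, measureReal_def, Real.volume_Ioo,
    ENNReal.toReal_ofReal (by linarith [Real.pi_pos])]
  field_simp
  ring

theorem setIntegral_geomG1 (hR : IsRadiusFunction R) :
    IntegrableOn (fun θ => (R θ ^ 2 / meanSquare R) ^ 2) (Ioo (-π) π) ∧
      ∫ θ in Ioo (-π) π, (R θ ^ 2 / meanSquare R) ^ 2 = 2 * π * geomG1 R := by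
  have hm := meanSquare_pos hR
  have hc : Continuous fun θ => (R θ ^ 2 / meanSquare R) ^ 2 :=
    ((hR.continuous.pow 2).div_const _).pow 2
  refine ⟨hc.integrableOn_Icc.mono_set Ioo_subset_Icc_self, ?_⟩
  rw [setIntegral_circle_eq_of_periodic (fun θ => by simp only [hR.periodic θ])]
  simp only [div_pow, ← pow_mul]
  rw [intervalIntegral.integral_div, geomG1]
  change _ = 2 * π * ((1 / (2 * π) * ∫ θ in (0 : ℝ)..(2 * π), R θ ^ 4) / meanSquare R ^ 2)
  field_simp

theorem setIntegral_cross (hR : IsRadiusFunction R) :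
    IntegrableOn (fun θ => 2 * (deriv R θ / R θ * (R θ ^ 2 / meanSquare R))) (Ioo (-π) π) ∧
      ∫ θ in Ioo (-π) π, 2 * (deriv R θ / R θ * (R θ ^ 2 / meanSquare R)) = 0 := by
  obtain ⟨K, hK⟩ := hR.lipschitz
  obtain ⟨a, b, ha, hab⟩ := hR.exists_bounds
  have hm := meanSquare_pos hR
  have e : ∀ θ, 2 * (deriv R θ / R θ * (R θ ^ 2 / meanSquare R)) =
      2 / meanSquare R * (R θ * deriv R θ) := fun θ => by
    have := hR.pos θ
    field_simp
  simp only [e]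
  have hi : IntegrableOn (fun θ => R θ * deriv R θ) (Ioo (-π) π) :=
    integrableOn_circle_of_bound (hR.continuous.measurable.mul (measurable_deriv R))
      (C := b * K) fun θ => by
        rw [abs_mul, abs_of_pos (hR.pos θ)]
        exact mul_le_mul (hab θ).2 (norm_deriv_le_of_lipschitz hK) (abs_nonneg _)
          ((hR.pos θ).le.trans (hab θ).2)
  refine ⟨hi.const_mul _, ?_⟩
  rw [integral_const_mul]
  have hac : AbsolutelyContinuousOnInterval R (-π) π :=
    hK.lipschitzOnWith.absolutelyContinuousOnInterval
  have h := hac.integral_mul_deriv_eq_deriv_mul hac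
  have hper : R π = R (-π) := by
    have := hR.periodic (-π)
    rwa [show -π + 2 * π = π by ring] at this
  rw [intervalIntegral.integral_of_le (by linarith [Real.pi_pos]),
    intervalIntegral.integral_of_le (by linarith [Real.pi_pos]), integral_Ioc_eq_integral_Ioo,
    integral_Ioc_eq_integral_Ioo, hper, sub_self, zero_sub] at h
  simp only [mul_comm (deriv R _)] at h
  have h0 : ∫ θ in Ioo (-π) π, R θ * deriv R θ = 0 := by linarith
  rw [h0, mul_zero]

theorem integral_withDensity_circle (hR : IsRadiusFunction R) (hρ : 0 < ρ) {f : ℝ → ℝ}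
    (hf : IntegrableOn f (Ioo (-π) π)) :
    Integrable (fun θ => (ρ / R θ) ^ 2 * f θ) ((volume.restrict (Ioo (-π) π)).withDensity
        fun θ => ENNReal.ofReal (R θ ^ 2 / ρ ^ 2)) ∧
      ∫ θ, (ρ / R θ) ^ 2 * f θ ∂((volume.restrict (Ioo (-π) π)).withDensity
        fun θ => ENNReal.ofReal (R θ ^ 2 / ρ ^ 2)) = ∫ θ in Ioo (-π) π, f θ := by
  have hw : Measurable fun θ => ENNReal.ofReal (R θ ^ 2 / ρ ^ 2) :=
    ENNReal.measurable_ofReal.comp ((hR.continuous.measurable.pow_const 2).div_const _)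
  have e : ∀ θ, (ENNReal.ofReal (R θ ^ 2 / ρ ^ 2)).toReal • ((ρ / R θ) ^ 2 * f θ) = f θ := by
    intro θ
    have := hR.pos θ
    rw [ENNReal.toReal_ofReal (by positivity), smul_eq_mul]
    field_simp
  have hlt : ∀ᵐ θ ∂(volume.restrict (Ioo (-π) π)), ENNReal.ofReal (R θ ^ 2 / ρ ^ 2) < ⊤ :=
    Filter.Eventually.of_forall fun _ => ENNReal.ofReal_lt_top
  rw [integrable_withDensity_iff_integrable_smul' hw hlt,
    integral_withDensity_eq_integral_toReal_smul hw hlt]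
  simp only [e]
  exact ⟨hf, trivial⟩

end Energy

section Average

variable {R : ℝ → ℝ} {ρ β η : ℝ}

/-- The mean over all rotations of the energy of a function transplanted from the disk. The radial
and angular parts of the energy acquire the factors `G₀` and `G₁`, and the mixed term drops out
because `∫ R R' = 0` over the circle. -/
theorem average_energy_le (hR : IsRadiusFunction R) (hρ : 0 < ρ) (β : ℝ) {u g₁ g₂ : ℂ → ℂ}
    (h : IsH1WithGrad (starlikeDomain fun _ => ρ) u g₁ g₂) {E : ℝ → ℝ}
    (hE : ∀ η, E η = ∫ z in starlikeDomain R,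
      (‖covariantPartial (potential₁ β (starlikeDomain R)) (u ∘ diskMap R ρ η)
          (pullGrad (diskMap R ρ η) 1 g₁ g₂) z‖ ^ 2 +
        ‖covariantPartial (potential₂ β (starlikeDomain R)) (u ∘ diskMap R ρ η)
          (pullGrad (diskMap R ρ η) Complex.I g₁ g₂) z‖ ^ 2)) :
    IntegrableOn E (Ioo (-π) π) ∧ ∫ η in Ioo (-π) π, E η ≤
      2 * π * geomG R * ∫ w in starlikeDomain fun _ => ρ,
        (‖covariantPartial (potential₁ β (starlikeDomain fun _ => ρ)) u g₁ w‖ ^ 2 +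
          ‖covariantPartial (potential₂ β (starlikeDomain fun _ => ρ)) u g₂ w‖ ^ 2) := by
  set Ω := starlikeDomain R
  set D := starlikeDomain fun _ => ρ with hD
  obtain ⟨δ, hDs⟩ := (isRadiusFunction_const hρ).exists_isStarShapedAboutBall
  set p₁ := covariantPartial (potential₁ β D) u g₁ with hp₁
  set p₂ := covariantPartial (potential₂ β D) u g₂ with hp₂
  have mp₁ : MemLp p₁ 2 (volume.restrict D) := memLp_covariantPartial hDs.isBounded
    hDs.measurableSet (continuous_potential₁ β D) h.memLp h.memLp_fst
  have mp₂ : MemLp p₂ 2 (volume.restrict D) := memLp_covariantPartial hDs.isBounded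
    hDs.measurableSet (continuous_potential₂ β D) h.memLp h.memLp_snd
  set Λ₁ := radialComponent p₁ p₂
  set Λ₂ := angularComponent p₁ p₂
  have m₁ : MemLp Λ₁ 2 (volume.restrict D) := memLp_radialComponent mp₁ mp₂
  have m₂ : MemLp Λ₂ 2 (volume.restrict D) := memLp_angularComponent mp₁ mp₂
  have iF₁ : Integrable (fun w => ‖Λ₁ w‖ ^ 2) (volume.restrict D) := m₁.norm.integrable_sq
  have iF₂ : Integrable (fun w => ‖Λ₂ w‖ ^ 2) (volume.restrict D) := m₂.norm.integrable_sq
  have iF₃ : Integrable (fun w => (Λ₁ w * conj (Λ₂ w)).re) (volume.restrict D) :=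
    (m₁.integrable_mul m₂.star).re
  obtain ⟨ig₁, eg₁⟩ := setIntegral_geomG0 hR
  obtain ⟨ig₂, eg₂⟩ := setIntegral_geomG1 hR
  obtain ⟨ig₃, eg₃⟩ := setIntegral_cross hR
  obtain ⟨if₁, ef₁⟩ := integral_withDensity_circle hR hρ ig₁
  obtain ⟨if₂, ef₂⟩ := integral_withDensity_circle hR hρ ig₂
  obtain ⟨if₃, ef₃⟩ := integral_withDensity_circle hR hρ ig₃
  rw [eg₁] at ef₁
  rw [eg₂] at ef₂
  rw [eg₃] at ef₃
  set W := (volume.restrict (Ioo (-π) π)).withDensity fun θ => ENNReal.ofReal (R θ ^ 2 / ρ ^ 2)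
    with hW
  have : SFinite W := by
    have : SigmaFinite W := SigmaFinite.withDensity_ofReal _
    infer_instance
  -- The angular coefficients of the radial, the angular and the mixed term of the energy.
  set f₁ : ℝ → ℝ := fun θ => (ρ / R θ) ^ 2 * (1 + (deriv R θ / R θ) ^ 2)
  set f₂ : ℝ → ℝ := fun θ => (ρ / R θ) ^ 2 * (R θ ^ 2 / meanSquare R) ^ 2
  set f₃ : ℝ → ℝ := fun θ => (ρ / R θ) ^ 2 * (2 * (deriv R θ / R θ * (R θ ^ 2 / meanSquare R)))
  have j₁ : Integrable (fun x : ℝ × ℂ => f₁ x.1 * ‖Λ₁ x.2‖ ^ 2) (W.prod (volume.restrict D)) :=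
    if₁.mul_prod iF₁
  have j₂ : Integrable (fun x : ℝ × ℂ => f₂ x.1 * ‖Λ₂ x.2‖ ^ 2) (W.prod (volume.restrict D)) :=
    if₂.mul_prod iF₂
  have j₃ : Integrable (fun x : ℝ × ℂ => f₃ x.1 * (Λ₁ x.2 * conj (Λ₂ x.2)).re)
      (W.prod (volume.restrict D)) := if₃.mul_prod iF₃
  set F : ℝ × ℂ → ℝ := fun x => f₁ x.1 * ‖Λ₁ x.2‖ ^ 2 + f₂ x.1 * ‖Λ₂ x.2‖ ^ 2 -
    f₃ x.1 * (Λ₁ x.2 * conj (Λ₂ x.2)).re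
  have hF : Integrable F (W.prod (volume.restrict D)) := (j₁.add j₂).sub j₃
  have hFint : ∫ x, F x ∂(W.prod (volume.restrict D)) =
      2 * π * geomG0 R * (∫ w in D, ‖Λ₁ w‖ ^ 2) + 2 * π * geomG1 R * ∫ w in D, ‖Λ₂ w‖ ^ 2 := by
    have e1 := integral_sub (j₁.add j₂) j₃
    have e2 := integral_add j₁ j₂
    have e3 := integral_prod_mul (μ := W) (ν := volume.restrict D) f₁ fun w => ‖Λ₁ w‖ ^ 2
    have e4 := integral_prod_mul (μ := W) (ν := volume.restrict D) f₂ fun w => ‖Λ₂ w‖ ^ 2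
    have e5 := integral_prod_mul (μ := W) (ν := volume.restrict D) f₃
      fun w => (Λ₁ w * conj (Λ₂ w)).re
    rw [ef₁] at e3
    rw [ef₂] at e4
    rw [ef₃, zero_mul] at e5
    rw [e5, sub_zero] at e1
    rw [e3, e4] at e2
    exact e1.trans e2
  -- Each of these products is the integral over all rotations and over the starlike domain.
  have hmap := map_arg_diskMap hR hρ
  have hΘ : Measurable fun q : ℝ × ℂ => (Complex.arg q.2, diskMap R ρ q.1 q.2) :=
    (Complex.measurable_arg.comp measurable_snd).prodMk (measurable_diskMap hR ρ)
  rw [← hW, ← hD] at hmap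
  have hF' : Integrable (fun q : ℝ × ℂ => F (Complex.arg q.2, diskMap R ρ q.1 q.2))
      ((volume.restrict (Ioo (-π) π)).prod (volume.restrict Ω)) := by
    rw [← hmap] at hF
    exact hF.comp_measurable hΘ
  have hEF : ∀ η, E η = ∫ z in Ω, F (Complex.arg z, diskMap R ρ η z) := by
    intro η
    rw [hE η]
    obtain ⟨K, hK⟩ := exists_lipschitzWith_diskMap hR hρ η
    have h1 := ae_restrict_of_ae (s := Ω) (hK.ae_differentiableAt (μ := volume))
    have h2 : ∀ᵐ z : ℂ ∂(volume.restrict Ω), z ≠ 0 :=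
      ae_restrict_of_ae (Measure.ae_ne volume 0)
    refine integral_congr_ae ?_
    filter_upwards [h1, h2] with z hz hz0
    obtain ⟨c1, c2⟩ := components_comp_diskMap (β := β) hR hρ hz0 hz u g₁ g₂ rfl rfl hp₁ hp₂
    rw [← norm_sq_radialComponent_add, c1, c2, norm_mul, norm_mul, mul_pow, mul_pow,
      norm_sq_neg_mul_add, Complex.norm_real, Real.norm_eq_abs, sq_abs]
    simp only [F, f₁, f₂, f₃]
    ring
  have hE' : E = fun η => ∫ z in Ω, F (Complex.arg z, diskMap R ρ η z) := funext hEF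
  refine ⟨hE' ▸ hF'.integral_prod_left, ?_⟩
  have e6 : ∫ η in Ioo (-π) π, E η = ∫ x, F x ∂(W.prod (volume.restrict D)) := by
    rw [hE', ← integral_prod _ hF', ← hmap, integral_map hΘ.aemeasurable]
    rw [hmap]
    exact hF.1
  rw [e6, hFint]
  have e7 : ∫ w in D, (‖p₁ w‖ ^ 2 + ‖p₂ w‖ ^ 2) =
      (∫ w in D, ‖Λ₁ w‖ ^ 2) + ∫ w in D, ‖Λ₂ w‖ ^ 2 := by
    rw [← integral_add iF₁ iF₂]
    exact integral_congr_ae (Filter.Eventually.of_forall fun w =>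
      (norm_sq_radialComponent_add p₁ p₂ w).symm)
  rw [e7, mul_add]
  have n1 : 0 ≤ ∫ w in D, ‖Λ₁ w‖ ^ 2 := integral_nonneg fun _ => sq_nonneg _
  have n2 : 0 ≤ ∫ w in D, ‖Λ₂ w‖ ^ 2 := integral_nonneg fun _ => sq_nonneg _
  have k1 : geomG0 R ≤ geomG R := le_max_left _ _
  have k2 : geomG1 R ≤ geomG R := le_max_right _ _
  gcongr

end Average

/-! ### The sum of the first eigenvalues -/

section Sum

variable {R : ℝ → ℝ} {ρ β δ : ℝ} {Ω : Set ℂ}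

theorem norm_gradLp_sq {p₁ p₂ : ℂ → ℂ} (h₁ : MemLp p₁ 2 (volume.restrict Ω))
    (h₂ : MemLp p₂ 2 (volume.restrict Ω)) :
    ‖gradLp h₁ h₂‖ ^ 2 = ∫ z in Ω, (‖p₁ z‖ ^ 2 + ‖p₂ z‖ ^ 2) := by
  have h := inner_gradLp h₁ h₂ h₁ h₂
  rw [inner_self_eq_norm_sq_to_K] at h
  have e : ∀ z, p₁ z * conj (p₁ z) + p₂ z * conj (p₂ z) =
      ((‖p₁ z‖ ^ 2 + ‖p₂ z‖ ^ 2 : ℝ) : ℂ) := fun z => by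
    rw [Complex.mul_conj, Complex.mul_conj, Complex.normSq_eq_norm_sq, Complex.normSq_eq_norm_sq]
    push_cast
    rfl
  simp only [e] at h
  rw [integral_complex_ofReal] at h
  exact Complex.ofReal_injective (by push_cast; exact h)

/-- The variational principle for sums of eigenvalues: trial functions which are orthogonal and
have equal norms. -/
theorem IsNeumannSpectrum.mul_sum_le_sum_energy (hb : Bornology.IsBounded Ω)
    (hm : MeasurableSet Ω) {μ : ℕ → ℝ} (hμ : IsNeumannSpectrum β Ω μ) {n : ℕ}
    {v h₁ h₂ : Fin n → ℂ → ℂ} (hv : ∀ j, IsH1WithGrad Ω (v j) (h₁ j) (h₂ j)) {M : ℝ} (hM : 0 < M)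
    (hvv : ∀ i j, ∫ z in Ω, v j z * conj (v i z) = if i = j then (M : ℂ) else 0) :
    M * ∑ k ∈ Finset.range n, μ k ≤ ∑ j, ∫ z in Ω,
      (‖covariantPartial (potential₁ β Ω) (v j) (h₁ j) z‖ ^ 2 +
        ‖covariantPartial (potential₂ β Ω) (v j) (h₂ j) z‖ ^ 2) := by
  obtain ⟨hmono, b, hbas⟩ := hμ
  choose g₁ g₂ hH hform using hbas
  have c₁ := continuous_potential₁ β Ω
  have c₂ := continuous_potential₂ β Ω
  have mp₁ := fun k => memLp_covariantPartial hb hm c₁ (hH k).memLp (hH k).memLp_fst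
  have mp₂ := fun k => memLp_covariantPartial hb hm c₂ (hH k).memLp (hH k).memLp_snd
  have mq₁ := fun j => memLp_covariantPartial hb hm c₁ (hv j).memLp (hv j).memLp_fst
  have mq₂ := fun j => memLp_covariantPartial hb hm c₂ (hv j).memLp (hv j).memLp_snd
  have weak : ∀ k {w l₁ l₂ : ℂ → ℂ} (hw : IsH1WithGrad Ω w l₁ l₂)
      (n₁ : MemLp (covariantPartial (potential₁ β Ω) w l₁) 2 (volume.restrict Ω))
      (n₂ : MemLp (covariantPartial (potential₂ β Ω) w l₂) 2 (volume.restrict Ω)),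
      inner ℂ (gradLp (mp₁ k) (mp₂ k)) (gradLp n₁ n₂) =
        (μ k : ℂ) * inner ℂ (b k) (hw.memLp.toLp w) := by
    intro k w l₁ l₂ hw n₁ n₂
    have h := hform k w l₁ l₂ hw
    rw [magneticForm_eq_inner (mp₁ k) (mp₂ k) n₁ n₂, ← inner_toLp_left hw.memLp] at h
    rw [← inner_conj_symm, h, map_mul, Complex.conj_ofReal, inner_conj_symm]
  set c : ℂ := (((Real.sqrt M)⁻¹ : ℝ) : ℂ)
  have hc : ((Real.sqrt M)⁻¹) ^ 2 = M⁻¹ := by rw [inv_pow, Real.sq_sqrt hM.le]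
  have horth : Orthonormal ℂ fun j => c • (hv j).memLp.toLp (v j) := by
    rw [orthonormal_iff_ite]
    intro i j
    rw [inner_smul_left, inner_smul_right, inner_toLp, hvv]
    split_ifs with hij
    · simp only [c, Complex.conj_ofReal]
      rw [← Complex.ofReal_mul, ← Complex.ofReal_mul, ← mul_assoc, ← sq, hc,
        inv_mul_cancel₀ hM.ne', Complex.ofReal_one]
    · simp
  have key := sum_eigenvalues_le b hmono (p := fun k => gradLp (mp₁ k) (mp₂ k)) (fun k l => by
      have := weak k (hH l) (mp₁ l) (mp₂ l)
      rwa [Lp.toLp_coeFn] at this) horth (q := fun j => c • gradLp (mq₁ j) (mq₂ j)) (fun k j => by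
      rw [inner_smul_right, inner_smul_right, weak k (hv j) (mq₁ j) (mq₂ j)]
      ring)
  have e : ∀ j, ‖c • gradLp (mq₁ j) (mq₂ j)‖ ^ 2 = M⁻¹ * ∫ z in Ω,
      (‖covariantPartial (potential₁ β Ω) (v j) (h₁ j) z‖ ^ 2 +
        ‖covariantPartial (potential₂ β Ω) (v j) (h₂ j) z‖ ^ 2) := fun j => by
    rw [norm_smul, mul_pow, norm_gradLp_sq, Complex.norm_real, Real.norm_eq_abs, sq_abs, hc]
  simp only [e] at key
  rw [← Finset.mul_sum, ← div_eq_inv_mul, le_div_iff₀ hM] at key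
  linarith

theorem geomG_pos (R : ℝ → ℝ) : 0 < geomG R := by
  have h : 1 ≤ geomG0 R := by
    have : 0 ≤ ∫ θ in (0 : ℝ)..(2 * π), (deriv (fun t => Real.log (R t)) θ) ^ 2 :=
      intervalIntegral.integral_nonneg Real.two_pi_pos.le fun _ _ => sq_nonneg _
    rw [geomG0]
    have := mul_nonneg (by positivity : 0 ≤ 1 / (2 * π)) this
    linarith
  exact (zero_lt_one.trans_le h).trans_le (le_max_left _ _)

theorem geomG_const (hρ : 0 < ρ) : geomG (fun _ => ρ) = 1 := by
  have h0 : geomG0 (fun _ => ρ) = 1 := by simp [geomG0]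
  have h1 : geomG1 (fun _ => ρ) = 1 := by
    rw [geomG1, intervalIntegral.integral_const, intervalIntegral.integral_const, smul_eq_mul,
      smul_eq_mul, sub_zero]
    field_simp
  rw [geomG, h0, h1, max_self]

theorem areaOverG_pos (hR : IsRadiusFunction R) : 0 < areaOverG R := by
  rw [areaOverG, area_starlikeDomain hR]
  exact div_pos (mul_pos Real.pi_pos (meanSquare_pos hR)) (geomG_pos R)

theorem eigenvalue_eq_energy {D : Set ℂ} (hb : Bornology.IsBounded D) (hm : MeasurableSet D)
    {u : SquareIntegrable D} (hu : ‖u‖ = 1) {g₁ g₂ : ℂ → ℂ} (hH : IsH1WithGrad D u g₁ g₂) {ν : ℝ}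
    (h : magneticForm β D u g₁ g₂ u g₁ g₂ = ν * ∫ z in D, u z * conj (u z)) :
    ν = ∫ w in D, (‖covariantPartial (potential₁ β D) u g₁ w‖ ^ 2 +
      ‖covariantPartial (potential₂ β D) u g₂ w‖ ^ 2) := by
  rw [← norm_gradLp_sq (memLp_covariantPartial hb hm (continuous_potential₁ β D) hH.memLp
    hH.memLp_fst) (memLp_covariantPartial hb hm (continuous_potential₂ β D) hH.memLp hH.memLp_snd)]
  exact eigenvalue_eq_norm_gradLp_sq hu _ _ h

theorem integral_comp_diskMap (hR : IsRadiusFunction R) (hρ : 0 < ρ) (η : ℝ)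
    (u v : SquareIntegrable (starlikeDomain fun _ => ρ)) :
    ∫ z in starlikeDomain R, u (diskMap R ρ η z) * conj (v (diskMap R ρ η z)) =
      ((meanSquare R / ρ ^ 2 : ℝ) : ℂ) * inner ℂ v u := by
  have hm := meanSquare_pos hR
  have hT : Measurable (diskMap R ρ η) := (measurable_diskMap hR ρ).comp measurable_prodMk_left
  have hmap := map_diskMap hR hρ η
  have haes : AEStronglyMeasurable (fun w => u w * conj (v w))
      ((volume.restrict (starlikeDomain R)).map (diskMap R ρ η)) := by
    rw [hmap]
    exact (((Lp.memLp u).1).mul (Lp.memLp v).star.1).smul_measure _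
  have h1 := integral_map hT.aemeasurable haes
  rw [hmap, integral_smul_measure, ENNReal.toReal_ofReal (by positivity),
    ← inner_toLp_left (Lp.memLp v), Lp.toLp_coeFn, Complex.real_smul] at h1
  exact h1.symm

/-- The variational principle for the functions transplanted from the disk with a fixed
rotation. -/
theorem IsNeumannSpectrum.mul_sum_le_sum_energy_comp_diskMap (hR : IsRadiusFunction R)
    (hρ : 0 < ρ) {μ : ℕ → ℝ} (hμ : IsNeumannSpectrum β (starlikeDomain R) μ)
    {b : ℕ → SquareIntegrable (starlikeDomain fun _ => ρ)} (hb : Orthonormal ℂ b)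
    {g₁ g₂ : ℕ → ℂ → ℂ}
    (hH : ∀ j, IsH1WithGrad (starlikeDomain fun _ => ρ) (b j) (g₁ j) (g₂ j)) (η : ℝ) (n : ℕ) :
    meanSquare R / ρ ^ 2 * ∑ k ∈ Finset.range n, μ k ≤
      ∑ j ∈ Finset.range n, ∫ z in starlikeDomain R,
        (‖covariantPartial (potential₁ β (starlikeDomain R)) (b j ∘ diskMap R ρ η)
            (pullGrad (diskMap R ρ η) 1 (g₁ j) (g₂ j)) z‖ ^ 2 +
          ‖covariantPartial (potential₂ β (starlikeDomain R)) (b j ∘ diskMap R ρ η)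
            (pullGrad (diskMap R ρ η) Complex.I (g₁ j) (g₂ j)) z‖ ^ 2) := by
  obtain ⟨δ, hΩ⟩ := hR.exists_isStarShapedAboutBall
  obtain ⟨δ', hD⟩ := (isRadiusFunction_const hρ).exists_isStarShapedAboutBall
  obtain ⟨K, hK⟩ := exists_lipschitzWith_diskMap hR hρ η
  have hMpos : 0 < meanSquare R / ρ ^ 2 := div_pos (meanSquare_pos hR) (pow_pos hρ 2)
  have hle : (volume.restrict (starlikeDomain R)).map (diskMap R ρ η) ≤
      (meanSquare R / ρ ^ 2).toNNReal • volume.restrict (starlikeDomain fun _ => ρ) :=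
    (map_diskMap hR hρ η).le
  rw [← Fin.sum_univ_eq_sum_range (fun j => ∫ z in starlikeDomain R,
        (‖covariantPartial (potential₁ β (starlikeDomain R)) (b j ∘ diskMap R ρ η)
            (pullGrad (diskMap R ρ η) 1 (g₁ j) (g₂ j)) z‖ ^ 2 +
          ‖covariantPartial (potential₂ β (starlikeDomain R)) (b j ∘ diskMap R ρ η)
            (pullGrad (diskMap R ρ η) Complex.I (g₁ j) (g₂ j)) z‖ ^ 2)) n]
  refine hμ.mul_sum_le_sum_energy hΩ.isBounded hΩ.measurableSet
    (v := fun j : Fin n => b j ∘ diskMap R ρ η)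
    (fun j => (hH j).comp_lipschitz hD hK hle) hMpos fun i j => ?_
  refine (integral_comp_diskMap hR hρ η (b j) (b i)).trans ?_
  rw [orthonormal_iff_ite.1 hb i j]
  by_cases hij : i = j
  · subst hij; simp
  · have hij' : (i : ℕ) ≠ j := fun h => hij (Fin.ext h)
    simp [hij, hij']

theorem mul_sum_neumannSpectrum_le (hR : IsRadiusFunction R) (hρ : 0 < ρ) {μ ν : ℕ → ℝ}
    (hμ : IsNeumannSpectrum β (starlikeDomain R) μ)
    {b : ℕ → SquareIntegrable (starlikeDomain fun _ => ρ)} (hb : Orthonormal ℂ b)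
    {g₁ g₂ : ℕ → ℂ → ℂ}
    (hH : ∀ j, IsH1WithGrad (starlikeDomain fun _ => ρ) (b j) (g₁ j) (g₂ j))
    (hform : ∀ j, magneticForm β (starlikeDomain fun _ => ρ) (b j) (g₁ j) (g₂ j) (b j) (g₁ j)
      (g₂ j) = ν j * ∫ z in starlikeDomain fun _ => ρ, b j z * conj (b j z)) (n : ℕ) :
    meanSquare R / ρ ^ 2 * ∑ k ∈ Finset.range n, μ k ≤
      geomG R * ∑ k ∈ Finset.range n, ν k := by
  obtain ⟨δ', hD⟩ := (isRadiusFunction_const hρ).exists_isStarShapedAboutBall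
  have havg := fun j => average_energy_le hR hρ β (hH j) fun η => rfl
  have hdisk := fun j => eigenvalue_eq_energy hD.isBounded hD.measurableSet (hb.1 j) (hH j)
    (hform j)
  simp only [← hdisk] at havg
  have h1 := integral_mono (integrableOn_circle_of_bound measurable_const (fun _ => le_rfl))
    (integrable_finsetSum (Finset.range n) fun j _ => (havg j).1)
    fun η => hμ.mul_sum_le_sum_energy_comp_diskMap hR hρ hb hH η n
  rw [setIntegral_const, smul_eq_mul, measureReal_def, Real.volume_Ioo,
    ENNReal.toReal_ofReal (by linarith [Real.pi_pos]), integral_finsetSum _ fun j _ => (havg j).1]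
    at h1
  have h2 := h1.trans (Finset.sum_le_sum fun j _ => (havg j).2)
  rw [← Finset.mul_sum] at h2
  have h3 : 2 * π * (meanSquare R / ρ ^ 2 * ∑ k ∈ Finset.range n, μ k) ≤
      2 * π * (geomG R * ∑ k ∈ Finset.range n, ν k) := by linarith
  exact le_of_mul_le_mul_left h3 Real.two_pi_pos

/-- The disk maximizes every normalized sum of the first eigenvalues. -/
theorem sum_neumannSpectrum_le (hR : IsRadiusFunction R) (hρ : 0 < ρ) {μ ν : ℕ → ℝ}
    (hμ : IsNeumannSpectrum β (starlikeDomain R) μ)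
    (hν : IsNeumannSpectrum β (starlikeDomain fun _ => ρ) ν) (n : ℕ) :
    ∑ j ∈ Finset.range n, μ j * areaOverG R ≤
      ∑ j ∈ Finset.range n, ν j * areaOverG (fun _ => ρ) := by
  obtain ⟨-, b, hb⟩ := hν
  choose g₁ g₂ hH hform using hb
  have h3 := mul_sum_neumannSpectrum_le hR hρ hμ b.orthonormal hH
    (fun j => hform j _ _ _ (hH j)) n
  rw [← Finset.sum_mul, ← Finset.sum_mul, areaOverG, areaOverG, geomG_const hρ, div_one,
    area_starlikeDomain hR, area_starlikeDomain (isRadiusFunction_const hρ), meanSquare_const]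
  rw [div_mul_eq_mul_div, div_le_iff₀ (pow_pos hρ 2)] at h3
  rw [mul_div_assoc', div_le_iff₀ (geomG_pos R)]
  linear_combination π * h3

end Sum

theorem theorem2p4 (β : ℝ) (hβ : β ≠ 0) :
    -- the Neumann spectrum exists and is positive
    (∀ R : ℝ → ℝ, IsRadiusFunction R →
      (∃ μ : ℕ → ℝ, IsNeumannSpectrum β (starlikeDomain R) μ) ∧
      ∀ μ : ℕ → ℝ, IsNeumannSpectrum β (starlikeDomain R) μ → ∀ j, 0 < μ j) ∧
    -- comparison with the centered disk of any radius `ρ`, which has the eigenvalues `ν`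
    ∀ R : ℝ → ℝ, IsRadiusFunction R → ∀ ρ : ℝ, 0 < ρ →
      ∀ μ ν : ℕ → ℝ, IsNeumannSpectrum β (starlikeDomain R) μ →
        IsNeumannSpectrum β (starlikeDomain (fun _ => ρ)) ν → ∀ n : ℕ, 1 ≤ n →
      μ 0 * areaOverG R ≤ ν 0 * areaOverG (fun _ => ρ) ∧
      (∀ s : ℝ, 0 < s → s ≤ 1 →
        (∑ j ∈ Finset.range n, μ j ^ s) ^ (1 / s) * areaOverG R ≤
          (∑ j ∈ Finset.range n, ν j ^ s) ^ (1 / s) * areaOverG (fun _ => ρ)) ∧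
      (∏ j ∈ Finset.range n, μ j) ^ (1 / (n : ℝ)) * areaOverG R ≤
        (∏ j ∈ Finset.range n, ν j) ^ (1 / (n : ℝ)) * areaOverG (fun _ => ρ) ∧
      (∀ Φ : ℝ → ℝ, ConcaveOn ℝ (Set.Ioi 0) Φ → MonotoneOn Φ (Set.Ioi 0) →
        ∑ j ∈ Finset.range n, Φ (μ j * areaOverG R) ≤
          ∑ j ∈ Finset.range n, Φ (ν j * areaOverG (fun _ => ρ))) ∧
      (∀ s : ℝ, s < 0 →
        ∑ j ∈ Finset.range n, (ν j * areaOverG (fun _ => ρ)) ^ s ≤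
          ∑ j ∈ Finset.range n, (μ j * areaOverG R) ^ s) ∧
      (∀ t : ℝ, 0 < t →
        ∑ j ∈ Finset.range n, Real.exp (-(ν j * areaOverG (fun _ => ρ) * t)) ≤
          ∑ j ∈ Finset.range n, Real.exp (-(μ j * areaOverG R * t))) := by
  refine ⟨fun R hR => ?_, fun R hR ρ hρ μ ν hμ hν n hn => ?_⟩
  · obtain ⟨δ, hΩ⟩ := hR.exists_isStarShapedAboutBall
    exact ⟨hΩ.exists_isNeumannSpectrum β, fun μ hμ => hΩ.neumannSpectrum_pos hβ hμ⟩
  · have hcon := isRadiusFunction_const hρ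
    obtain ⟨δ, hΩ⟩ := hR.exists_isStarShapedAboutBall
    obtain ⟨δ', hD⟩ := hcon.exists_isStarShapedAboutBall
    exact functionals_le_of_sum_le (areaOverG_pos hR) (areaOverG_pos hcon)
      (hΩ.neumannSpectrum_pos hβ hμ) (hD.neumannSpectrum_pos hβ hν) hν.1
      (sum_neumannSpectrum_le hR hρ hμ hν) n hn
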